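/- Let $d\ge 2$, let $I_1,\dots,I_d\subset\mathbb R$ be nonempty open intervals and fix $e_i\in I_i$. For each $i$ let $m_i$ be a fully supported Radon measure on $I_i$, and let $\mathtt s_i:I_i\to\mathbb R$ be a scaling function, i.e. continuous and strictly increasing. For such a pair $(\mathtt s,m)$ on an open interval $I$, put $$\mathcal E^{(\mathtt s,m)}(u,v)=\frac12\int_I\frac{du}{d\mathtt s}\frac{dv}{d\mathtt s}\,d\mathtt s$$ for $u,v\in L^2(I,m)$ that are absolutely continuous with respect to $\mathtt s$ with derivative in $L^2(I,d\mathtt s)$, and let $\mathcal F^{(\mathtt s,m)}_0$ be the closure of $\{\varphi\circ\mathtt s:\varphi\in C_c^\infty(\mathtt s(I))\}$ in the norm $\|u\|_{\mathcal E_1}^2=\mathcal E^{(\mathtt s,m)}(u,u)+\|u\|_{L^2(m)}^2$. A minimal diffusion on $I$ with scaling function $\mathtt s$, speed measure $m$ and no killing inside is an $m$-symmetric diffusion (with a lifetime) whose Dirichlet form on $L^2(I,m)$ is $(\mathcal E^{(\mathtt s,m)},\mathcal F^{(\mathtt s,m)}_0)$; here the Dirichlet form of a $\mu$-symmetric process with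 transition function $p_t$ is $\mathcal E(u,v)=\lim_{t\downarrow0}\frac1t(u-p_tu,v)_\mu$, with domain the set of all $u\in L^2(\mu)$ for which $\lim_{t\downarrow 0}\frac1t(u-p_tu,u)_\mu$ is finite. For each $i$ let $\mathbf X^i$ be a minimal diffusion on $I_i$ with scaling function $\mathtt s_i$, speed measure $m_i$ and no killing inside. Put $E=I_1\times\dots\times I_d$ and $m=m_1\times\dots\times m_d$, and let $(\mathcal E,\mathcal F)$ be the Dirichlet form on $L^2(E,m)$ of the Cartesian product $\mathbf X$ of $\mathbf X^1,\dots,\mathbf X^d$, i.e. of the process with independent components distributed as the $\mathbf X^i$, which lives as long as all of its components are alive. Let $g_i$ be the density of the absolutely continuous part in the Lebesgue decomposition of the measure $d\mathtt s_i$ on $I_i$ with respect to Lebesgue measure, and let $\bar{\mathtt s}_i(x)=\int_{e_i}^x g_i(y)\,dy$. Assume $C_c^\infty(E)\subset\mathcal F$, and let $(\bar{\mathcal E},\bar{\mathcal F})$ be the restriction of $\mathcal E$ to the closure $\bar{\mathcal F}$ of $C_c^\infty(E)$ in $\mathcal F$ with respect to the norm $\|u\|_{\mathcal E_1}=(\mathcal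 E(u,u)+\|u\|_{L^2(m)}^2)^{1/2}$. Then: 1. Each $\bar{\mathtt s}_i$ is a scaling function on $I_i$, and $(\bar{\mathcal E},\bar{\mathcal F})$ is the Dirichlet form on $L^2(E,m)$ of the Cartesian product of $\bar{\mathbf X}^1,\dots,\bar{\mathbf X}^d$, where $\bar{\mathbf X}^i$ is the minimal diffusion on $I_i$ with scaling function $\bar{\mathtt s}_i$, speed measure $m_i$ and no killing inside. At the level of forms, $(\bar{\mathcal E},\bar{\mathcal F})$ is the Cartesian product of the forms $(\mathcal E^{(\bar{\mathtt s}_i,m_i)},\mathcal F_0^{(\bar{\mathtt s}_i,m_i)})$: it is a closed form, the linear span of the products $f_1\otimes\dots\otimes f_d$ with $f_i\in\mathcal F_0^{(\bar{\mathtt s}_i,m_i)}$ is an $\mathcal E_1$-dense subspace of $\bar{\mathcal F}$, and $$\bar{\mathcal E}(f_1\otimes\dots\otimes f_d,\;h_1\otimes\dots\otimes h_d)=\sum_{i=1}^d\mathcal E^{(\bar{\mathtt s}_i,m_i)}(f_i,h_i)\prod_{j\ne i}(f_j,h_j)_{m_j}\qquad(f_i,h_i\in\mathcal F_0^{(\bar{\mathtt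 s}_i,m_i)}).$$ 2. $C_c^\infty(E)$ is a special standard core of $(\mathcal E,\mathcal F)$ if and only if every $\mathtt s_i$ is absolutely continuous (on compact subintervals of $I_i$). Here a special standard core is a linear subspace $\mathcal C$ of $\mathcal F\cap C_c(E)$ such that: $\mathcal C$ is $\mathcal E_1$-dense in $\mathcal F$; $\mathcal C$ is a subalgebra, uniformly dense in $C_c(E)$; for every $\varepsilon>0$ there is a function $\varphi_\varepsilon:\mathbb R\to[-\varepsilon,1+\varepsilon]$ with $\varphi_\varepsilon(t)=t$ on $[0,1]$ and $0\le\varphi_\varepsilon(t')-\varphi_\varepsilon(t)\le t'-t$ for $t<t'$, such that $\varphi_\varepsilon\circ u\in\mathcal C$ for all $u\in\mathcal C$; and for every compact $K$ and relatively compact open $G\supset K$ in $E$ there is $u\in\mathcal C$ with $u\ge0$, $u=1$ on $K$ and $u=0$ off $G$. -/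

import Mathlib

open MeasureTheory Filter Topology Set
open scoped NNReal ENNReal

universe w w'

noncomputable section

namespace Diffusion

/-! ## Symmetric forms on an `L²` space -/

/-- A symmetric form on `L²(S, μ)`: a domain and a bilinear form; the values of `form` are meaningful
for arguments in `dom` only. -/
structure L2Form {S : Type*} [MeasurableSpace S] (μ : Measure S) where
  /-- The domain. -/
  dom : Set (Lp ℝ 2 μ)
  /-- The form. -/
  form : Lp ℝ 2 μ → Lp ℝ 2 μ → ℝ

/-- The elements of `L²(S, μ)` that are the class of a function in `C`. -/
def toL2 {S : Type*} [MeasurableSpace S] (μ : Measure S) (C : Set (S → ℝ)) : Set (Lp ℝ 2 μ) :=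
  {u | ∃ f ∈ C, u =ᵐ[μ] f}

namespace L2Form

variable {S : Type*} [MeasurableSpace S] {μ : Measure S}

/-- Two forms are the same: same domain, and same values on it. -/
def Agree (q r : L2Form μ) : Prop :=
  q.dom = r.dom ∧ ∀ u ∈ q.dom, ∀ v ∈ q.dom, q.form u v = r.form u v

/-- The squared `ℰ₁`-norm `ℰ₁(u,u) = ℰ(u,u) + ‖u‖²`. -/
def energyOne (q : L2Form μ) (u : Lp ℝ 2 μ) : ℝ := q.form u u + ‖u‖ ^ 2

/-- The restriction of a form to the `ℰ₁`-closure, in its domain, of a set `C` of elements of its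
domain. -/
def closureOf (q : L2Form μ) (C : Set (Lp ℝ 2 μ)) : L2Form μ where
  dom := {u | u ∈ q.dom ∧ ∃ f : ℕ → Lp ℝ 2 μ, (∀ n, f n ∈ C) ∧
    Tendsto (fun n => q.energyOne (u - f n)) atTop (𝓝 0)}
  form := q.form

/-- Closed symmetric forms: a nonnegative symmetric bilinear form on a linear subspace that is
complete for the `ℰ₁`-norm. -/
structure IsClosedForm (q : L2Form μ) : Prop where
  zero_mem : (0 : Lp ℝ 2 μ) ∈ q.dom
  add_mem : ∀ u ∈ q.dom, ∀ v ∈ q.dom, u + v ∈ q.dom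
  smul_mem : ∀ (c : ℝ), ∀ u ∈ q.dom, c • u ∈ q.dom
  form_symm : ∀ u ∈ q.dom, ∀ v ∈ q.dom, q.form u v = q.form v u
  form_add : ∀ u ∈ q.dom, ∀ v ∈ q.dom, ∀ w ∈ q.dom, q.form (u + v) w = q.form u w + q.form v w
  form_smul : ∀ (c : ℝ), ∀ u ∈ q.dom, ∀ v ∈ q.dom, q.form (c • u) v = c * q.form u v
  form_nonneg : ∀ u ∈ q.dom, 0 ≤ q.form u u
  complete : ∀ f : ℕ → Lp ℝ 2 μ, (∀ n, f n ∈ q.dom) →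
    (∀ ε : ℝ, 0 < ε → ∃ N, ∀ j ≥ N, ∀ k ≥ N, q.energyOne (f j - f k) < ε) →
    ∃ u ∈ q.dom, Tendsto (fun n => q.energyOne (u - f n)) atTop (𝓝 0)

/-- Special standard cores of a form on `L²(S, μ)`. -/
structure IsSpecialStandardCore [TopologicalSpace S] (q : L2Form μ) (C : Set (S → ℝ)) : Prop where
  /-- The elements of `C` are continuous functions with compact support ... -/
  subset_continuous : ∀ f ∈ C, Continuous f ∧ HasCompactSupport f
  /-- ... that belong to the domain. -/
  subset_dom : ∀ f ∈ C, ∃ u ∈ q.dom, u =ᵐ[μ] f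
  /-- `C` is `ℰ₁`-dense in the domain. -/
  dense_dom : ∀ u ∈ q.dom, u ∈ (q.closureOf (toL2 μ C)).dom
  /-- `C` is uniformly dense in the continuous functions with compact support. -/
  dense_uniform : ∀ h : S → ℝ, Continuous h → HasCompactSupport h → ∀ ε : ℝ, 0 < ε →
    ∃ f ∈ C, ∀ x, |h x - f x| ≤ ε
  /-- `C` is a linear space and an algebra. -/
  add_mem : ∀ f ∈ C, ∀ g ∈ C, f + g ∈ C
  smul_mem : ∀ (c : ℝ), ∀ f ∈ C, c • f ∈ C
  mul_mem : ∀ f ∈ C, ∀ g ∈ C, f * g ∈ C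
  /-- `C` is stable under an approximate unit contraction. -/
  contraction : ∀ ε : ℝ, 0 < ε → ∃ φ : ℝ → ℝ, (∀ t ∈ Icc (0 : ℝ) 1, φ t = t) ∧
    (∀ t, φ t ∈ Icc (-ε) (1 + ε)) ∧
    (∀ t t', t < t' → 0 ≤ φ t' - φ t ∧ φ t' - φ t ≤ t' - t) ∧
    ∀ f ∈ C, φ ∘ f ∈ C
  /-- `C` contains cut-off functions. -/
  cutoff : ∀ K G : Set S, IsCompact K → IsOpen G → IsCompact (closure G) → K ⊆ G →
    ∃ f ∈ C, (∀ x, 0 ≤ f x) ∧ (∀ x ∈ K, f x = 1) ∧ ∀ x ∉ G, f x = 0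

end L2Form

/-! ## Markov processes with a lifetime and their Dirichlet forms -/

/-- The data of a process with state space `S`: a sample space, a measure `P x` for each starting
point, the position `X t` at time `t` (meaningful only before the lifetime), and the lifetime `ζ`. -/
structure KilledProcess.{a, b} (S : Type b) where
  /-- The sample space. -/
  Ω : Type a
  /-- Its `σ`-algebra. -/
  mΩ : MeasurableSpace Ω
  /-- The law of the process started at a point. -/
  P : S → @Measure Ω mΩ
  /-- The position. -/
  X : ℝ≥0 → Ω → S
  /-- The lifetime. -/
  ζ : Ω → ℝ≥0∞

attribute [instance] KilledProcess.mΩ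

namespace KilledProcess

section

variable {S : Type*} (X : KilledProcess S)

/-- The event that the process is alive at time `t`, and in `B`. -/
def visit (t : ℝ≥0) (B : Set S) : Set X.Ω := {ω | (t : ℝ≥0∞) < X.ζ ω ∧ X.X t ω ∈ B}

/-- The `σ`-algebra generated by the process up to time `t`. -/
@[reducible] def history [MeasurableSpace S] (t : ℝ≥0) : MeasurableSpace X.Ω :=
  MeasurableSpace.generateFrom {A | ∃ r ≤ t, ∃ B : Set S, MeasurableSet B ∧ A = X.visit r B}

/-- Normal Markov processes whose paths are continuous up to the lifetime. -/
structure IsContinuousMarkov [TopologicalSpace S] [MeasurableSpace S] : Prop where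
  prob : ∀ x, IsProbabilityMeasure (X.P x)
  measurable_visit : ∀ t B, MeasurableSet B → MeasurableSet (X.visit t B)
  measurable_law : ∀ t B, MeasurableSet B → Measurable fun x => X.P x (X.visit t B)
  start : ∀ x, ∀ᵐ ω ∂(X.P x), 0 < X.ζ ω ∧ X.X 0 ω = x
  continuous_paths : ∀ x, ∀ᵐ ω ∂(X.P x),
    ContinuousOn (fun t => X.X t ω) {t : ℝ≥0 | (t : ℝ≥0∞) < X.ζ ω}
  markov : ∀ (x : S) (t r : ℝ≥0) (A : Set X.Ω) (B : Set S),
    MeasurableSet[X.history t] A → MeasurableSet B →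
    X.P x (A ∩ X.visit (t + r) B) =
      ∫⁻ ω in A ∩ X.visit t univ, X.P (X.X t ω) (X.visit r B) ∂(X.P x)

/-- Symmetry of the transition function with respect to `μ`. -/
def IsSymmetric [MeasurableSpace S] (μ : Measure S) : Prop :=
  ∀ (t : ℝ≥0) (A B : Set S), MeasurableSet A → MeasurableSet B →
    ∫⁻ x in A, X.P x (X.visit t B) ∂μ = ∫⁻ x in B, X.P x (X.visit t A) ∂μ

/-- The transition function `p_t f (x) = 𝐄ˣ[f(X_t); t < ζ]`. -/
def transition (t : ℝ≥0) (f : S → ℝ) (x : S) : ℝ :=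
  ∫ ω in X.visit t univ, f (X.X t ω) ∂(X.P x)

/-- The approximating form `t⁻¹ (u - p_t u, v)_μ`. -/
def approxForm [MeasurableSpace S] (μ : Measure S) (t : ℝ≥0) (u v : Lp ℝ 2 μ) : ℝ :=
  (t : ℝ)⁻¹ * ∫ x, (u x - X.transition t u x) * v x ∂μ

/-- The Dirichlet form on `L²(S, μ)` associated with a `μ`-symmetric process:
`ℰ(u,v) = lim_{t ↓ 0} t⁻¹ (u - p_t u, v)_μ`, with domain the set of the `u` for which
`t⁻¹ (u - p_t u, u)_μ` has a finite limit. -/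
def dirichletForm [MeasurableSpace S] (μ : Measure S) : L2Form μ where
  dom := {u | ∃ l : ℝ, Tendsto (fun t => X.approxForm μ t u u) (𝓝[>] 0) (𝓝 l)}
  form u v := limUnder (𝓝[>] 0) fun t => X.approxForm μ t u v

end

/-- The Cartesian product of processes: the components are independent copies of the given
processes, and the product lives as long as all of them are alive. -/
def cartesian {ι : Type*} [Fintype ι] {S : ι → Type*} (X : ∀ i, KilledProcess (S i)) :
    KilledProcess (∀ i, S i) where
  Ω := ∀ i, (X i).Ω
  mΩ := inferInstance
  P x := Measure.pi fun i => (X i).P (x i)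
  X t ω i := (X i).X t (ω i)
  ζ ω := ⨅ i, (X i).ζ (ω i)

end KilledProcess

/-! ## One-dimensional minimal diffusions -/

/-- `φ ∈ C_c^∞(U)`, as a function on the whole space. -/
def IsTest {V : Type*} [NormedAddCommGroup V] [NormedSpace ℝ V] (U : Set V) (φ : V → ℝ) : Prop :=
  ContDiff ℝ ((⊤ : ℕ∞) : WithTop ℕ∞) φ ∧ HasCompactSupport φ ∧ tsupport φ ⊆ U

section OneDim

variable {I : Set ℝ}

/-- Scaling functions: continuous and strictly increasing. -/
def IsScale (s : I → ℝ) : Prop := Continuous s ∧ StrictMono s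

/-- The Stieltjes measure `ds` on `I` of a scaling function: `ds(A)` is the Lebesgue measure of
`s(A)`, so that `ds((x,y]) = s(y) - s(x)`. -/
def scaleMeasure (s : I → ℝ) : Measure I := Measure.comap s volume

/-- `u` is absolutely continuous with respect to `s`, with `du/ds = w ∈ L²(I, ds)`. -/
def IsScaleDeriv (s u w : I → ℝ) : Prop :=
  MemLp w 2 (scaleMeasure s) ∧
    ∀ x y, x ≤ y → u y - u x = ∫ z in Ioc x y, w z ∂(scaleMeasure s)

open scoped Classical in
/-- The derivative `du/ds` of (an absolutely continuous version of) `u`. -/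
def scaleDeriv (s : I → ℝ) (m : Measure I) (u : Lp ℝ 2 m) : I → ℝ :=
  if h : ∃ w, ∃ u' : I → ℝ, u =ᵐ[m] u' ∧ IsScaleDeriv s u' w then h.choose else 0

/-- The form `ℰ(u,v) = (1/2) ∫ (du/ds)(dv/ds) ds` on the space of all `u ∈ L²(I, m)` that are
absolutely continuous with respect to `s` with `du/ds ∈ L²(I, ds)`. -/
def fullScaleForm (s : I → ℝ) (m : Measure I) : L2Form m where
  dom := {u | ∃ w, ∃ u' : I → ℝ, u =ᵐ[m] u' ∧ IsScaleDeriv s u' w}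
  form u v := (1 / 2) * ∫ z, scaleDeriv s m u z * scaleDeriv s m v z ∂(scaleMeasure s)

/-- The form `(ℰ^{(s,m)}, ℱ₀^{(s,m)})`: the domain is the `ℰ₁`-closure of
`{φ ∘ s : φ ∈ C_c^∞(J)}`, where `J = s(I)`. -/
def minimalScaleForm (s : I → ℝ) (m : Measure I) : L2Form m :=
  (fullScaleForm s m).closureOf (toL2 m {f | ∃ φ : ℝ → ℝ, IsTest (range s) φ ∧ f = φ ∘ s})

/-- `X` is a minimal diffusion on `I` with scaling function `s`, speed measure `m` and no killing
inside: it is `m`-symmetric with Dirichlet form `(ℰ^{(s,m)}, ℱ₀^{(s,m)})`. -/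
def IsMinimalDiffusion (X : KilledProcess I) (s : I → ℝ) (m : Measure I) : Prop :=
  X.IsContinuousMarkov ∧ X.IsSymmetric m ∧ (X.dirichletForm m).Agree (minimalScaleForm s m)

/-- The Lebesgue measure on `I`. -/
def lebesgueOn (I : Set ℝ) : Measure I := Measure.comap Subtype.val volume

/-- The absolutely continuous part `s̄(x) = ∫_e^x g(y) dy` of a scaling function `s`, where `g` is the
density in the Lebesgue decomposition of `ds`. -/
def acPart (s : I → ℝ) (e : I) (x : I) : ℝ :=
  (∫ y in Ioc e x, ((scaleMeasure s).rnDeriv (lebesgueOn I) y).toReal ∂(lebesgueOn I)) -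
    ∫ y in Ioc x e, ((scaleMeasure s).rnDeriv (lebesgueOn I) y).toReal ∂(lebesgueOn I)

/-- Absolute continuity of a function on an open interval, i.e. on its compact subintervals. -/
def IsAbsCont (s : I → ℝ) : Prop :=
  ∀ a b : I, AbsolutelyContinuousOnInterval (Function.extend Subtype.val s 0) a b

end OneDim

/-! ## Products -/

section Product

variable {d : ℕ} {I : Fin d → Set ℝ}

/-- `C_c^∞(E)` for the box `E = I₁ × ⋯ × I_d`, as a set of functions on `E`. -/
def smoothBox (I : Fin d → Set ℝ) : Set ((∀ i, I i) → ℝ) :=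
  {f | ∃ φ : (Fin d → ℝ) → ℝ, IsTest (univ.pi I) φ ∧ f = fun x => φ fun i => x i}

/-- The elements `u(x) = u₁(x₁) ⋯ u_d(x_d)` of `L²(E, m)` with `uᵢ` in the domain of the `i`-th form. -/
def tensors {m : ∀ i, Measure (I i)} (p : ∀ i, L2Form (m i)) : Set (Lp ℝ 2 (Measure.pi m)) :=
  {u | ∃ f : ∀ i, Lp ℝ 2 (m i), (∀ i, f i ∈ (p i).dom) ∧
    u =ᵐ[Measure.pi m] fun x => ∏ i, f i (x i)}

/-- `q` is the Cartesian product of the forms `p i`: the closed form that has the span of the tensor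
products as an `ℰ₁`-dense subspace, on which it is given by
`ℰ(⊗ fᵢ, ⊗ gᵢ) = ∑ᵢ ℰⁱ(fᵢ, gᵢ) ∏_{j ≠ i} (fⱼ, gⱼ)`. -/
structure IsCartesianForm {m : ∀ i, Measure (I i)} (q : L2Form (Measure.pi m))
    (p : ∀ i, L2Form (m i)) : Prop where
  closed : q.IsClosedForm
  tensors_subset : tensors p ⊆ q.dom
  form_tensors : ∀ f g : ∀ i, Lp ℝ 2 (m i), (∀ i, f i ∈ (p i).dom) → (∀ i, g i ∈ (p i).dom) →
    ∀ u v : Lp ℝ 2 (Measure.pi m), (u =ᵐ[Measure.pi m] fun x => ∏ i, f i (x i)) →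
      (v =ᵐ[Measure.pi m] fun x => ∏ i, g i (x i)) →
      q.form u v = ∑ i, (p i).form (f i) (g i) *
        ∏ j ∈ Finset.univ.erase i, ∫ z, f j z * g j z ∂(m j)
  dense : ∀ u ∈ q.dom,
    u ∈ (q.closureOf (Submodule.span ℝ (tensors p) : Set (Lp ℝ 2 (Measure.pi m)))).dom

end Product

end Diffusion

end

/-! The processes enter only through their semigroups on `L²`. A symmetric Markov process with
continuous paths has a strongly continuous semigroup of symmetric contractions, and the semigroup of
a Cartesian product acts on tensors factor by factor. Differentiating this at time zero gives a
Leibniz formula, so the Dirichlet form of the product is the Cartesian product of the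
one-dimensional forms (`isCartesianForm_of_semigroup`).

Testing the hypothesis `C_c^∞(E) ⊆ ℱ` on products of functions of one variable yields `C_c^∞(Iᵢ) ⊆
ℱ₀` for every factor (`mem_dom_of_tens_mem_dom`). A test function that equals `x` on `[a, b]` then
shows that `dx` has a locally square integrable density `k` with respect to `ds`. Hence `dx ≪ ds`,
the density `g` of `ds` is positive almost everywhere, and `s̄` is strictly increasing. Moreover
`ds̄` is the restriction of `ds` to a set of full Lebesgue measure on which the singular part
vanishes (`regSet`), and `dx = k ds̄`. A function with derivative `w` with respect to `s̄` has with
respect to `s` the derivative `w` extended by zero to the singular set, so the form of `s` extends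
that of `s̄`.

The one-dimensional core is `IsScaleChange.exists_test_energy_lt`: if `dτ = k ds` with `k > 0`
locally in `L²(ds)`, then compactly supported functions of finite energy are `ℰ₁`-limits of smooth
functions of `τ`. For the scale `s̄` and `τ(x) = x` it says that `C_c^∞(I)` is dense in the minimal
domain of `s̄`.

On the box, both inclusions between the closure of `C_c^∞(E)` and the product of the minimal forms
of the `s̄ᵢ` rest on `mem_closureOf_of_bounded`: an `L²`-limit of a sequence bounded in energy is in
the `ℰ₁`-closure of its span. Tensors are limits of products of test functions. Conversely, a test
function on `E` is a uniform limit of finite sums of products whose partial derivatives stay bounded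
(`exists_sum_prod_approx`), hence whose energies stay bounded.

For the second claim, everything in the span of the tensors for `s̄` has its `i`-th derivative equal
to zero on the singular set of `dsᵢ`. If that set had positive `dsᵢ`-measure, some tensor in `ℱ`
would keep a positive `ℰ₁`-distance from this span. Conversely, for absolutely continuous `sᵢ` the
functions `s̄ᵢ` and `sᵢ` differ by a constant, and the two product forms coincide. -/

noncomputable section

namespace Diffusion

/-! ### Closed forms, closures of subspaces, and limits of bounded energy -/

namespace L2Form

variable {S : Type*} [MeasurableSpace S] {μ : Measure S} {q r : L2Form μ}

namespace IsClosedForm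

/-- The domain of a closed form, as a submodule. -/
def domain (hq : q.IsClosedForm) : Submodule ℝ (Lp ℝ 2 μ) where
  carrier := q.dom
  add_mem' := fun {u v} hu hv => hq.add_mem u hu v hv
  zero_mem' := hq.zero_mem
  smul_mem' := fun c u hu => hq.smul_mem c u hu

theorem sub_mem (hq : q.IsClosedForm) {u v : Lp ℝ 2 μ} (hu : u ∈ q.dom) (hv : v ∈ q.dom) :
    u - v ∈ q.dom := hq.domain.sub_mem hu hv

/-- A closed form, as a bilinear map on its domain. -/
def bilin (hq : q.IsClosedForm) : hq.domain →ₗ[ℝ] hq.domain →ₗ[ℝ] ℝ :=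
  LinearMap.mk₂ ℝ (fun u v => q.form u v)
    (fun u v w => hq.form_add u u.2 v v.2 w w.2)
    (fun c u v => hq.form_smul c u u.2 v v.2)
    (fun u v w => by
      have h1 := hq.form_symm u u.2 (v + w) (hq.add_mem v v.2 w w.2)
      have h2 := hq.form_add v v.2 w w.2 u u.2
      have h3 := hq.form_symm u u.2 v v.2
      have h4 := hq.form_symm u u.2 w w.2
      simp only [Submodule.coe_add]
      linarith)
    (fun c u v => by
      have h1 := hq.form_symm u u.2 (c • v) (hq.smul_mem c v v.2)
      have h2 := hq.form_smul c v v.2 u u.2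
      have h3 := hq.form_symm u u.2 v v.2
      simp only [Submodule.coe_smul, smul_eq_mul]
      rw [h1, h2, h3])

theorem bilin_apply (hq : q.IsClosedForm) (u v : hq.domain) : hq.bilin u v = q.form u v := rfl

theorem form_sub_left (hq : q.IsClosedForm) {u v w : Lp ℝ 2 μ} (hu : u ∈ q.dom) (hv : v ∈ q.dom)
    (hw : w ∈ q.dom) : q.form (u - v) w = q.form u w - q.form v w := by
  have := map_sub hq.bilin ⟨u, hu⟩ ⟨v, hv⟩
  exact congrArg (fun f => f ⟨w, hw⟩) this

theorem form_sub_right (hq : q.IsClosedForm) {u v w : Lp ℝ 2 μ} (hu : u ∈ q.dom) (hv : v ∈ q.dom)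
    (hw : w ∈ q.dom) : q.form w (u - v) = q.form w u - q.form w v := by
  rw [hq.form_symm w hw _ (hq.sub_mem hu hv), hq.form_sub_left hu hv hw, hq.form_symm u hu w hw,
    hq.form_symm v hv w hw]

theorem form_add_right (hq : q.IsClosedForm) {u v w : Lp ℝ 2 μ} (hu : u ∈ q.dom) (hv : v ∈ q.dom)
    (hw : w ∈ q.dom) : q.form w (u + v) = q.form w u + q.form w v := by
  rw [hq.form_symm w hw _ (hq.add_mem u hu v hv), hq.form_add u hu v hv w hw,
    hq.form_symm u hu w hw, hq.form_symm v hv w hw]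

theorem form_zero_left (hq : q.IsClosedForm) {u : Lp ℝ 2 μ} (hu : u ∈ q.dom) : q.form 0 u = 0 := by
  have := hq.form_smul 0 0 hq.zero_mem u hu
  simpa using this

theorem energyOne_zero (hq : q.IsClosedForm) : q.energyOne 0 = 0 := by
  simp [energyOne, hq.form_zero_left hq.zero_mem]

theorem energyOne_nonneg (hq : q.IsClosedForm) {u : Lp ℝ 2 μ} (hu : u ∈ q.dom) :
    0 ≤ q.energyOne u := add_nonneg (hq.form_nonneg u hu) (sq_nonneg _)

theorem form_le_energyOne (u : Lp ℝ 2 μ) : q.form u u ≤ q.energyOne u :=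
  le_add_of_nonneg_right (sq_nonneg _)

theorem norm_sq_le_energyOne (hq : q.IsClosedForm) {u : Lp ℝ 2 μ} (hu : u ∈ q.dom) :
    ‖u‖ ^ 2 ≤ q.energyOne u := le_add_of_nonneg_left (hq.form_nonneg u hu)

theorem energyOne_smul (hq : q.IsClosedForm) (c : ℝ) {u : Lp ℝ 2 μ} (hu : u ∈ q.dom) :
    q.energyOne (c • u) = c ^ 2 * q.energyOne u := by
  have h := hq.smul_mem c u hu
  rw [energyOne, energyOne, hq.form_smul c u hu _ h, hq.form_symm u hu _ h,
    hq.form_smul c u hu u hu, norm_smul, mul_pow, Real.norm_eq_abs, sq_abs]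
  ring

theorem energyOne_parallelogram (hq : q.IsClosedForm) {u v : Lp ℝ 2 μ} (hu : u ∈ q.dom)
    (hv : v ∈ q.dom) :
    q.energyOne (u + v) + q.energyOne (u - v) = 2 * (q.energyOne u + q.energyOne v) := by
  have ha := hq.add_mem u hu v hv
  have hs := hq.sub_mem hu hv
  have h1 := parallelogram_law_with_norm ℝ u v
  have h2 := hq.form_add u hu v hv _ ha
  have h3 := hq.form_sub_left hu hv hs
  rw [hq.form_add_right hu hv hu, hq.form_add_right hu hv hv] at h2
  rw [hq.form_sub_right hu hv hu, hq.form_sub_right hu hv hv] at h3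
  simp only [energyOne]
  rw [h2, h3]
  linarith

theorem energyOne_add_le (hq : q.IsClosedForm) {u v : Lp ℝ 2 μ} (hu : u ∈ q.dom)
    (hv : v ∈ q.dom) : q.energyOne (u + v) ≤ 2 * (q.energyOne u + q.energyOne v) := by
  have := hq.energyOne_parallelogram hu hv
  have := hq.energyOne_nonneg (hq.sub_mem hu hv)
  linarith

theorem energyOne_sub_le (hq : q.IsClosedForm) {u v w : Lp ℝ 2 μ} (hu : u ∈ q.dom)
    (hv : v ∈ q.dom) (hw : w ∈ q.dom) :
    q.energyOne (u - w) ≤ 2 * (q.energyOne (u - v) + q.energyOne (v - w)) := by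
  have := hq.energyOne_add_le (hq.sub_mem hu hv) (hq.sub_mem hv hw)
  rwa [sub_add_sub_cancel] at this

theorem energyOne_sub_comm (hq : q.IsClosedForm) {u v : Lp ℝ 2 μ} (hu : u ∈ q.dom)
    (hv : v ∈ q.dom) : q.energyOne (u - v) = q.energyOne (v - u) := by
  have := hq.energyOne_smul (-1) (hq.sub_mem hu hv)
  rw [neg_one_smul, neg_sub] at this
  rw [this]; ring

theorem form_sq_le (hq : q.IsClosedForm) {u v : Lp ℝ 2 μ} (hu : u ∈ q.dom) (hv : v ∈ q.dom) :
    q.form u v ^ 2 ≤ q.form u u * q.form v v := by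
  have h : ∀ t : ℝ, 0 ≤ q.form v v * (t * t) + (2 * q.form u v) * t + q.form u u := by
    intro t
    have htv := hq.smul_mem t v hv
    have h0 := hq.form_nonneg _ (hq.add_mem u hu _ htv)
    rw [hq.form_add u hu _ htv _ (hq.add_mem u hu _ htv), hq.form_add_right hu htv hu,
      hq.form_add_right hu htv htv, hq.form_symm u hu _ htv, hq.form_smul t v hv u hu,
      hq.form_smul t v hv _ htv, hq.form_symm v hv _ htv, hq.form_smul t v hv v hv,
      hq.form_symm v hv u hu] at h0
    linarith
  have := discrim_le_zero h
  rw [discrim] at this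
  nlinarith

theorem abs_form_le (hq : q.IsClosedForm) {u v : Lp ℝ 2 μ} (hu : u ∈ q.dom) (hv : v ∈ q.dom) :
    |q.form u v| ≤ √(q.energyOne u) * √(q.energyOne v) := by
  rw [← Real.sqrt_mul (hq.energyOne_nonneg hu)]
  apply Real.abs_le_sqrt
  refine (hq.form_sq_le hu hv).trans ?_
  exact mul_le_mul (form_le_energyOne u) (form_le_energyOne v) (hq.form_nonneg v hv)
    (hq.energyOne_nonneg hu)

theorem tendsto_form (hq : q.IsClosedForm) {f g : ℕ → Lp ℝ 2 μ} {u v : Lp ℝ 2 μ}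
    (hf : ∀ n, f n ∈ q.dom) (hg : ∀ n, g n ∈ q.dom) (hu : u ∈ q.dom) (hv : v ∈ q.dom)
    (hfu : Tendsto (fun n => q.energyOne (u - f n)) atTop (𝓝 0))
    (hgv : Tendsto (fun n => q.energyOne (v - g n)) atTop (𝓝 0)) :
    Tendsto (fun n => q.form (f n) (g n)) atTop (𝓝 (q.form u v)) := by
  have key : ∀ n, |q.form (f n) (g n) - q.form u v| ≤
      √(q.energyOne (u - f n)) * √(q.energyOne v) + √(q.energyOne u) * √(q.energyOne (v - g n)) +
      √(q.energyOne (u - f n)) * √(q.energyOne (v - g n)) := by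
    intro n
    have h1 := hq.abs_form_le (hq.sub_mem hu (hf n)) hv
    have h2 := hq.abs_form_le hu (hq.sub_mem hv (hg n))
    have h3 := hq.abs_form_le (hq.sub_mem hu (hf n)) (hq.sub_mem hv (hg n))
    have e1 := hq.form_sub_left hu (hf n) hv
    have e2 := hq.form_sub_right hv (hg n) hu
    have e3 := hq.form_sub_left hu (hf n) (hq.sub_mem hv (hg n))
    rw [hq.form_sub_right hv (hg n) hu, hq.form_sub_right hv (hg n) (hf n)] at e3
    have : q.form (f n) (g n) - q.form u v =
        -q.form (u - f n) v - q.form u (v - g n) + q.form (u - f n) (v - g n) := by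
      rw [e1, e2, e3]; ring
    rw [this]
    refine (abs_add_le _ _).trans (add_le_add ((abs_sub _ _).trans (add_le_add ?_ h2)) h3)
    rwa [abs_neg]
  have s1 : Tendsto (fun n => √(q.energyOne (u - f n))) atTop (𝓝 0) := by
    simpa using hfu.sqrt
  have s2 : Tendsto (fun n => √(q.energyOne (v - g n))) atTop (𝓝 0) := by
    simpa using hgv.sqrt
  have s3 := ((s1.mul_const (√(q.energyOne v))).add (s2.const_mul (√(q.energyOne u)))).add
    (s1.mul s2)
  simp only [zero_mul, mul_zero, add_zero] at s3
  rw [tendsto_iff_norm_sub_tendsto_zero]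
  exact squeeze_zero (fun _ => norm_nonneg _) key s3

theorem tendsto_of_energyOne (hq : q.IsClosedForm) {f : ℕ → Lp ℝ 2 μ} {u : Lp ℝ 2 μ}
    (hf : ∀ n, f n ∈ q.dom) (hu : u ∈ q.dom)
    (hfu : Tendsto (fun n => q.energyOne (u - f n)) atTop (𝓝 0)) : Tendsto f atTop (𝓝 u) := by
  rw [tendsto_iff_norm_sub_tendsto_zero]
  refine squeeze_zero (fun _ => norm_nonneg _) (fun n => ?_) (g := fun n => √(q.energyOne (u - f n)))
    (by simpa using hfu.sqrt)
  rw [norm_sub_rev]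
  exact Real.le_sqrt_of_sq_le (hq.norm_sq_le_energyOne (hq.sub_mem hu (hf n)))

theorem cauchy_of_energyOne (hq : q.IsClosedForm) {f : ℕ → Lp ℝ 2 μ} {u : Lp ℝ 2 μ}
    (hf : ∀ n, f n ∈ q.dom) (hu : u ∈ q.dom)
    (hfu : Tendsto (fun n => q.energyOne (u - f n)) atTop (𝓝 0)) (ε : ℝ) (hε : 0 < ε) :
    ∃ N, ∀ j ≥ N, ∀ k ≥ N, q.energyOne (f j - f k) < ε := by
  obtain ⟨N, hN⟩ := eventually_atTop.1 (hfu.eventually (gt_mem_nhds (show 0 < ε / 4 by linarith)))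
  refine ⟨N, fun j hj k hk => ?_⟩
  have h1 := hq.energyOne_sub_le (hf j) hu (hf k)
  rw [hq.energyOne_sub_comm (hf j) hu] at h1
  have := hN j hj
  have := hN k hk
  linarith

/-- The inclusion of `C` in the domain is needed to pass from `ε` to sequences: it makes the
energies of the differences nonnegative, so that they can be squeezed to zero. -/
theorem mem_closureOf_iff (hq : q.IsClosedForm) {C : Set (Lp ℝ 2 μ)} (hC : C ⊆ q.dom)
    {u : Lp ℝ 2 μ} :
    u ∈ (q.closureOf C).dom ↔ u ∈ q.dom ∧ ∀ ε > 0, ∃ f ∈ C, q.energyOne (u - f) < ε := by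
  constructor
  · rintro ⟨hu, f, hf, hlim⟩
    refine ⟨hu, fun ε hε => ?_⟩
    obtain ⟨n, hn⟩ := (hlim.eventually (gt_mem_nhds hε)).exists
    exact ⟨f n, hf n, hn⟩
  · rintro ⟨hu, h⟩
    choose f hf hlt using fun n : ℕ => h (1 / ((n : ℝ) + 1)) (by positivity)
    exact ⟨hu, f, hf, squeeze_zero (fun n => hq.energyOne_nonneg (hq.sub_mem hu (hC (hf n))))
      (fun n => (hlt n).le) tendsto_one_div_add_atTop_nhds_zero_nat⟩

theorem subset_closureOf (hq : q.IsClosedForm) {C : Set (Lp ℝ 2 μ)} (hC : C ⊆ q.dom) :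
    C ⊆ (q.closureOf C).dom := fun u hu =>
  (hq.mem_closureOf_iff hC).2 ⟨hC hu, fun ε hε => ⟨u, hu, by rwa [sub_self, hq.energyOne_zero]⟩⟩

theorem closureOf_subset (C : Set (Lp ℝ 2 μ)) : (q.closureOf C).dom ⊆ q.dom := fun _ h => h.1

/-- A set whose elements are in the closure of `C` has its closure contained in it. -/
theorem closureOf_closureOf (hq : q.IsClosedForm) {C D : Set (Lp ℝ 2 μ)} (hC : C ⊆ q.dom)
    (hD : D ⊆ (q.closureOf C).dom) : (q.closureOf D).dom ⊆ (q.closureOf C).dom := by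
  intro u hu
  have hDq : D ⊆ q.dom := hD.trans (closureOf_subset C)
  rw [hq.mem_closureOf_iff hDq] at hu
  refine (hq.mem_closureOf_iff hC).2 ⟨hu.1, fun ε hε => ?_⟩
  obtain ⟨f, hf, hlt⟩ := hu.2 (ε / 4) (by linarith)
  obtain ⟨g, hg, hlt'⟩ := ((hq.mem_closureOf_iff hC).1 (hD hf)).2 (ε / 4) (by linarith)
  refine ⟨g, hg, ?_⟩
  have := hq.energyOne_sub_le hu.1 (hDq hf) (hC hg)
  linarith

/-- The closure of a linear subspace of the domain, as a linear subspace. -/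
theorem isClosedForm_closureOf (hq : q.IsClosedForm) {M : Submodule ℝ (Lp ℝ 2 μ)}
    (hM : (M : Set (Lp ℝ 2 μ)) ⊆ q.dom) : (q.closureOf (M : Set (Lp ℝ 2 μ))).IsClosedForm where
  zero_mem := hq.subset_closureOf hM M.zero_mem
  add_mem := by
    intro u hu v hv
    rw [hq.mem_closureOf_iff hM] at hu hv ⊢
    refine ⟨hq.add_mem u hu.1 v hv.1, fun ε hε => ?_⟩
    obtain ⟨f, hf, hlt⟩ := hu.2 (ε / 4) (by linarith)
    obtain ⟨g, hg, hlt'⟩ := hv.2 (ε / 4) (by linarith)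
    refine ⟨f + g, M.add_mem hf hg, ?_⟩
    have := hq.energyOne_add_le (hq.sub_mem hu.1 (hM hf)) (hq.sub_mem hv.1 (hM hg))
    rw [add_sub_add_comm]
    linarith
  smul_mem := by
    intro c u hu
    rw [hq.mem_closureOf_iff hM] at hu ⊢
    refine ⟨hq.smul_mem c u hu.1, fun ε hε => ?_⟩
    obtain ⟨f, hf, hlt⟩ := hu.2 (ε / (c ^ 2 + 1)) (by positivity)
    refine ⟨c • f, M.smul_mem c hf, ?_⟩
    rw [← smul_sub, hq.energyOne_smul c (hq.sub_mem hu.1 (hM hf))]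
    rw [lt_div_iff₀ (by positivity)] at hlt
    have := hq.energyOne_nonneg (hq.sub_mem hu.1 (hM hf))
    nlinarith [sq_nonneg c]
  form_symm := fun u hu v hv => hq.form_symm u hu.1 v hv.1
  form_add := fun u hu v hv w hw => hq.form_add u hu.1 v hv.1 w hw.1
  form_smul := fun c u hu v hv => hq.form_smul c u hu.1 v hv.1
  form_nonneg := fun u hu => hq.form_nonneg u hu.1
  complete := by
    intro f hf hc
    obtain ⟨u, hu, hlim⟩ := hq.complete f (fun n => (hf n).1) hc
    exact ⟨u, hq.closureOf_closureOf hM subset_rfl ⟨hu, f, hf, hlim⟩, hlim⟩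

/-- Convergence in `L²` of a sequence that is bounded in energy implies that the limit is in the
closure of the linear span of the sequence. -/
theorem mem_closureOf_of_bounded (hq : q.IsClosedForm) {M : Submodule ℝ (Lp ℝ 2 μ)}
    (hM : (M : Set (Lp ℝ 2 μ)) ⊆ q.dom) {v : ℕ → Lp ℝ 2 μ} {u : Lp ℝ 2 μ} (hv : ∀ n, v n ∈ M)
    {C : ℝ} (hC : ∀ n, q.form (v n) (v n) ≤ C) (hlim : Tendsto v atTop (𝓝 u)) :
    u ∈ (q.closureOf (M : Set (Lp ℝ 2 μ))).dom := by
  -- Mazur's argument without weak convergence: nearly minimize `ℰ₁` over the convex hulls of the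
  -- tails of the sequence. The minima `a n` increase and are bounded, hence converge.
  set K : ℕ → Set (Lp ℝ 2 μ) := fun n => convexHull ℝ (v '' Ici n) with hK
  have hKM : ∀ n, K n ⊆ M := fun n => convexHull_min
    (by rintro _ ⟨k, -, rfl⟩; exact hv k) M.convex
  have hKq : ∀ n, K n ⊆ q.dom := fun n => (hKM n).trans hM
  have hKanti : Antitone K := fun m n h => convexHull_mono (image_mono (Ici_subset_Ici.2 h))
  have hKv : ∀ n, v n ∈ K n := fun n => subset_convexHull ℝ _ ⟨n, mem_Ici.2 le_rfl, rfl⟩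
  have hbdd : ∀ n, BddBelow (q.energyOne '' K n) := fun n =>
    ⟨0, by rintro _ ⟨w, hw, rfl⟩; exact hq.energyOne_nonneg (hKq n hw)⟩
  set a : ℕ → ℝ := fun n => sInf (q.energyOne '' K n) with ha
  have hamono : Monotone a := fun m n h =>
    csInf_le_csInf (hbdd m) ⟨_, mem_image_of_mem _ (hKv n)⟩ (image_mono (hKanti h))
  obtain ⟨R, hR⟩ := (Metric.isBounded_range_of_tendsto v hlim).exists_norm_le
  have habdd : BddAbove (range a) := by
    refine ⟨C + R ^ 2, ?_⟩
    rintro _ ⟨n, rfl⟩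
    refine (csInf_le (hbdd n) (mem_image_of_mem _ (hKv n))).trans (add_le_add (hC n) ?_)
    exact pow_le_pow_left₀ (norm_nonneg _) (hR _ ⟨n, rfl⟩) 2
  have hatend := tendsto_atTop_ciSup hamono habdd
  set A := ⨆ n, a n
  have hex : ∀ n : ℕ, ∃ w ∈ K n, q.energyOne w < a n + 1 / ((n : ℝ) + 1) := by
    intro n
    obtain ⟨_, ⟨w, hw, rfl⟩, hlt⟩ := exists_lt_of_csInf_lt (s := q.energyOne '' K n)
      ⟨_, mem_image_of_mem _ (hKv n)⟩ (show a n < a n + 1 / ((n : ℝ) + 1) by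
        have : 0 < 1 / ((n : ℝ) + 1) := by positivity
        linarith)
    exact ⟨w, hw, hlt⟩
  choose w hwK hw using hex
  have hwq : ∀ n, w n ∈ q.dom := fun n => hKq n (hwK n)
  -- The midpoint of `w j` and `w k` is again in the hull `K n`, so its energy is at least `a n`.
  -- The parallelogram identity turns this into smallness of the energy of `w j - w k`.
  have hcauchy : ∀ n : ℕ, ∀ j ≥ n, ∀ k ≥ n,
      q.energyOne (w j - w k) ≤ 4 * (A - a n + 1 / ((n : ℝ) + 1)) := by
    intro n j hj k hk
    have hmid : (2⁻¹ : ℝ) • (w j + w k) ∈ K n := by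
      rw [smul_add]
      exact (convex_convexHull ℝ _) (hKanti hj (hwK j)) (hKanti hk (hwK k)) (by norm_num)
        (by norm_num) (by norm_num)
    have h1 : a n ≤ q.energyOne ((2⁻¹ : ℝ) • (w j + w k)) :=
      csInf_le (hbdd n) (mem_image_of_mem _ hmid)
    rw [hq.energyOne_smul _ (hq.add_mem _ (hwq j) _ (hwq k))] at h1
    have h2 := hq.energyOne_parallelogram (hwq j) (hwq k)
    have h3 : ∀ i ≥ n, q.energyOne (w i) ≤ A + 1 / ((n : ℝ) + 1) := by
      intro i hi
      have e1 : a i ≤ A := le_ciSup habdd i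
      have e2 : 1 / ((i : ℝ) + 1) ≤ 1 / ((n : ℝ) + 1) := by
        apply one_div_le_one_div_of_le (by positivity)
        have : (n : ℝ) ≤ i := by exact_mod_cast hi
        linarith
      linarith [(hw i).le]
    have := h3 j hj
    have := h3 k hk
    norm_num at h1
    linarith
  have hzero : Tendsto (fun n : ℕ => 4 * (A - a n + 1 / ((n : ℝ) + 1))) atTop (𝓝 0) := by
    have := ((hatend.const_sub A).add tendsto_one_div_add_atTop_nhds_zero_nat).const_mul 4
    simpa using this
  obtain ⟨z, hz, hzlim⟩ := hq.complete w hwq (by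
    intro ε hε
    obtain ⟨n, hn⟩ := (hzero.eventually (gt_mem_nhds hε)).exists
    exact ⟨n, fun j hj k hk => (hcauchy n j hj k hk).trans_lt hn⟩)
  have hwz := hq.tendsto_of_energyOne hwq hz hzlim
  -- Tails of `v` lie in small balls around `u`, and balls are convex, so the hulls lie there too.
  -- This identifies the `ℰ₁`-limit with `u`.
  have hwu : Tendsto w atTop (𝓝 u) := by
    rw [Metric.tendsto_atTop] at hlim ⊢
    intro ε hε
    obtain ⟨N, hN⟩ := hlim (ε / 2) (by linarith)
    refine ⟨N, fun n hn => ?_⟩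
    have hsub : K n ⊆ Metric.closedBall u (ε / 2) := by
      refine convexHull_min ?_ (convex_closedBall _ _)
      rintro _ ⟨k, hk, rfl⟩
      exact (hN k (hn.trans hk)).le
    have := hsub (hwK n)
    rw [Metric.mem_closedBall] at this
    linarith
  rw [tendsto_nhds_unique hwu hwz]
  exact ⟨hz, w, fun n => hKM n (hwK n), hzlim⟩

/-- Two closed forms that agree on a common dense set of generators are the same. -/
theorem agree_of_dense (hq : q.IsClosedForm) (hr : r.IsClosedForm) {C : Set (Lp ℝ 2 μ)}
    (hCq : C ⊆ q.dom) (hCr : C ⊆ r.dom) (hform : ∀ u ∈ C, ∀ v ∈ C, q.form u v = r.form u v)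
    (hdq : ∀ u ∈ q.dom, u ∈ (q.closureOf (Submodule.span ℝ C : Set (Lp ℝ 2 μ))).dom)
    (hdr : ∀ u ∈ r.dom, u ∈ (r.closureOf (Submodule.span ℝ C : Set (Lp ℝ 2 μ))).dom) :
    q.Agree r := by
  have hSq : (Submodule.span ℝ C) ≤ hq.domain := Submodule.span_le.2 hCq
  have hSr : (Submodule.span ℝ C) ≤ hr.domain := Submodule.span_le.2 hCr
  have hspan : ∀ u ∈ Submodule.span ℝ C, ∀ v ∈ Submodule.span ℝ C, q.form u v = r.form u v := by
    have h1 : ∀ u ∈ C, ∀ v ∈ Submodule.span ℝ C, q.form u v = r.form u v := by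
      intro u hu v hv
      induction hv using Submodule.span_induction with
      | mem x hx => exact hform u hu x hx
      | zero => rw [hq.form_symm _ (hCq hu) _ hq.zero_mem, hr.form_symm _ (hCr hu) _ hr.zero_mem,
          hq.form_zero_left (hCq hu), hr.form_zero_left (hCr hu)]
      | add x y hx hy h h' =>
        rw [hq.form_add_right (hSq hx) (hSq hy) (hCq hu),
          hr.form_add_right (hSr hx) (hSr hy) (hCr hu), h, h']
      | smul c x hx h =>
        rw [hq.form_symm _ (hCq hu) _ (hSq (Submodule.smul_mem _ c hx)),
          hr.form_symm _ (hCr hu) _ (hSr (Submodule.smul_mem _ c hx)),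
          hq.form_smul _ _ (hSq hx) _ (hCq hu), hr.form_smul _ _ (hSr hx) _ (hCr hu),
          hq.form_symm _ (hSq hx) _ (hCq hu), hr.form_symm _ (hSr hx) _ (hCr hu), h]
    intro u hu v hv
    induction hu using Submodule.span_induction with
    | mem x hx => exact h1 x hx v hv
    | zero => rw [hq.form_zero_left (hSq hv), hr.form_zero_left (hSr hv)]
    | add x y hx hy h h' =>
      rw [hq.form_add _ (hSq hx) _ (hSq hy) _ (hSq hv), hr.form_add _ (hSr hx) _ (hSr hy) _ (hSr hv),
        h, h']
    | smul c x hx h =>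
      rw [hq.form_smul _ _ (hSq hx) _ (hSq hv), hr.form_smul _ _ (hSr hx) _ (hSr hv), h]
  -- A sequence in the span that is Cauchy for one form is Cauchy for the other, since the forms
  -- coincide there. Both `ℰ₁`-limits are equal to the limit in `L²`.
  have transfer : ∀ {q r : L2Form μ} (hq : q.IsClosedForm) (hr : r.IsClosedForm),
      (Submodule.span ℝ C : Set (Lp ℝ 2 μ)) ⊆ q.dom → (Submodule.span ℝ C : Set (Lp ℝ 2 μ)) ⊆ r.dom →
      (∀ u ∈ Submodule.span ℝ C, ∀ v ∈ Submodule.span ℝ C, q.form u v = r.form u v) →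
      ∀ (u : Lp ℝ 2 μ) (f : ℕ → Lp ℝ 2 μ), u ∈ q.dom → (∀ n, f n ∈ Submodule.span ℝ C) →
      Tendsto (fun n => q.energyOne (u - f n)) atTop (𝓝 0) →
      u ∈ r.dom ∧ Tendsto (fun n => r.energyOne (u - f n)) atTop (𝓝 0) := by
    intro q r hq hr hSq hSr hspan u f hu hf hlim
    have hc := hq.cauchy_of_energyOne (fun n => hSq (hf n)) hu hlim
    obtain ⟨z, hz, hzlim⟩ := hr.complete f (fun n => hSr (hf n)) (by
      intro ε hε
      obtain ⟨N, hN⟩ := hc ε hε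
      refine ⟨N, fun j hj k hk => ?_⟩
      have hm := Submodule.sub_mem _ (hf j) (hf k)
      rw [energyOne, ← hspan _ hm _ hm]
      exact hN j hj k hk)
    have : u = z := tendsto_nhds_unique (hq.tendsto_of_energyOne (fun n => hSq (hf n)) hu hlim)
      (hr.tendsto_of_energyOne (fun n => hSr (hf n)) hz hzlim)
    rw [this]
    exact ⟨hz, hzlim⟩
  refine ⟨?_, ?_⟩
  · ext u
    constructor
    · intro hu
      obtain ⟨-, f, hf, hlim⟩ := hdq u hu
      exact (transfer hq hr hSq hSr hspan u f hu hf hlim).1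
    · intro hu
      obtain ⟨-, f, hf, hlim⟩ := hdr u hu
      exact (transfer hr hq hSr hSq (fun u hu v hv => (hspan u hu v hv).symm) u f hu hf hlim).1
  · intro u hu v hv
    obtain ⟨-, f, hf, hlim⟩ := hdq u hu
    obtain ⟨-, g, hg, hglim⟩ := hdq v hv
    obtain ⟨hu', hlim'⟩ := transfer hq hr hSq hSr hspan u f hu hf hlim
    obtain ⟨hv', hglim'⟩ := transfer hq hr hSq hSr hspan v g hv hg hglim
    have t1 := hq.tendsto_form (fun n => hSq (hf n)) (fun n => hSq (hg n)) hu hv hlim hglim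
    have t2 := hr.tendsto_form (fun n => hSr (hf n)) (fun n => hSr (hg n)) hu' hv' hlim' hglim'
    refine tendsto_nhds_unique t1 (t2.congr fun n => ?_)
    exact (hspan _ (hf n) _ (hg n)).symm

theorem of_agree (hq : q.IsClosedForm) (h : q.Agree r) : r.IsClosedForm := by
  obtain ⟨hd, hf⟩ := h
  have hsub : ∀ {u v : Lp ℝ 2 μ}, u ∈ q.dom → v ∈ q.dom → r.energyOne (u - v) = q.energyOne (u - v) :=
    fun hu hv => by rw [energyOne, energyOne, hf _ (hq.sub_mem hu hv) _ (hq.sub_mem hu hv)]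
  constructor
  · exact hd ▸ hq.zero_mem
  · rw [← hd]; exact hq.add_mem
  · rw [← hd]; exact hq.smul_mem
  · rw [← hd]
    intro u hu v hv
    rw [← hf u hu v hv, ← hf v hv u hu, hq.form_symm u hu v hv]
  · rw [← hd]
    intro u hu v hv w hw
    rw [← hf u hu w hw, ← hf v hv w hw, ← hf _ (hq.add_mem u hu v hv) w hw, hq.form_add u hu v hv w hw]
  · rw [← hd]
    intro c u hu v hv
    rw [← hf u hu v hv, ← hf _ (hq.smul_mem c u hu) v hv, hq.form_smul c u hu v hv]
  · rw [← hd]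
    intro u hu
    rw [← hf u hu u hu]
    exact hq.form_nonneg u hu
  · rw [← hd]
    intro f hfd hc
    obtain ⟨u, hu, hlim⟩ := hq.complete f hfd (by
      intro ε hε
      obtain ⟨N, hN⟩ := hc ε hε
      exact ⟨N, fun j hj k hk => by rw [← hsub (hfd j) (hfd k)]; exact hN j hj k hk⟩)
    exact ⟨u, hu, hlim.congr fun n => (hsub hu (hfd n)).symm⟩

end IsClosedForm

end L2Form

end Diffusion

end

/-! ### Symmetric contraction semigroups and their forms, without the spectral theorem -/

noncomputable section

namespace Diffusion

open scoped RealInnerProductSpace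

/-- Convex sequences stand in for spectral calculus: sampled at equidistant times, `⟪T t u, u⟫` is
convex, and the monotonicity of the approximating forms and the regularization by the semigroup are
read off from that. -/
theorem antitone_diff_of_convex {a : ℕ → ℝ} (ha : ∀ k, 2 * a (k + 1) ≤ a k + a (k + 2)) :
    Antitone fun k => a k - a (k + 1) := by
  refine antitone_nat_of_succ_le fun k => ?_
  have := ha k
  linarith [show a (k + 1 + 1) = a (k + 2) from rfl]

theorem mul_diff_le_of_convex {a : ℕ → ℝ} (ha : ∀ k, 2 * a (k + 1) ≤ a k + a (k + 2)) (n : ℕ) :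
    n * (a n - a (n + 1)) ≤ a 0 - a n := by
  have h := antitone_diff_of_convex ha
  rw [← Finset.sum_range_sub' a n]
  calc (n : ℝ) * (a n - a (n + 1)) = ∑ _k ∈ Finset.range n, (a n - a (n + 1)) := by simp; ring
    _ ≤ _ := Finset.sum_le_sum fun k hk => h (Finset.mem_range.1 hk).le

theorem sub_le_mul_diff_of_convex {a : ℕ → ℝ} (ha : ∀ k, 2 * a (k + 1) ≤ a k + a (k + 2)) (n : ℕ) :
    a 0 - a n ≤ n * (a 0 - a 1) := by
  have h := antitone_diff_of_convex ha
  rw [← Finset.sum_range_sub' a n]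
  calc _ ≤ ∑ _k ∈ Finset.range n, (a 0 - a 1) :=
        Finset.sum_le_sum fun k _ => h (Nat.zero_le k)
    _ = _ := by simp; ring

/-- A convex sequence that goes up in its first step grows at least linearly. -/
theorem le_of_convex_of_bounded {a : ℕ → ℝ} (ha : ∀ k, 2 * a (k + 1) ≤ a k + a (k + 2)) {C : ℝ}
    (hC : ∀ k, a k ≤ C) : a 1 ≤ a 0 := by
  by_contra! hlt
  obtain ⟨n, hn⟩ := exists_nat_gt ((C - a 0) / (a 1 - a 0))
  rw [div_lt_iff₀ (by linarith)] at hn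
  have := sub_le_mul_diff_of_convex ha n
  have := hC n
  linarith

theorem tendsto_nnreal_div_nat (t : ℝ≥0) : Tendsto (fun n : ℕ => t / n) atTop (𝓝 0) := by
  rw [← NNReal.tendsto_coe]
  simpa using tendsto_const_div_atTop_nhds_zero_nat (t : ℝ)

/-- Strongly continuous semigroups of symmetric contractions. -/
structure IsSymmSemigroup {H : Type*} [NormedAddCommGroup H] [InnerProductSpace ℝ H]
    (T : ℝ≥0 → H →L[ℝ] H) : Prop where
  zero : ∀ u, T 0 u = u
  add : ∀ s t u, T (s + t) u = T s (T t u)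
  contraction : ∀ t u, ‖T t u‖ ≤ ‖u‖
  symm : ∀ t u v, ⟪T t u, v⟫ = ⟪u, T t v⟫
  cont : ∀ u, Tendsto (fun t => T t u) (𝓝[>] 0) (𝓝 u)

/-- The approximating forms of a semigroup. -/
def approx {H : Type*} [NormedAddCommGroup H] [InnerProductSpace ℝ H]
    (T : ℝ≥0 → H →L[ℝ] H) (t : ℝ≥0) (u v : H) : ℝ := (t : ℝ)⁻¹ * ⟪u - T t u, v⟫

namespace IsSymmSemigroup

section Hilbert

variable {H : Type*} [NormedAddCommGroup H] [InnerProductSpace ℝ H] {T : ℝ≥0 → H →L[ℝ] H}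

theorem inner_add (hT : IsSymmSemigroup T) (s t : ℝ≥0) (u : H) :
    ⟪T (s + t) u, u⟫ = ⟪T s u, T t u⟫ := by
  rw [add_comm, hT.add, hT.symm]

theorem inner_double (hT : IsSymmSemigroup T) (t : ℝ≥0) (u : H) :
    ⟪T (t + t) u, u⟫ = ‖T t u‖ ^ 2 := by
  rw [hT.inner_add, real_inner_self_eq_norm_sq]

/-- Halving the time exhibits `⟪T t u, u⟫` as a squared norm. Positivity, the bound by `‖u‖ ^ 2` and
monotonicity in `t` then come from contractivity. -/
theorem inner_eq_half (hT : IsSymmSemigroup T) (t : ℝ≥0) (u : H) :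
    ⟪T t u, u⟫ = ‖T (t / 2) u‖ ^ 2 := by
  rw [← hT.inner_double, add_halves]

theorem inner_nonneg (hT : IsSymmSemigroup T) (t : ℝ≥0) (u : H) : 0 ≤ ⟪T t u, u⟫ := by
  rw [hT.inner_eq_half]; positivity

theorem inner_anti (hT : IsSymmSemigroup T) {s t : ℝ≥0} (h : s ≤ t) (u : H) :
    ⟪T t u, u⟫ ≤ ⟪T s u, u⟫ := by
  rw [hT.inner_eq_half, hT.inner_eq_half]
  have : t / 2 = (t - s) / 2 + s / 2 := by rw [← add_div, tsub_add_cancel_of_le h]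
  rw [this, hT.add]
  exact pow_le_pow_left₀ (norm_nonneg _) (hT.contraction _ _) 2

theorem inner_le (hT : IsSymmSemigroup T) (t : ℝ≥0) (u : H) : ⟪T t u, u⟫ ≤ ‖u‖ ^ 2 := by
  rw [hT.inner_eq_half]
  exact pow_le_pow_left₀ (norm_nonneg _) (hT.contraction _ _) 2

/-- Expansion of `0 ≤ ‖T p u - T (p + h) u‖ ^ 2`, where `p` is half of the first of the three times.
-/
theorem inner_convex (hT : IsSymmSemigroup T) (r h : ℝ≥0) (u : H) (k : ℕ) :
    2 * ⟪T (r + (k + 1 : ℕ) * h) u, u⟫ ≤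
      ⟪T (r + k * h) u, u⟫ + ⟪T (r + (k + 2 : ℕ) * h) u, u⟫ := by
  set p := (r + k * h) / 2 with hp
  have e1 : r + k * h = p + p := by rw [hp, add_halves]
  have e2 : r + (k + 1 : ℕ) * h = p + (p + h) := by
    rw [← add_assoc, ← e1]; push_cast; ring
  have e3 : r + (k + 2 : ℕ) * h = (p + h) + (p + h) := by
    rw [show p + h + (p + h) = (p + p) + 2 * h by ring, ← e1]; push_cast; ring
  rw [e1, e2, e3, hT.inner_double, hT.inner_double, hT.inner_add]
  have := norm_sub_sq_real (T p u) (T (p + h) u)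
  have := sq_nonneg ‖T p u - T (p + h) u‖
  linarith

theorem approx_self (T : ℝ≥0 → H →L[ℝ] H) (t : ℝ≥0) (u : H) :
    approx T t u u = (t : ℝ)⁻¹ * (‖u‖ ^ 2 - ⟪T t u, u⟫) := by
  rw [approx, inner_sub_left, real_inner_self_eq_norm_sq]

theorem approx_nonneg (hT : IsSymmSemigroup T) (t : ℝ≥0) (u : H) : 0 ≤ approx T t u u := by
  rw [approx_self]
  exact mul_nonneg (by positivity) (sub_nonneg.2 (hT.inner_le t u))

theorem approx_symm (hT : IsSymmSemigroup T) (t : ℝ≥0) (u v : H) :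
    approx T t u v = approx T t v u := by
  rw [approx, approx, inner_sub_left, inner_sub_left, hT.symm, real_inner_comm,
    real_inner_comm u (T t v)]

theorem approx_add (T : ℝ≥0 → H →L[ℝ] H) (t : ℝ≥0) (u v w : H) :
    approx T t (u + v) w = approx T t u w + approx T t v w := by
  rw [approx, approx, approx, map_add, add_sub_add_comm, inner_add_left, mul_add]

theorem approx_smul (T : ℝ≥0 → H →L[ℝ] H) (t : ℝ≥0) (c : ℝ) (u w : H) :
    approx T t (c • u) w = c * approx T t u w := by
  rw [approx, approx, map_smul, ← smul_sub, real_inner_smul_left]; ring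

theorem approx_add_right (T : ℝ≥0 → H →L[ℝ] H) (t : ℝ≥0) (u v w : H) :
    approx T t w (u + v) = approx T t w u + approx T t w v := by
  rw [approx, approx, approx, inner_add_right, mul_add]

theorem approx_smul_right (T : ℝ≥0 → H →L[ℝ] H) (t : ℝ≥0) (c : ℝ) (u w : H) :
    approx T t w (c • u) = c * approx T t w u := by
  rw [approx, approx, real_inner_smul_right]; ring

theorem approx_add_self (hT : IsSymmSemigroup T) (t : ℝ≥0) (u v : H) :
    approx T t (u + v) (u + v) = approx T t u u + 2 * approx T t u v + approx T t v v := by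
  rw [approx_add, approx_add_right, approx_add_right, hT.approx_symm t v u]; ring

theorem approx_sub_self (hT : IsSymmSemigroup T) (t : ℝ≥0) (u v : H) :
    approx T t (u - v) (u - v) = approx T t u u - 2 * approx T t u v + approx T t v v := by
  have : u - v = u + (-1 : ℝ) • v := by simp [sub_eq_add_neg]
  rw [this, hT.approx_add_self, approx_smul, approx_smul_right, approx_smul_right]; ring

theorem approx_add_self_le (hT : IsSymmSemigroup T) (t : ℝ≥0) (u v : H) :
    approx T t (u + v) (u + v) ≤ 2 * (approx T t u u + approx T t v v) := by
  have h1 := hT.approx_add_self t u v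
  have h2 := hT.approx_sub_self t u v
  have := hT.approx_nonneg t (u - v)
  linarith

theorem continuous_approx (T : ℝ≥0 → H →L[ℝ] H) (t : ℝ≥0) :
    Continuous fun u => approx T t u u := by
  unfold approx; fun_prop

/-- For a convex function the chord from `0` to `n * t` descends no more steeply than the chord from
`0` to `t`. -/
theorem approx_nsmul_le (hT : IsSymmSemigroup T) (t : ℝ≥0) (ht : 0 < t) (n : ℕ) (hn : 0 < n)
    (u : H) : approx T (n * t) u u ≤ approx T t u u := by
  have h := sub_le_mul_diff_of_convex (a := fun k : ℕ => ⟪T (0 + k * t) u, u⟫)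
    (fun k => hT.inner_convex 0 t u k) n
  simp only [Nat.cast_zero, zero_mul, add_zero, zero_add, Nat.cast_one, one_mul] at h
  rw [hT.zero, real_inner_self_eq_norm_sq] at h
  rw [approx_self, approx_self]
  have hn' : (0 : ℝ) < n := by exact_mod_cast hn
  have ht' : (0 : ℝ) < t := by exact_mod_cast ht
  push_cast
  rw [inv_mul_le_iff₀ (by positivity)]
  calc _ ≤ _ := h
    _ = _ := by field_simp

/-- If the approximating forms converge, then they are bounded by the limit. -/
theorem approx_le_of_tendsto (hT : IsSymmSemigroup T) {u : H} {l : ℝ}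
    (h : Tendsto (fun t => approx T t u u) (𝓝[>] 0) (𝓝 l)) (t : ℝ≥0) : approx T t u u ≤ l := by
  rcases eq_or_ne t 0 with rfl | ht
  · have h0 : approx T 0 u u = 0 := by simp [approx]
    rw [h0]
    exact ge_of_tendsto' h fun t => hT.approx_nonneg t u
  have ht : 0 < t := pos_iff_ne_zero.2 ht
  -- Only integer multiples of a time can be compared, so the limit at zero is taken along the
  -- fractions of the given `t`.
  have hlim : Tendsto (fun n : ℕ => t / (n + 1 : ℕ)) atTop (𝓝[>] 0) := by
    rw [tendsto_nhdsWithin_iff]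
    refine ⟨?_, Eventually.of_forall fun n => by simp only [mem_Ioi]; positivity⟩
    exact (tendsto_nnreal_div_nat t).comp (tendsto_add_atTop_nat 1)
  refine ge_of_tendsto' (h.comp hlim) fun n => ?_
  have := hT.approx_nsmul_le (t / (n + 1 : ℕ)) (by positivity) (n + 1) n.succ_pos u
  rwa [mul_div_cancel₀ _ (by positivity : ((n + 1 : ℕ) : ℝ≥0) ≠ 0)] at this

/-- The limit is the supremum over all times. Comparison along integer multiples alone does not give
monotonicity in `t`, but it loses only a factor `t₀ / (t₀ + t)`, which tends to one as `t` decreases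
to zero. -/
theorem tendsto_of_approx_le (hT : IsSymmSemigroup T) {u : H} {C : ℝ}
    (h : ∀ t, 0 < t → approx T t u u ≤ C) :
    ∃ l ≤ C, Tendsto (fun t => approx T t u u) (𝓝[>] 0) (𝓝 l) := by
  set S : Set ℝ := (fun t => approx T t u u) '' Ioi 0 with hS
  have hne : S.Nonempty := ⟨_, mem_image_of_mem _ (mem_Ioi.2 one_pos)⟩
  have hbdd : BddAbove S := ⟨C, by rintro _ ⟨t, ht, rfl⟩; exact h t ht⟩
  refine ⟨sSup S, csSup_le hne (by rintro _ ⟨t, ht, rfl⟩; exact h t ht), ?_⟩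
  rw [tendsto_order]
  constructor
  · intro a ha
    obtain ⟨_, ⟨t₀, ht₀, rfl⟩, hlt⟩ := exists_lt_of_lt_csSup hne ha
    have ht₀ : 0 < t₀ := ht₀
    have ht₀' : (0 : ℝ) < t₀ := ht₀
    have hlim : Tendsto (fun t : ℝ≥0 => approx T t₀ u u * (t₀ / (t₀ + t) : ℝ)) (𝓝[>] 0)
        (𝓝 (approx T t₀ u u * (t₀ / (t₀ + (0 : ℝ≥0)) : ℝ))) := by
      refine Tendsto.mono_left ?_ nhdsWithin_le_nhds
      apply ContinuousAt.tendsto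
      have : (t₀ : ℝ) + (0 : ℝ≥0) ≠ 0 := by simpa using ht₀'.ne'
      fun_prop (disch := exact this)
    rw [NNReal.coe_zero, add_zero, div_self ht₀'.ne', mul_one] at hlim
    filter_upwards [hlim.eventually (lt_mem_nhds hlt), self_mem_nhdsWithin] with t ht htpos
    have htpos : 0 < t := htpos
    have htpos' : (0 : ℝ) < t := htpos
    refine ht.trans_le ?_
    -- With this choice `t₀ ≤ n * t ≤ t₀ + t`: the first bound serves the monotone `⟪T · u, u⟫`, the
    -- second the prefactor.
    set n := ⌈(t₀ / t : ℝ)⌉₊ with hn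
    have hnpos : 0 < n := Nat.ceil_pos.2 (by positivity)
    have h1 : (t₀ : ℝ) ≤ n * t := by
      have := Nat.le_ceil (t₀ / t : ℝ)
      rwa [div_le_iff₀ htpos'] at this
    have h2 : (n : ℝ) * t ≤ t₀ + t := by
      have := (Nat.ceil_lt_add_one (show (0 : ℝ) ≤ t₀ / t by positivity)).le
      calc (n : ℝ) * t ≤ (t₀ / t + 1) * t := by gcongr
        _ = t₀ + t := by field_simp
    refine le_trans ?_ (hT.approx_nsmul_le t htpos n hnpos u)
    rw [approx_self, approx_self]
    have h3 : ⟪T (n * t) u, u⟫ ≤ ⟪T t₀ u, u⟫ := hT.inner_anti (by exact_mod_cast h1) u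
    have h4 := hT.inner_le t₀ u
    have h5 : (0 : ℝ) < n * t := by positivity
    push_cast
    calc _ = (t₀ + t : ℝ)⁻¹ * (‖u‖ ^ 2 - ⟪T t₀ u, u⟫) := by field_simp
      _ ≤ (n * t : ℝ)⁻¹ * (‖u‖ ^ 2 - ⟪T t₀ u, u⟫) :=
        mul_le_mul_of_nonneg_right (inv_anti₀ h5 h2) (by linarith)
      _ ≤ _ := by gcongr
  · intro a ha
    filter_upwards [self_mem_nhdsWithin] with t ht
    exact (le_csSup hbdd (mem_image_of_mem _ ht)).trans_lt ha

/-- The values along `T (k * t) u` form a convex sequence, because the approximating form is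
nonnegative on `T (k * t) u - T ((k + 2) * t) u`. They are bounded, so the first step cannot go up.
-/
theorem approx_apply_le (hT : IsSymmSemigroup T) (s t : ℝ≥0) (u : H) :
    approx T s (T t u) (T t u) ≤ approx T s u u := by
  have hcomm : ∀ a b : ℝ≥0, ∀ v, T a (T b v) = T b (T a v) := fun a b v => by
    rw [← hT.add, add_comm, hT.add]
  have hself : ∀ (a b : ℝ≥0) (v w : H), approx T s (T a v) (T b w) = approx T s v (T (a + b) w) := by
    intro a b v w
    rw [approx, approx, hcomm s a, ← map_sub, hT.symm, ← hT.add]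
  have hconv : ∀ k : ℕ, 2 * approx T s (T ((k + 1 : ℕ) * t) u) (T ((k + 1 : ℕ) * t) u) ≤
      approx T s (T (k * t) u) (T (k * t) u) +
        approx T s (T ((k + 2 : ℕ) * t) u) (T ((k + 2 : ℕ) * t) u) := by
    intro k
    have h1 := hT.approx_sub_self s (T (k * t) u) (T ((k + 2 : ℕ) * t) u)
    have h2 := hT.approx_nonneg s (T (k * t) u - T ((k + 2 : ℕ) * t) u)
    have h3 : approx T s (T (k * t) u) (T ((k + 2 : ℕ) * t) u) =
        approx T s (T ((k + 1 : ℕ) * t) u) (T ((k + 1 : ℕ) * t) u) := by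
      rw [hself, hself]
      congr 3
      push_cast; ring
    linarith
  have := le_of_convex_of_bounded
    (a := fun k : ℕ => approx T s (T (k * t) u) (T (k * t) u)) hconv (C := (s : ℝ)⁻¹ * ‖u‖ ^ 2) (fun k => by
    rw [approx_self]
    gcongr
    have := hT.inner_nonneg s (T (k * t) u)
    have := pow_le_pow_left₀ (norm_nonneg _) (hT.contraction (k * t) u) 2
    linarith)
  simpa [hT.zero] using this

/-- The regularizing effect of the semigroup. The left side is the slope of `r ↦ ⟪T r u, u⟫` on
`[2t, 2t + s]`, up to sign, and a decreasing convex function with values between `0` and `‖u‖ ^ 2`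
cannot be steep after the time `2t`. For `s > t` the trivial bound `‖u‖ ^ 2 / s` is enough. -/
theorem approx_apply_le_div (hT : IsSymmSemigroup T) {s t : ℝ≥0} (hs : 0 < s) (ht : 0 < t) (u : H) :
    approx T s (T t u) (T t u) ≤ ‖u‖ ^ 2 / t := by
  have hs' : (0 : ℝ) < s := hs
  have ht' : (0 : ℝ) < t := ht
  have e : ∀ a : ℝ≥0, ⟪T a (T t u), T t u⟫ = ⟪T (2 * t + a) u, u⟫ := by
    intro a
    rw [← hT.symm, ← hT.add, ← hT.add]
    congr 3; ring
  have e0 : ‖T t u‖ ^ 2 = ⟪T (2 * t) u, u⟫ := by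
    rw [← real_inner_self_eq_norm_sq]
    simpa [hT.zero] using e 0
  rw [approx_self, e, e0]
  rcases lt_or_ge t s with hlt | hle
  · have h1 := hT.inner_le (2 * t) u
    have h2 := hT.inner_nonneg (2 * t + s) u
    have hlt' : (t : ℝ) < s := hlt
    calc _ ≤ (s : ℝ)⁻¹ * ‖u‖ ^ 2 := by gcongr; linarith
      _ ≤ (t : ℝ)⁻¹ * ‖u‖ ^ 2 := by gcongr
      _ = _ := by ring
  -- Going back from `2 * t` in `n` steps of length `s` stays at nonnegative times, and covers at
  -- least a length `t` since `s ≤ t`.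
  · set n := ⌊(2 * t / s : ℝ)⌋₊ with hn
    have hle' : (s : ℝ) ≤ t := hle
    have h1 : (n : ℝ) * s ≤ 2 * t := by
      have := Nat.floor_le (show (0 : ℝ) ≤ 2 * t / s by positivity)
      rwa [le_div_iff₀ hs'] at this
    have h2 : (t : ℝ) ≤ n * s := by
      have := Nat.lt_floor_add_one (2 * t / s : ℝ)
      rw [div_lt_iff₀ hs'] at this
      have : (2 * t : ℝ) < (n + 1) * s := this
      linarith
    have h1' : (n : ℝ≥0) * s ≤ 2 * t := by exact_mod_cast h1
    set r := 2 * t - n * s with hr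
    have hr' : r + n * s = 2 * t := tsub_add_cancel_of_le h1'
    have h3 := mul_diff_le_of_convex (a := fun k : ℕ => ⟪T (r + k * s) u, u⟫)
      (fun k => hT.inner_convex r s u k) n
    simp only [Nat.cast_zero, zero_mul, add_zero, hr'] at h3
    have e1 : r + ((n + 1 : ℕ) : ℝ≥0) * s = 2 * t + s := by rw [← hr']; push_cast; ring
    rw [e1] at h3
    have h4 := hT.inner_le r u
    have h5 := hT.inner_nonneg (2 * t) u
    have hnpos : (0 : ℝ) < n := by
      by_contra! hneg
      have : (n : ℝ) * s ≤ 0 := mul_nonpos_of_nonpos_of_nonneg hneg hs'.le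
      linarith
    have h6 : 0 ≤ ⟪T (2 * t) u, u⟫ - ⟪T (2 * t + s) u, u⟫ :=
      sub_nonneg.2 (hT.inner_anti le_self_add u)
    rw [inv_mul_le_iff₀ hs', mul_div_assoc', le_div_iff₀ ht']
    calc (⟪T (2 * t) u, u⟫ - ⟪T (2 * t + s) u, u⟫) * t
        ≤ (⟪T (2 * t) u, u⟫ - ⟪T (2 * t + s) u, u⟫) * (n * s) := by gcongr
      _ = s * (n * (⟪T (2 * t) u, u⟫ - ⟪T (2 * t + s) u, u⟫)) := by ring
      _ ≤ s * ‖u‖ ^ 2 := by gcongr; linarith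

end Hilbert

section Form

variable {S : Type*} [MeasurableSpace S] {μ : Measure S} {T : ℝ≥0 → Lp ℝ 2 μ →L[ℝ] Lp ℝ 2 μ}

/-- The closed form of a semigroup. -/
def _root_.Diffusion.semigroupForm (T : ℝ≥0 → Lp ℝ 2 μ →L[ℝ] Lp ℝ 2 μ) : L2Form μ where
  dom := {u | ∃ l : ℝ, Tendsto (fun t => approx T t u u) (𝓝[>] 0) (𝓝 l)}
  form u v := limUnder (𝓝[>] 0) fun t => approx T t u v

theorem mem_dom_of_le (hT : IsSymmSemigroup T) {u : Lp ℝ 2 μ} {C : ℝ}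
    (h : ∀ t, 0 < t → approx T t u u ≤ C) :
    u ∈ (semigroupForm T).dom ∧ (semigroupForm T).form u u ≤ C := by
  obtain ⟨l, hl, hlim⟩ := hT.tendsto_of_approx_le h
  exact ⟨⟨l, hlim⟩, hlim.limUnder_eq.trans_le hl⟩

theorem approx_le_form (hT : IsSymmSemigroup T) {u : Lp ℝ 2 μ} (hu : u ∈ (semigroupForm T).dom)
    (t : ℝ≥0) : approx T t u u ≤ (semigroupForm T).form u u := by
  obtain ⟨l, hl⟩ := hu
  exact (hT.approx_le_of_tendsto hl t).trans_eq hl.limUnder_eq.symm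

theorem add_mem_dom (hT : IsSymmSemigroup T) {u v : Lp ℝ 2 μ} (hu : u ∈ (semigroupForm T).dom)
    (hv : v ∈ (semigroupForm T).dom) : u + v ∈ (semigroupForm T).dom := by
  refine (hT.mem_dom_of_le (C := 2 * ((semigroupForm T).form u u + (semigroupForm T).form v v))
    fun t _ => ?_).1
  have := hT.approx_add_self_le t u v
  have := hT.approx_le_form hu t
  have := hT.approx_le_form hv t
  linarith

theorem smul_mem_dom {u : Lp ℝ 2 μ} (c : ℝ) (hu : u ∈ (semigroupForm T).dom) :
    c • u ∈ (semigroupForm T).dom := by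
  obtain ⟨l, hl⟩ := hu
  refine ⟨c * (c * l), ?_⟩
  simp only [approx_smul, approx_smul_right]
  exact (hl.const_mul c).const_mul c

/-- Polarization: the domain is defined by convergence on the diagonal only. -/
theorem tendsto_approx (hT : IsSymmSemigroup T) {u v : Lp ℝ 2 μ} (hu : u ∈ (semigroupForm T).dom)
    (hv : v ∈ (semigroupForm T).dom) :
    Tendsto (fun t => approx T t u v) (𝓝[>] 0) (𝓝 ((semigroupForm T).form u v)) := by
  obtain ⟨l, hl⟩ := hT.add_mem_dom hu hv
  obtain ⟨l₁, hl₁⟩ := hu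
  obtain ⟨l₂, hl₂⟩ := hv
  have : Tendsto (fun t => approx T t u v) (𝓝[>] 0) (𝓝 (2⁻¹ * (l - l₁ - l₂))) := by
    refine (((hl.sub hl₁).sub hl₂).const_mul 2⁻¹).congr fun t => ?_
    rw [hT.approx_add_self]; ring
  rwa [← this.limUnder_eq] at this

theorem isClosedForm (hT : IsSymmSemigroup T) : (semigroupForm T).IsClosedForm where
  zero_mem := ⟨0, by simp [approx]⟩
  add_mem := fun u hu v hv => hT.add_mem_dom hu hv
  smul_mem := fun c u hu => smul_mem_dom c hu
  form_symm := fun u hu v hv => tendsto_nhds_unique (hT.tendsto_approx hu hv)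
    ((hT.tendsto_approx hv hu).congr fun t => hT.approx_symm t v u)
  form_add := fun u hu v hv w hw => tendsto_nhds_unique
    (hT.tendsto_approx (hT.add_mem_dom hu hv) hw)
    (((hT.tendsto_approx hu hw).add (hT.tendsto_approx hv hw)).congr fun t =>
      (approx_add T t u v w).symm)
  form_smul := fun c u hu v hv => tendsto_nhds_unique
    (hT.tendsto_approx (smul_mem_dom c hu) hv)
    (((hT.tendsto_approx hu hv).const_mul c).congr fun t => (approx_smul T t c u v).symm)
  form_nonneg := fun u hu => ge_of_tendsto' (hT.tendsto_approx hu hu) fun t => hT.approx_nonneg t u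
  complete := by
    intro f hf hc
    have hsubm : ∀ {u v : Lp ℝ 2 μ}, u ∈ (semigroupForm T).dom → v ∈ (semigroupForm T).dom →
        u - v ∈ (semigroupForm T).dom := by
      intro u v hu hv
      have := hT.add_mem_dom hu (smul_mem_dom (-1) hv)
      simpa [sub_eq_add_neg] using this
    have hnn : ∀ u ∈ (semigroupForm T).dom, 0 ≤ (semigroupForm T).form u u := fun u hu =>
      ge_of_tendsto' (hT.tendsto_approx hu hu) fun t => hT.approx_nonneg t u
    have hcau : CauchySeq f := by
      rw [Metric.cauchySeq_iff]
      intro ε hε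
      obtain ⟨N, hN⟩ := hc (ε ^ 2) (by positivity)
      refine ⟨N, fun j hj k hk => ?_⟩
      have h1 := hN j hj k hk
      have h2 := hnn _ (hsubm (hf j) (hf k))
      rw [L2Form.energyOne] at h1
      rw [dist_eq_norm]
      exact lt_of_pow_lt_pow_left₀ 2 hε.le (by linarith)
    obtain ⟨u, hu⟩ := cauchySeq_tendsto_of_complete hcau
    -- Lower semicontinuity: for fixed `t` the approximating form is continuous on `L²` and bounded
    -- by the form, so the Cauchy estimate survives the limit in `k`, with a bound independent of
    -- `t`.
    have key : ∀ ε > 0, ∃ N, ∀ n ≥ N, (u - f n) ∈ (semigroupForm T).dom ∧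
        (semigroupForm T).form (u - f n) (u - f n) ≤ ε := by
      intro ε hε
      obtain ⟨N, hN⟩ := hc ε hε
      refine ⟨N, fun n hn => hT.mem_dom_of_le fun t ht => ?_⟩
      have hlim : Tendsto (fun k => approx T t (f k - f n) (f k - f n)) atTop
          (𝓝 (approx T t (u - f n) (u - f n))) :=
        ((continuous_approx T t).tendsto _).comp (hu.sub_const (f n))
      refine le_of_tendsto hlim (eventually_atTop.2 ⟨N, fun k hk => ?_⟩)
      have h1 := hN k hk n hn
      have h2 := hT.approx_le_form (hsubm (hf k) (hf n)) t
      rw [L2Form.energyOne] at h1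
      nlinarith [sq_nonneg ‖f k - f n‖]
    have hmem : u ∈ (semigroupForm T).dom := by
      obtain ⟨N, hN⟩ := key 1 one_pos
      have := hT.add_mem_dom (hN N le_rfl).1 (hf N)
      rwa [sub_add_cancel] at this
    refine ⟨u, hmem, ?_⟩
    have h1 : Tendsto (fun n => (semigroupForm T).form (u - f n) (u - f n)) atTop (𝓝 0) := by
      rw [Metric.tendsto_atTop]
      intro ε hε
      obtain ⟨N, hN⟩ := key (ε / 2) (by linarith)
      refine ⟨N, fun n hn => ?_⟩
      obtain ⟨ha, hb⟩ := hN n hn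
      rw [Real.dist_eq, sub_zero, abs_of_nonneg (hnn _ ha)]
      linarith
    have h2 : Tendsto (fun n => ‖u - f n‖ ^ 2) atTop (𝓝 0) := by
      have := (tendsto_const_nhds (x := u)).sub hu
      rw [sub_self] at this
      simpa using this.norm.pow 2
    simpa [L2Form.energyOne] using h1.add h2

theorem apply_mem_dom (hT : IsSymmSemigroup T) {t : ℝ≥0} (ht : 0 < t) (u : Lp ℝ 2 μ) :
    T t u ∈ (semigroupForm T).dom ∧
      (semigroupForm T).form (T t u) (T t u) ≤ ‖u‖ ^ 2 / t :=
  hT.mem_dom_of_le fun _ hs => hT.approx_apply_le_div hs ht u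

theorem form_apply_le (hT : IsSymmSemigroup T) (t : ℝ≥0) {u : Lp ℝ 2 μ}
    (hu : u ∈ (semigroupForm T).dom) :
    T t u ∈ (semigroupForm T).dom ∧
      (semigroupForm T).form (T t u) (T t u) ≤ (semigroupForm T).form u u :=
  hT.mem_dom_of_le fun s _ => (hT.approx_apply_le s t u).trans (hT.approx_le_form hu s)

/-- A subspace of the domain that contains the images under the semigroup of a dense subset of `L²`
is dense in the domain. -/
theorem dense_dom (hT : IsSymmSemigroup T) {M : Submodule ℝ (Lp ℝ 2 μ)}
    (hM : (M : Set (Lp ℝ 2 μ)) ⊆ (semigroupForm T).dom) {D : Set (Lp ℝ 2 μ)} (hD : Dense D)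
    (hTD : ∀ t, 0 < t → ∀ u ∈ D, T t u ∈ M) :
    ∀ u ∈ (semigroupForm T).dom, u ∈ ((semigroupForm T).closureOf (M : Set (Lp ℝ 2 μ))).dom := by
  have hq := hT.isClosedForm
  -- Approximating `u` in `L²` by elements of `D`, the images under `T t` converge in `L²` with
  -- energies bounded by a constant over `t`.
  have h1 : ∀ t, 0 < t → ∀ u, T t u ∈ ((semigroupForm T).closureOf (M : Set (Lp ℝ 2 μ))).dom := by
    intro t ht u
    obtain ⟨f, hf, hlim⟩ := mem_closure_iff_seq_limit.1 (hD u)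
    obtain ⟨R, hR⟩ := (Metric.isBounded_range_of_tendsto f hlim).exists_norm_le
    refine hq.mem_closureOf_of_bounded hM (fun n => hTD t ht (f n) (hf n)) (C := R ^ 2 / t)
      (fun n => (hT.apply_mem_dom ht (f n)).2.trans ?_) (((T t).continuous.tendsto u).comp hlim)
    gcongr
    exact hR _ ⟨n, rfl⟩
  intro u hu
  have hN := hq.isClosedForm_closureOf hM
  have hsub : (hN.domain : Set (Lp ℝ 2 μ)) ⊆ (semigroupForm T).dom := fun u hu => hu.1
  -- Since closing twice gives nothing new, it remains to reach `u` from the elements `T t u` as `t`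
  -- decreases to zero; their energies are at most that of `u`.
  refine hq.closureOf_closureOf hM (D := hN.domain) (fun u hu => hu) ?_
  have hlim : Tendsto (fun n : ℕ => (1 / ((n + 1 : ℕ) : ℝ≥0))) atTop (𝓝[>] 0) := by
    rw [tendsto_nhdsWithin_iff]
    refine ⟨?_, Eventually.of_forall fun n => by simp only [mem_Ioi]; positivity⟩
    exact (tendsto_nnreal_div_nat 1).comp (tendsto_add_atTop_nat 1)
  exact hq.mem_closureOf_of_bounded hsub (v := fun n : ℕ => T (1 / ((n + 1 : ℕ) : ℝ≥0)) u)
    (fun n => h1 _ (by positivity) u) (fun n => (hT.form_apply_le _ hu).2)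
    ((hT.cont u).comp hlim)

end Form

end IsSymmSemigroup

end Diffusion

end

/-! ### Sub-Markov kernels as operators on `L²`, and tensor products in `L²` -/

noncomputable section

namespace Diffusion

open ProbabilityTheory
open scoped RealInnerProductSpace

section Total

variable {S : Type*} [MeasurableSpace S] {μ : Measure S}

theorem l2_inner (u v : Lp ℝ 2 μ) : ⟪u, v⟫ = ∫ x, u x * v x ∂μ := by
  rw [L2.inner_def]
  exact integral_congr_ae (Eventually.of_forall fun x => by simp [mul_comm])

theorem l2_norm_sq (u : Lp ℝ 2 μ) : ‖u‖ ^ 2 = ∫ x, u x ^ 2 ∂μ := by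
  rw [← real_inner_self_eq_norm_sq, l2_inner]
  simp only [sq]

theorem dense_span_of_orthogonal {D : Set (Lp ℝ 2 μ)}
    (h : ∀ u : Lp ℝ 2 μ, (∀ v ∈ D, ⟪v, u⟫ = 0) → u = 0) :
    Dense (Submodule.span ℝ D : Set (Lp ℝ 2 μ)) := by
  rw [Submodule.dense_iff_topologicalClosure_eq_top, Submodule.topologicalClosure_eq_top_iff,
    Submodule.eq_bot_iff]
  intro u hu
  exact h u fun v hv => (Submodule.mem_orthogonal _ _).1 hu v (Submodule.subset_span hv)

/-- The classes of indicators of sets of finite measure. -/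
def indicators (μ : Measure S) : Set (Lp ℝ 2 μ) :=
  {u | ∃ (A : Set S) (hA : MeasurableSet A) (hμ : μ A ≠ ∞), u = indicatorConstLp 2 hA hμ 1}

theorem dense_indicators : Dense (Submodule.span ℝ (indicators μ) : Set (Lp ℝ 2 μ)) := by
  refine dense_span_of_orthogonal fun u hu => ?_
  have h : u =ᵐ[μ] 0 := by
    refine Lp.ae_eq_zero_of_forall_setIntegral_eq_zero u two_ne_zero ENNReal.ofNat_ne_top
      (fun s hs hμ => ?_) fun s hs hμ => ?_
    · exact integrableOn_Lp_of_measure_ne_top u (by norm_num) hμ.ne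
    · rw [← L2.inner_indicatorConstLp_one (𝕜 := ℝ) hs hμ.ne]
      exact hu _ ⟨s, hs, hμ.ne, rfl⟩
  exact (Lp.eq_zero_iff_ae_eq_zero).2 h

end Total

section KernelOp

variable {S : Type*} [MeasurableSpace S] {μ : Measure S} {κ : Kernel S S}

/-- Sub-Markov kernels with an excessive measure. -/
structure IsSubinvariant (κ : Kernel S S) (μ : Measure S) : Prop where
  mass : ∀ x, κ x univ ≤ 1
  inv : μ.bind κ ≤ μ

namespace IsSubinvariant

theorem ae_ae (h : IsSubinvariant κ μ) {p : S → Prop} (hp : ∀ᵐ x ∂μ, p x) :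
    ∀ᵐ x ∂μ, ∀ᵐ y ∂(κ x), p y :=
  Measure.ae_ae_of_ae_bind κ.aemeasurable (h.inv.absolutelyContinuous.ae_le hp)

theorem lintegral_le (h : IsSubinvariant κ μ) {f : S → ℝ≥0∞} (hf : Measurable f) :
    ∫⁻ x, ∫⁻ y, f y ∂(κ x) ∂μ ≤ ∫⁻ x, f x ∂μ := by
  rw [← Measure.lintegral_bind κ.aemeasurable hf.aemeasurable]
  exact lintegral_mono' h.inv le_rfl

/-- Jensen's inequality; the total mass is at most one, so the factor coming from Hölder's
inequality can be dropped. -/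
theorem enorm_integral_sq_le (h : IsSubinvariant κ μ) {u : S → ℝ} (hu : StronglyMeasurable u) (x : S) :
    ‖∫ y, u y ∂(κ x)‖ₑ ^ 2 ≤ ∫⁻ y, ‖u y‖ₑ ^ 2 ∂(κ x) := by
  have h1 := enorm_integral_le_lintegral_enorm (μ := κ x) u
  rw [← eLpNorm_one_eq_lintegral_enorm] at h1
  have h2 := eLpNorm_le_eLpNorm_mul_rpow_measure_univ (show (1 : ℝ≥0∞) ≤ 2 by norm_num)
    (hu.aestronglyMeasurable (μ := κ x))
  have h3 : (κ x) univ ^ (1 / (1 : ℝ≥0∞).toReal - 1 / (2 : ℝ≥0∞).toReal) ≤ 1 :=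
    ENNReal.rpow_le_one (h.mass x) (by norm_num)
  have h4 : ‖∫ y, u y ∂(κ x)‖ₑ ≤ eLpNorm u 2 (κ x) :=
    (h1.trans h2).trans ((mul_le_mul_right h3 _).trans_eq (mul_one _))
  have h5 := eLpNorm_nnreal_pow_eq_lintegral (f := u) (μ := κ x) (p := 2) two_ne_zero
  calc _ ≤ eLpNorm u 2 (κ x) ^ 2 := by gcongr
    _ = _ := by simpa using h5

theorem eLpNorm_le (h : IsSubinvariant κ μ) {u : S → ℝ} (hu : StronglyMeasurable u) :
    eLpNorm (fun x => ∫ y, u y ∂(κ x)) 2 μ ≤ eLpNorm u 2 μ := by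
  have h5 := eLpNorm_nnreal_pow_eq_lintegral (f := u) (μ := μ) (p := 2) two_ne_zero
  have h6 := eLpNorm_nnreal_pow_eq_lintegral (f := fun x => ∫ y, u y ∂(κ x)) (μ := μ) (p := 2)
    two_ne_zero
  have h7 : ∫⁻ x, ‖∫ y, u y ∂(κ x)‖ₑ ^ (2 : ℝ) ∂μ ≤ ∫⁻ x, ‖u x‖ₑ ^ (2 : ℝ) ∂μ := by
    refine le_trans (lintegral_mono fun x => ?_) (h.lintegral_le (hu.enorm.pow_const 2))
    simpa using h.enorm_integral_sq_le hu x
  have h8 : eLpNorm (fun x => ∫ y, u y ∂(κ x)) 2 μ ^ (2 : ℝ) ≤ eLpNorm u 2 μ ^ (2 : ℝ) := by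
    simp only [ENNReal.coe_ofNat, NNReal.coe_ofNat] at h5 h6
    rw [h5, h6]
    exact h7
  exact (ENNReal.rpow_le_rpow_iff (by norm_num)).1 h8

theorem memLp (h : IsSubinvariant κ μ) {u : S → ℝ} (hu : StronglyMeasurable u) (hu2 : MemLp u 2 μ) :
    MemLp (fun x => ∫ y, u y ∂(κ x)) 2 μ :=
  ⟨hu.integral_kernel.aestronglyMeasurable, (h.eLpNorm_le hu).trans_lt hu2.2⟩

/-- Required for the additivity of the operator: the integral of a sum splits only where both
summands are integrable. -/
theorem ae_integrable (h : IsSubinvariant κ μ) {u : S → ℝ} (hu : StronglyMeasurable u)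
    (hu2 : MemLp u 2 μ) : ∀ᵐ x ∂μ, Integrable u (κ x) := by
  have h1 : ∫⁻ x, ∫⁻ y, ‖u y‖ₑ ^ (2 : ℝ) ∂(κ x) ∂μ ≠ ∞ := by
    refine ((h.lintegral_le (hu.enorm.pow_const 2)).trans_lt ?_).ne
    have := eLpNorm_nnreal_pow_eq_lintegral (f := u) (μ := μ) (p := 2) two_ne_zero
    simp only [ENNReal.coe_ofNat, NNReal.coe_ofNat] at this
    rw [← this]
    exact ENNReal.rpow_lt_top_of_nonneg (by norm_num) hu2.2.ne
  have hmeas : Measurable fun x => ∫⁻ y, ‖u y‖ₑ ^ (2 : ℝ) ∂(κ x) :=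
    (hu.enorm.pow_const 2).lintegral_kernel
  filter_upwards [ae_lt_top hmeas h1] with x hx
  have : IsFiniteMeasure (κ x) := ⟨(h.mass x).trans_lt ENNReal.one_lt_top⟩
  have hx2 : MemLp u 2 (κ x) := by
    refine ⟨hu.aestronglyMeasurable, ?_⟩
    rw [eLpNorm_lt_top_iff_lintegral_rpow_enorm_lt_top two_ne_zero ENNReal.ofNat_ne_top]
    simpa using hx
  exact hx2.integrable (by norm_num)

/-- The operator on `L²` of a sub-Markov kernel with an excessive measure. -/
def op (h : IsSubinvariant κ μ) : Lp ℝ 2 μ →L[ℝ] Lp ℝ 2 μ :=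
  LinearMap.mkContinuous
    { toFun := fun u => (h.memLp (Lp.stronglyMeasurable u) (Lp.memLp u)).toLp
      map_add' := fun u v => by
        ext1
        refine (MemLp.coeFn_toLp _).trans ?_
        filter_upwards [Lp.coeFn_add (MemLp.toLp _ (h.memLp (Lp.stronglyMeasurable u) (Lp.memLp u)))
            (MemLp.toLp _ (h.memLp (Lp.stronglyMeasurable v) (Lp.memLp v))),
          MemLp.coeFn_toLp (h.memLp (Lp.stronglyMeasurable u) (Lp.memLp u)),
          MemLp.coeFn_toLp (h.memLp (Lp.stronglyMeasurable v) (Lp.memLp v)),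
          h.ae_ae (Lp.coeFn_add u v), h.ae_integrable (Lp.stronglyMeasurable u) (Lp.memLp u),
          h.ae_integrable (Lp.stronglyMeasurable v) (Lp.memLp v)] with x h1 h2 h3 h4 h5 h6
        rw [h1, Pi.add_apply, h2, h3, ← integral_add h5 h6]
        exact integral_congr_ae h4
      map_smul' := fun c u => by
        ext1
        refine (MemLp.coeFn_toLp _).trans ?_
        filter_upwards [Lp.coeFn_smul c
            (MemLp.toLp _ (h.memLp (Lp.stronglyMeasurable u) (Lp.memLp u))),
          MemLp.coeFn_toLp (h.memLp (Lp.stronglyMeasurable u) (Lp.memLp u)),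
          h.ae_ae (Lp.coeFn_smul c u)] with x h1 h2 h4
        simp only [RingHom.id_apply]
        rw [h1, Pi.smul_apply, h2, smul_eq_mul, ← integral_const_mul]
        exact integral_congr_ae h4 }
    1 fun u => by
      rw [one_mul]
      simp only [LinearMap.coe_mk, AddHom.coe_mk]
      rw [Lp.norm_toLp, Lp.norm_def]
      exact ENNReal.toReal_mono (Lp.memLp u).2.ne (h.eLpNorm_le (Lp.stronglyMeasurable u))

theorem coeFn_op (h : IsSubinvariant κ μ) (u : Lp ℝ 2 μ) :
    h.op u =ᵐ[μ] fun x => ∫ y, u y ∂(κ x) :=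
  MemLp.coeFn_toLp (h.memLp (Lp.stronglyMeasurable u) (Lp.memLp u))

theorem norm_op_le (h : IsSubinvariant κ μ) (u : Lp ℝ 2 μ) : ‖h.op u‖ ≤ ‖u‖ := by
  have := (LinearMap.mkContinuous_norm_le _ zero_le_one _ : ‖h.op‖ ≤ 1)
  simpa using h.op.le_of_opNorm_le this u

/-- Excessiveness of `μ` makes a `μ`-null set negligible for `κ x`, for almost every `x`; the choice
of a representative is therefore immaterial. -/
theorem coeFn_op_congr (h : IsSubinvariant κ μ) {u : Lp ℝ 2 μ} {f : S → ℝ} (hf : u =ᵐ[μ] f) :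
    h.op u =ᵐ[μ] fun x => ∫ y, f y ∂(κ x) := by
  filter_upwards [h.coeFn_op u, h.ae_ae hf] with x h1 h2
  rw [h1]
  exact integral_congr_ae h2

theorem coeFn_op_indicator (h : IsSubinvariant κ μ) {A : Set S} (hA : MeasurableSet A)
    (hμ : μ A ≠ ∞) : h.op (indicatorConstLp 2 hA hμ 1) =ᵐ[μ] fun x => (κ x A).toReal := by
  filter_upwards [h.coeFn_op_congr (indicatorConstLp_coeFn (hs := hA) (hμs := hμ) (c := (1 : ℝ)))]
    with x hx
  rw [hx, integral_indicator_const _ hA]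
  simp [Measure.real]

/-- Symmetry is given on sets, that is for indicators of finite measure, and extends by linearity
and continuity in one argument after the other. -/
theorem op_symm (h : IsSubinvariant κ μ)
    (hsymm : ∀ A B : Set S, MeasurableSet A → MeasurableSet B →
      ∫⁻ x in A, κ x B ∂μ = ∫⁻ x in B, κ x A ∂μ) (u v : Lp ℝ 2 μ) :
    ⟪h.op u, v⟫ = ⟪u, h.op v⟫ := by
  have hfin : ∀ x A, κ x A ≠ ∞ := fun x A =>
    ((measure_mono (subset_univ A)).trans (h.mass x)).trans_lt ENNReal.one_lt_top |>.ne
  have key : ∀ u ∈ indicators μ, ∀ v ∈ indicators μ, ⟪h.op u, v⟫ = ⟪u, h.op v⟫ := by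
    have aux : ∀ {A B : Set S} (hA : MeasurableSet A) (hB : MeasurableSet B) (hμA : μ A ≠ ∞)
        (hμB : μ B ≠ ∞), ⟪indicatorConstLp 2 hA hμA (1 : ℝ), h.op (indicatorConstLp 2 hB hμB 1)⟫ =
          (∫⁻ x in A, κ x B ∂μ).toReal := by
      intro A B hA hB hμA hμB
      rw [L2.inner_indicatorConstLp_one (𝕜 := ℝ) hA hμA,
        setIntegral_congr_ae hA ((h.coeFn_op_indicator hB hμB).mono fun x hx _ => hx),
        integral_toReal (κ.measurable_coe hB).aemeasurable
          (Eventually.of_forall fun x => (hfin x B).lt_top)]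
    rintro _ ⟨A, hA, hμA, rfl⟩ _ ⟨B, hB, hμB, rfl⟩
    rw [real_inner_comm, aux hB hA hμB hμA, aux hA hB hμA hμB, hsymm B A hB hA]
  have h1 : ∀ u ∈ indicators μ, ∀ v, ⟪h.op u, v⟫ = ⟪u, h.op v⟫ := by
    intro u hu v
    have := ContinuousLinearMap.ext_on (f := innerSL ℝ (h.op u)) (g := (innerSL ℝ u).comp h.op)
      dense_indicators (fun v hv => key u hu v hv)
    exact congrArg (fun f => f v) this
  have := ContinuousLinearMap.ext_on (f := (innerSL ℝ v).comp h.op) (g := innerSL ℝ (h.op v))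
      dense_indicators (fun u hu => by
        simp only [ContinuousLinearMap.comp_apply, innerSL_apply_apply]
        rw [real_inner_comm, h1 u hu v, real_inner_comm])
  have := congrArg (fun f => f u) this
  simp only [ContinuousLinearMap.comp_apply, innerSL_apply_apply] at this
  rw [real_inner_comm, this, real_inner_comm]

theorem op_add {κ₁ κ₂ κ₃ : Kernel S S} (h₁ : IsSubinvariant κ₁ μ) (h₂ : IsSubinvariant κ₂ μ)
    (h₃ : IsSubinvariant κ₃ μ)
    (hck : ∀ x A, MeasurableSet A → κ₃ x A = ∫⁻ y, κ₂ y A ∂(κ₁ x)) (u : Lp ℝ 2 μ) :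
    h₃.op u = h₁.op (h₂.op u) := by
  have := ContinuousLinearMap.ext_on (f := h₃.op) (g := h₁.op.comp h₂.op) dense_indicators (by
    rintro _ ⟨A, hA, hμA, rfl⟩
    ext1
    filter_upwards [h₃.coeFn_op_indicator hA hμA,
      h₁.coeFn_op_congr (h₂.coeFn_op_indicator hA hμA)] with x h1 h2
    rw [h1, ContinuousLinearMap.comp_apply, h2, hck x A hA,
      integral_toReal (κ₂.measurable_coe hA).aemeasurable]
    exact Eventually.of_forall fun y =>
      ((measure_mono (subset_univ A)).trans (h₂.mass y)).trans_lt ENNReal.one_lt_top)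
  exact congrArg (fun f => f u) this

end IsSubinvariant

end KernelOp

/-- Strong continuity has to be checked on a total set only, and weakly. -/
theorem isSymmSemigroup_of_total {H : Type*} [NormedAddCommGroup H] [InnerProductSpace ℝ H]
    {T : ℝ≥0 → H →L[ℝ] H} (hadd : ∀ s t u, T (s + t) u = T s (T t u))
    (hcontr : ∀ t u, ‖T t u‖ ≤ ‖u‖) (hsymm : ∀ t u v, ⟪T t u, v⟫ = ⟪u, T t v⟫) {D : Set H}
    (hD : Dense (Submodule.span ℝ D : Set H))
    (hcont : ∀ u ∈ D, Tendsto (fun t => ⟪T t u, u⟫) (𝓝[>] 0) (𝓝 (‖u‖ ^ 2))) :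
    IsSymmSemigroup T := by
  have h1 : ∀ u ∈ D, Tendsto (fun t => T t u) (𝓝[>] 0) (𝓝 u) := by
    intro u hu
    rw [tendsto_iff_norm_sub_tendsto_zero]
    -- By contractivity `‖T t u - u‖ ^ 2 ≤ 2 * (‖u‖ ^ 2 - ⟪T t u, u⟫)`, so weak convergence tested
    -- on `u` itself gives norm convergence.
    have hlim : Tendsto (fun t => √(2 * (‖u‖ ^ 2 - ⟪T t u, u⟫))) (𝓝[>] 0) (𝓝 0) := by
      have := (((hcont u hu).const_sub (‖u‖ ^ 2)).const_mul 2).sqrt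
      simpa using this
    refine squeeze_zero (fun _ => norm_nonneg _) (fun t => ?_) hlim
    refine Real.le_sqrt_of_sq_le ?_
    rw [norm_sub_sq_real]
    have := pow_le_pow_left₀ (norm_nonneg _) (hcontr t u) 2
    linarith
  have h2 : ∀ u ∈ Submodule.span ℝ D, Tendsto (fun t => T t u) (𝓝[>] 0) (𝓝 u) := by
    intro u hu
    induction hu using Submodule.span_induction with
    | mem x hx => exact h1 x hx
    | zero => simp
    | add x y _ _ hx hy => simpa using hx.add hy
    | smul c x _ hx => simpa using hx.const_smul c
  have hcts : ∀ u, Tendsto (fun t => T t u) (𝓝[>] 0) (𝓝 u) := by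
    intro u
    rw [Metric.tendsto_nhds]
    intro ε hε
    obtain ⟨v, hv, huv⟩ := Metric.mem_closure_iff.1 (hD u) (ε / 3) (by linarith)
    filter_upwards [(Metric.tendsto_nhds.1 (h2 v hv)) (ε / 3) (by linarith)] with t ht
    have e1 : dist (T t u) (T t v) ≤ dist u v := by
      rw [dist_eq_norm, dist_eq_norm, ← map_sub]; exact hcontr t _
    calc dist (T t u) u ≤ dist (T t u) (T t v) + dist (T t v) v + dist v u := dist_triangle4 _ _ _ _
      _ < ε := by rw [dist_comm v u]; linarith
  refine ⟨fun u => ?_, hadd, hcontr, hsymm, hcts⟩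
  -- That `T 0` is the identity is not assumed: it follows from `T 0 (T t u) = T t u` as `t`
  -- decreases to zero.
  have e1 : Tendsto (fun t => T 0 (T t u)) (𝓝[>] 0) (𝓝 (T 0 u)) :=
    ((T 0).continuous.tendsto u).comp (hcts u)
  refine tendsto_nhds_unique e1 ((hcts u).congr fun t => ?_)
  rw [← hadd, zero_add]

section Tensor

variable {ι : Type*} [Fintype ι] {S : ι → Type*} [∀ i, MeasurableSpace (S i)]
  {m : ∀ i, Measure (S i)} [∀ i, SigmaFinite (m i)]

theorem aestronglyMeasurable_prod {f : ∀ i, S i → ℝ} (hf : ∀ i, AEStronglyMeasurable (f i) (m i)) :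
    AEStronglyMeasurable (fun x : ∀ i, S i => ∏ i, f i (x i)) (Measure.pi m) := by
  refine Finset.aestronglyMeasurable_fun_prod _ fun i _ => ?_
  exact (hf i).comp_quasiMeasurePreserving (Measure.quasiMeasurePreserving_eval m i)

theorem prod_congr_ae {f g : ∀ i, S i → ℝ} (h : ∀ i, f i =ᵐ[m i] g i) :
    (fun x : ∀ i, S i => ∏ i, f i (x i)) =ᵐ[Measure.pi m] fun x => ∏ i, g i (x i) := by
  filter_upwards [Measure.ae_eq_pi h] with x hx
  exact Finset.prod_congr rfl fun i _ => congrFun hx i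

theorem memLp_prod {f : ∀ i, S i → ℝ} (hf : ∀ i, MemLp (f i) 2 (m i)) :
    MemLp (fun x : ∀ i, S i => ∏ i, f i (x i)) 2 (Measure.pi m) := by
  rw [memLp_two_iff_integrable_sq (aestronglyMeasurable_prod fun i => (hf i).1)]
  simp only [← Finset.prod_pow]
  exact Integrable.fintype_prod_dep (f := fun i z => f i z ^ 2) fun i => (hf i).integrable_sq

/-- The tensor product of elements of `L²`. -/
def tens (f : ∀ i, Lp ℝ 2 (m i)) : Lp ℝ 2 (Measure.pi m) :=
  (memLp_prod fun i => Lp.memLp (f i)).toLp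

theorem coeFn_tens (f : ∀ i, Lp ℝ 2 (m i)) :
    tens f =ᵐ[Measure.pi m] fun x => ∏ i, f i (x i) := MemLp.coeFn_toLp _

theorem eq_tens {f : ∀ i, Lp ℝ 2 (m i)} {u : Lp ℝ 2 (Measure.pi m)}
    (h : u =ᵐ[Measure.pi m] fun x => ∏ i, f i (x i)) : u = tens f :=
  Lp.ext (h.trans (coeFn_tens f).symm)

theorem inner_tens (f g : ∀ i, Lp ℝ 2 (m i)) : ⟪tens f, tens g⟫ = ∏ i, ⟪f i, g i⟫ := by
  simp only [l2_inner]
  rw [← integral_fintype_prod_eq_prod (fun i z => f i z * g i z)]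
  refine integral_congr_ae ?_
  filter_upwards [coeFn_tens f, coeFn_tens g] with x h1 h2
  rw [h1, h2, Finset.prod_mul_distrib]

theorem norm_sq_tens (f : ∀ i, Lp ℝ 2 (m i)) : ‖tens f‖ ^ 2 = ∏ i, ‖f i‖ ^ 2 := by
  simp only [← real_inner_self_eq_norm_sq, inner_tens]

/-- An element orthogonal to all tensors has zero integral over rectangles, because products of
indicators are tensors. It is cut down to the boxes `R n` of finite measure, where it is integrable
and sets can be handled by a π-λ argument. -/
theorem dense_tens : Dense (Submodule.span ℝ (range (tens (m := m))) :
    Set (Lp ℝ 2 (Measure.pi m))) := by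
  refine dense_span_of_orthogonal fun u hu => ?_
  set R : ℕ → Set (∀ i, S i) := fun n => univ.pi fun i => spanningSets (m i) n with hR
  have hRm : ∀ n, MeasurableSet (R n) := fun n =>
    MeasurableSet.univ_pi fun i => measurableSet_spanningSets (m i) n
  have hRfin : ∀ n, Measure.pi m (R n) ≠ ∞ := fun n => by
    rw [hR, Measure.pi_pi]
    exact (ENNReal.prod_lt_top fun i _ => measure_spanningSets_lt_top (m i) n).ne
  have hRcov : ⋃ n, R n = univ := by
    refine eq_univ_of_forall fun x => mem_iUnion.2 ?_
    obtain ⟨N, hN⟩ := (finite_range fun i => spanningSetsIndex (m i) (x i)).bddAbove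
    exact ⟨N, fun i _ => mem_spanningSets_of_index_le (m i) (x i) (hN ⟨i, rfl⟩)⟩
  have hint : ∀ n, IntegrableOn u (R n) (Measure.pi m) := fun n =>
    integrableOn_Lp_of_measure_ne_top u (by norm_num) (hRfin n)
  have hrect : ∀ n, ∀ A : ∀ i, Set (S i), (∀ i, MeasurableSet (A i)) →
      ∫ x in univ.pi A ∩ R n, u x ∂(Measure.pi m) = 0 := by
    intro n A hA
    have hB : ∀ i, MeasurableSet (A i ∩ spanningSets (m i) n) := fun i =>
      (hA i).inter (measurableSet_spanningSets (m i) n)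
    have hBfin : ∀ i, m i (A i ∩ spanningSets (m i) n) ≠ ∞ := fun i =>
      ((measure_mono inter_subset_right).trans_lt (measure_spanningSets_lt_top (m i) n)).ne
    have h := hu _ ⟨fun i => indicatorConstLp 2 (hB i) (hBfin i) 1, rfl⟩
    rw [hR, ← pi_inter_distrib, ← integral_indicator (MeasurableSet.univ_pi hB), ← h, l2_inner]
    refine integral_congr_ae ?_
    filter_upwards [coeFn_tens fun i => indicatorConstLp 2 (hB i) (hBfin i) (1 : ℝ),
      prod_congr_ae fun i => indicatorConstLp_coeFn (p := 2) (hs := hB i) (hμs := hBfin i)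
        (c := (1 : ℝ))] with x h1 h2
    rw [h1, h2]
    by_cases hx : x ∈ univ.pi fun i => A i ∩ spanningSets (m i) n
    · rw [indicator_of_mem hx, Finset.prod_eq_one, one_mul]
      exact fun i _ => indicator_of_mem (hx i (mem_univ i)) _
    · rw [indicator_of_notMem hx]
      simp only [mem_univ_pi, not_forall] at hx
      obtain ⟨i, hi⟩ := hx
      rw [Finset.prod_eq_zero (Finset.mem_univ i) (indicator_of_notMem hi _), zero_mul]
  have hall : ∀ n, ∀ A, MeasurableSet A → ∫ x in A ∩ R n, u x ∂(Measure.pi m) = 0 := by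
    intro n A hA
    induction A, hA using MeasurableSpace.induction_on_inter
        (generateFrom_pi (α := S)).symm (isPiSystem_pi (α := S)) with
    | empty => simp
    | basic A hA =>
      obtain ⟨B, hB, rfl⟩ := hA
      exact hrect n B fun i => hB i (mem_univ i)
    | compl A hA ih =>
      have h1 := integral_inter_add_sdiff (s := R n) hA (hint n)
      have h2 := hrect n (fun _ => univ) fun _ => MeasurableSet.univ
      rw [pi_univ, univ_inter] at h2
      rw [inter_comm, ih, h2, zero_add] at h1
      rwa [inter_comm, ← sdiff_eq]
    | iUnion f hd hf ih =>
      rw [iUnion_inter, integral_iUnion (fun i => (hf i).inter (hRm n))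
        (fun i j hij => (hd hij).mono inter_subset_left inter_subset_left)
        ((hint n).mono_set (iUnion_subset fun i => inter_subset_right))]
      simp [ih]
  have hz : ∀ n, u =ᵐ[(Measure.pi m).restrict (R n)] (0 : (∀ i, S i) → ℝ) := by
    intro n
    refine Integrable.ae_eq_zero_of_forall_setIntegral_eq_zero (hint n) fun s hs _ => ?_
    rw [Measure.restrict_restrict hs]
    exact hall n s hs
  refine (Lp.eq_zero_iff_ae_eq_zero).2 ?_
  have : ∀ᵐ x ∂((Measure.pi m).restrict (⋃ n, R n)), u x = (0 : (∀ i, S i) → ℝ) x :=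
    (ae_restrict_iUnion_iff _ _).2 hz
  rwa [hRcov, Measure.restrict_univ] at this

end Tensor

end Diffusion

end

/-! ### Transition semigroups of processes and of Cartesian products -/

noncomputable section

namespace Diffusion

open ProbabilityTheory
open scoped RealInnerProductSpace

theorem dense_continuous_compactSupport {S : Type*} [TopologicalSpace S] [MeasurableSpace S]
    [BorelSpace S] [T2Space S] [NormalSpace S] [LocallyCompactSpace S] (μ : Measure S) [μ.Regular] :
    Dense {u : Lp ℝ 2 μ | ∃ f : S → ℝ, Continuous f ∧ HasCompactSupport f ∧ u =ᵐ[μ] f} := by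
  rw [Metric.dense_iff]
  intro u ε hε
  obtain ⟨g, hg, hle, hcont, hmem⟩ := (Lp.memLp u).exists_hasCompactSupport_eLpNorm_sub_le
    ENNReal.ofNat_ne_top (ε := ENNReal.ofReal (ε / 2)) (by simpa using hε)
  refine ⟨hmem.toLp, ?_, g, hcont, hg, hmem.coeFn_toLp⟩
  rw [Metric.mem_ball, dist_comm, Lp.dist_def]
  have h1 : eLpNorm ((u : S → ℝ) - ((hmem.toLp g : Lp ℝ 2 μ) : S → ℝ)) 2 μ = eLpNorm ((u : S → ℝ) - g) 2 μ :=
    eLpNorm_congr_ae ((ae_eq_refl _).sub hmem.coeFn_toLp)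
  rw [h1]
  calc _ ≤ ε / 2 := ENNReal.toReal_le_of_le_ofReal (by linarith) hle
    _ < ε := by linarith

namespace KilledProcess

section

variable {S : Type*} [MeasurableSpace S] {μ : Measure S} {X : KilledProcess S}

theorem dirichletForm_eq {T : ℝ≥0 → Lp ℝ 2 μ →L[ℝ] Lp ℝ 2 μ}
    (h : ∀ t u, T t u =ᵐ[μ] X.transition t u) : X.dirichletForm μ = semigroupForm T := by
  have h1 : ∀ t u v, X.approxForm μ t u v = approx T t u v := by
    intro t u v
    rw [approxForm, approx, l2_inner]
    congr 1
    refine integral_congr_ae ?_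
    filter_upwards [h t u, Lp.coeFn_sub u (T t u)] with x h1 h2
    rw [h2, Pi.sub_apply, h1]
  simp only [dirichletForm, semigroupForm, h1]

theorem visit_eq {S : Type*} {X : KilledProcess S} (t : ℝ≥0) (A : Set S) : X.visit t A = X.X t ⁻¹' A ∩ X.visit t univ := by
  ext ω; simp [visit, and_comm]

variable [TopologicalSpace S]

/-- The position is not assumed to be measurable; only the events of being alive and in a set are.
Off the event of being alive, a constant value is substituted. -/
theorem aemeasurable_X (hX : X.IsContinuousMarkov) (t : ℝ≥0) (x : S) :
    AEMeasurable (X.X t) ((X.P x).restrict (X.visit t univ)) := by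
  classical
  have hV := hX.measurable_visit t univ MeasurableSet.univ
  refine ⟨fun ω => if ω ∈ X.visit t univ then X.X t ω else x, ?_, ?_⟩
  · intro B hB
    have : (fun ω => if ω ∈ X.visit t univ then X.X t ω else x) ⁻¹' B =
        X.visit t B ∪ ((X.visit t univ)ᶜ ∩ {_ω | x ∈ B}) := by
      ext ω
      by_cases h : ω ∈ X.visit t univ
      · rw [visit_eq t B]; simp [h]
      · rw [visit_eq t B]; simp [h]
    rw [this]
    exact (hX.measurable_visit t B hB).union (hV.compl.inter (MeasurableSet.const _))
  · filter_upwards [ae_restrict_mem hV] with ω hω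
    simp [hω]

/-- The transition kernel of a process. -/
def kern (hX : X.IsContinuousMarkov) (t : ℝ≥0) : Kernel S S where
  toFun x := ((X.P x).restrict (X.visit t univ)).map (X.X t)
  measurable' := by
    refine Measure.measurable_of_measurable_coe _ fun A hA => ?_
    convert hX.measurable_law t A hA using 2 with x
    rw [Measure.map_apply_of_aemeasurable (aemeasurable_X hX t x) hA,
      Measure.restrict_apply' (hX.measurable_visit t univ MeasurableSet.univ), visit_eq t A]

theorem kern_def (hX : X.IsContinuousMarkov) (t : ℝ≥0) (x : S) :
    kern hX t x = ((X.P x).restrict (X.visit t univ)).map (X.X t) := rfl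

theorem kern_apply (hX : X.IsContinuousMarkov) (t : ℝ≥0) (x : S) {A : Set S}
    (hA : MeasurableSet A) : kern hX t x A = X.P x (X.visit t A) := by
  rw [kern_def, Measure.map_apply_of_aemeasurable (aemeasurable_X hX t x) hA,
      Measure.restrict_apply' (hX.measurable_visit t univ MeasurableSet.univ), visit_eq t A]

theorem kern_le_one (hX : X.IsContinuousMarkov) (t : ℝ≥0) (x : S) : kern hX t x univ ≤ 1 := by
  have := hX.prob x
  rw [kern_apply hX t x MeasurableSet.univ]
  exact prob_le_one

theorem transition_eq (hX : X.IsContinuousMarkov) (t : ℝ≥0) {f : S → ℝ} (hf : StronglyMeasurable f)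
    (x : S) : X.transition t f x = ∫ y, f y ∂(kern hX t x) := by
  rw [kern_def, integral_map (aemeasurable_X hX t x) hf.aestronglyMeasurable]
  rfl

/-- Symmetry between the whole space and `A` gives `∫ p_t(x, A) dμ = ∫_A p_t(x, S) dμ ≤ μ A`. -/
theorem isSubinvariant (hX : X.IsContinuousMarkov) (hs : X.IsSymmetric μ) (t : ℝ≥0) :
    IsSubinvariant (kern hX t) μ where
  mass := kern_le_one hX t
  inv := by
    rw [Measure.le_iff]
    intro A hA
    rw [Measure.bind_apply hA (kern hX t).aemeasurable]
    have := hs t univ A MeasurableSet.univ hA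
    rw [Measure.restrict_univ] at this
    simp only [kern_apply hX t _ hA, this, ← kern_apply hX t _ MeasurableSet.univ]
    calc _ ≤ ∫⁻ _ in A, 1 ∂μ := lintegral_mono fun x => kern_le_one hX t x
      _ = _ := by simp

theorem kern_add (hX : X.IsContinuousMarkov) (t r : ℝ≥0) (x : S) {A : Set S}
    (hA : MeasurableSet A) : kern hX (t + r) x A = ∫⁻ y, kern hX r y A ∂(kern hX t x) := by
  have hV : MeasurableSet[X.history t] (X.visit t univ) :=
    MeasurableSpace.measurableSet_generateFrom ⟨t, le_rfl, univ, MeasurableSet.univ, rfl⟩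
  have h := hX.markov x t r _ A hV hA
  rw [kern_apply hX _ _ hA, kern_def,
    lintegral_map' ((kern hX r).measurable_coe hA).aemeasurable (aemeasurable_X hX t x)]
  rw [inter_self] at h
  simp only [kern_apply hX r _ hA]
  rw [← h]
  congr 1
  -- Being alive at time `t + r` implies being alive at time `t`, so the intersection with the past
  -- event in the Markov property changes nothing.
  ext ω
  simp only [visit, mem_ofPred_eq, mem_inter_iff, mem_univ, and_true]
  refine ⟨fun h' => ⟨lt_of_le_of_lt ?_ h'.1, h'⟩, fun h' => h'.2⟩
  push_cast
  exact le_self_add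

/-- Almost every path is alive on a neighborhood of time zero and continuous there, so the indicator
of survival is eventually one and dominated convergence applies. -/
theorem tendsto_transition (hX : X.IsContinuousMarkov) [BorelSpace S] [SecondCountableTopology S]
    {f : S → ℝ} (hf : Continuous f) {C : ℝ} (hC : ∀ x, ‖f x‖ ≤ C) (x : S) :
    Tendsto (fun t => X.transition t f x) (𝓝[>] 0) (𝓝 (f x)) := by
  have := hX.prob x
  have hV := fun t => hX.measurable_visit t univ MeasurableSet.univ
  have h1 : ∀ t, X.transition t f x =
      ∫ ω, (X.visit t univ).indicator (fun ω => f (X.X t ω)) ω ∂(X.P x) := fun t =>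
    (integral_indicator (hV t)).symm
  simp only [h1]
  have h2 : f x = ∫ _ω, f x ∂(X.P x) := by simp
  rw [h2]
  refine tendsto_integral_filter_of_dominated_convergence (fun _ => C)
    (Eventually.of_forall fun t => ?_) (Eventually.of_forall fun t => Eventually.of_forall fun ω => ?_)
    (integrable_const _) ?_
  · rw [aestronglyMeasurable_indicator_iff (hV t)]
    exact (hf.measurable.comp_aemeasurable (aemeasurable_X hX t x)).aestronglyMeasurable
  · exact (norm_indicator_le_norm_self _ _).trans (hC _)
  · filter_upwards [hX.start x, hX.continuous_paths x] with ω h0 hc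
    have hopen : {t : ℝ≥0 | (t : ℝ≥0∞) < X.ζ ω} ∈ 𝓝 (0 : ℝ≥0) :=
      (isOpen_Iio.preimage ENNReal.continuous_coe).mem_nhds (by simpa using h0.1)
    have hlim : Tendsto (fun t => f (X.X t ω)) (𝓝 0) (𝓝 (f x)) := by
      have := (hc.continuousAt hopen).tendsto
      rw [h0.2] at this
      exact (hf.tendsto x).comp this
    refine (hlim.mono_left nhdsWithin_le_nhds).congr' ?_
    filter_upwards [mem_nhdsWithin_of_mem_nhds hopen] with t ht
    rw [indicator_of_mem]
    exact ⟨ht, mem_univ _⟩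

/-- The transition semigroup on `L²`. -/
def semigroup (hX : X.IsContinuousMarkov) (hs : X.IsSymmetric μ) (t : ℝ≥0) :
    Lp ℝ 2 μ →L[ℝ] Lp ℝ 2 μ := (isSubinvariant hX hs t).op

theorem semigroup_coe (hX : X.IsContinuousMarkov) (hs : X.IsSymmetric μ) (t : ℝ≥0)
    (u : Lp ℝ 2 μ) : semigroup hX hs t u =ᵐ[μ] X.transition t u := by
  filter_upwards [(isSubinvariant hX hs t).coeFn_op u] with x hx
  rw [semigroup, hx, transition_eq hX t (Lp.stronglyMeasurable u)]

/-- Strong continuity is tested on continuous functions with compact support only, where the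
transition function converges pointwise and is dominated by a multiple of an integrable function. -/
theorem isSymmSemigroup (hX : X.IsContinuousMarkov) (hs : X.IsSymmetric μ) [BorelSpace S]
    [SecondCountableTopology S] [T2Space S] [NormalSpace S] [LocallyCompactSpace S] [μ.Regular] :
    IsSymmSemigroup (semigroup hX hs) := by
  refine isSymmSemigroup_of_total
    (D := {u : Lp ℝ 2 μ | ∃ f : S → ℝ, Continuous f ∧ HasCompactSupport f ∧ u =ᵐ[μ] f})
    (fun s t u => ?_) (fun t u => (isSubinvariant hX hs t).norm_op_le u) (fun t u v => ?_)
    ((dense_continuous_compactSupport μ).mono Submodule.subset_span) ?_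
  · exact IsSubinvariant.op_add (isSubinvariant hX hs s) (isSubinvariant hX hs t)
      (isSubinvariant hX hs (s + t)) (fun x A hA => kern_add hX s t x hA) u
  · refine (isSubinvariant hX hs t).op_symm (fun A B hA hB => ?_) u v
    simp only [kern_apply hX t _ hA, kern_apply hX t _ hB]
    exact hs t A B hA hB
  · rintro u ⟨f, hf, hfc, huf⟩
    obtain ⟨C, hC⟩ := hfc.exists_bound_of_continuous hf
    have hint : Integrable f μ := hf.integrable_of_hasCompactSupport hfc
    have hfs : StronglyMeasurable f := hf.measurable.stronglyMeasurable
    have e1 : ∀ t, ⟪semigroup hX hs t u, u⟫ = ∫ x, X.transition t f x * f x ∂μ := by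
      intro t
      rw [l2_inner]
      refine integral_congr_ae ?_
      filter_upwards [(isSubinvariant hX hs t).coeFn_op_congr huf, huf] with x h1 h2
      rw [semigroup, h1, h2, transition_eq hX t hfs]
    have e2 : ‖u‖ ^ 2 = ∫ x, f x * f x ∂μ := by
      rw [l2_norm_sq]
      refine integral_congr_ae ?_
      filter_upwards [huf] with x h2
      rw [h2, sq]
    simp only [e1, e2]
    have htr : ∀ t x, ‖X.transition t f x‖ ≤ C := by
      intro t x
      have := hX.prob x
      have hb : ‖X.transition t f x‖ ≤ C * (X.P x).real (X.visit t univ) :=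
        norm_setIntegral_le_of_norm_le_const (measure_lt_top _ _) fun ω _ => hC _
      have hC0 : 0 ≤ C := (norm_nonneg _).trans (hC x)
      exact hb.trans (mul_le_of_le_one_right hC0 measureReal_le_one)
    refine tendsto_integral_filter_of_dominated_convergence (fun x => C * ‖f x‖)
      (Eventually.of_forall fun t => ?_)
      (Eventually.of_forall fun t => Eventually.of_forall fun x => ?_)
      (hint.norm.const_mul C) (Eventually.of_forall fun x => ?_)
    · simp only [transition_eq hX t hfs]
      exact (hfs.integral_kernel.mul hfs).aestronglyMeasurable
    · rw [norm_mul]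
      exact mul_le_mul_of_nonneg_right (htr t x) (norm_nonneg _)
    · exact (tendsto_transition hX hf hC x).mul_const _

theorem dirichletForm_eq_semigroupForm (hX : X.IsContinuousMarkov) (hs : X.IsSymmetric μ) :
    X.dirichletForm μ = semigroupForm (semigroup hX hs) :=
  dirichletForm_eq (semigroup_coe hX hs)

end

end KilledProcess

section Product

variable {d : ℕ} {S : Fin d → Type*} [∀ i, MeasurableSpace (S i)]

theorem lintegral_fin_prod {d : ℕ} {S : Fin d → Type*} [∀ i, MeasurableSpace (S i)]
    {μ : ∀ i, Measure (S i)} [∀ i, SigmaFinite (μ i)] {f : ∀ i, S i → ℝ≥0∞}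
    (hf : ∀ i, Measurable (f i)) :
    ∫⁻ x, ∏ i, f i (x i) ∂(Measure.pi μ) = ∏ i, ∫⁻ z, f i z ∂(μ i) := by
  induction d with
  | zero => simp
  | succ n ih =>
    rw [← ((measurePreserving_piFinSuccAbove μ 0).symm).lintegral_comp_emb
      (MeasurableEquiv.measurableEmbedding _)]
    simp_rw [MeasurableEquiv.piFinSuccAbove_symm_apply, Fin.insertNthEquiv,
      Fin.prod_univ_succ, Fin.insertNth_zero, Equiv.coe_fn_mk, Fin.cons_succ,
      Fin.zero_succAbove, Fin.cons_zero]
    rw [← ih fun i => hf i.succ]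
    refine lintegral_prod_mul (μ := μ 0) (ν := Measure.pi fun j : Fin n => μ j.succ) (f := f 0)
      (g := fun y : ∀ j : Fin n, S j.succ => ∏ i, f i.succ (y i)) (hf 0).aemeasurable ?_
    exact (Finset.measurable_fun_prod _ fun i _ =>
      (hf i.succ).comp (measurable_pi_apply i)).aemeasurable

/-- The product of sub-Markov kernels. -/
def piKernel (κ : ∀ i, Kernel (S i) (S i)) (hκ : ∀ i x, κ i x univ ≤ 1) :
    Kernel (∀ i, S i) (∀ i, S i) where
  toFun x := Measure.pi fun i => κ i (x i)
  measurable' := by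
    have hfin : ∀ i x, IsFiniteMeasure (κ i x) := fun i x =>
      ⟨(hκ i x).trans_lt ENNReal.one_lt_top⟩
    have hmeas : ∀ A : ∀ i, Set (S i), (∀ i, MeasurableSet (A i)) →
        Measurable fun x : ∀ i, S i => Measure.pi (fun i => κ i (x i)) (univ.pi A) := by
      intro A hA
      simp only [Measure.pi_pi]
      exact Finset.measurable_fun_prod _ fun i _ =>
        ((κ i).measurable_coe (hA i)).comp (measurable_pi_apply i)
    refine Measurable.measure_of_isPiSystem (generateFrom_pi (α := S)).symm
      (isPiSystem_pi (α := S)) ?_ ?_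
    · rintro _ ⟨A, hA, rfl⟩
      exact hmeas A fun i => hA i (mem_univ i)
    · have := hmeas (fun _ => univ) fun _ => MeasurableSet.univ
      rwa [pi_univ] at this

theorem piKernel_apply (κ : ∀ i, Kernel (S i) (S i)) (hκ : ∀ i x, κ i x univ ≤ 1) (x : ∀ i, S i) :
    piKernel κ hκ x = Measure.pi fun i => κ i (x i) := rfl

/-- The product outer measure is the largest one that is bounded on boxes by the products of the
factors. -/
theorem measure_pi_mono {μ ν : ∀ i, Measure (S i)} [∀ i, SigmaFinite (μ i)] [∀ i, SigmaFinite (ν i)]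
    (h : ∀ i, μ i ≤ ν i) : Measure.pi μ ≤ Measure.pi ν := by
  have h1 : (OuterMeasure.pi fun i => (μ i).toOuterMeasure) ≤
      OuterMeasure.pi fun i => (ν i).toOuterMeasure := by
    rw [OuterMeasure.le_pi]
    intro s _
    exact (OuterMeasure.pi_pi_le _ _).trans (Finset.prod_le_prod' fun i _ => h i (s i))
  rw [Measure.le_iff]
  intro A hA
  rw [Measure.pi, Measure.pi, toMeasure_apply _ _ hA, toMeasure_apply _ _ hA]
  exact h1 A

theorem isSubinvariant_piKernel {m : ∀ i, Measure (S i)} [∀ i, SigmaFinite (m i)]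
    {κ : ∀ i, Kernel (S i) (S i)} (h : ∀ i, IsSubinvariant (κ i) (m i)) :
    IsSubinvariant (piKernel κ fun i => (h i).mass) (Measure.pi m) := by
  have hfin : ∀ i x, IsFiniteMeasure (κ i x) := fun i x =>
    ⟨((h i).mass x).trans_lt ENNReal.one_lt_top⟩
  constructor
  · intro x
    rw [piKernel_apply, Measure.pi_univ]
    exact Finset.prod_le_one' fun i _ => (h i).mass (x i)
  -- The image of `m i` is dominated by `m i`, so the same spanning sets serve for it; with this the
  -- image of the product measure is characterized by its values on boxes.
  · have hsf : ∀ i, SigmaFinite ((m i).bind (κ i)) := fun i => by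
      refine ⟨⟨⟨spanningSets (m i), fun _ => trivial, fun n => ?_, iUnion_spanningSets (m i)⟩⟩⟩
      exact ((h i).inv _).trans_lt (measure_spanningSets_lt_top (m i) n)
    have : Measure.pi (fun i => (m i).bind (κ i)) =
        (Measure.pi m).bind (piKernel κ fun i => (h i).mass) := by
      refine Measure.pi_eq fun A hA => ?_
      rw [Measure.bind_apply (MeasurableSet.univ_pi hA) (Kernel.aemeasurable _)]
      simp only [piKernel_apply, Measure.pi_pi]
      rw [lintegral_fin_prod (μ := m) (f := fun i z => κ i z (A i))
        fun i => (κ i).measurable_coe (hA i)]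
      exact Finset.prod_congr rfl fun i _ =>
        (Measure.bind_apply (hA i) (κ i).aemeasurable).symm
    rw [← this]
    exact measure_pi_mono fun i => (h i).inv

theorem piKernel_op_tens {m : ∀ i, Measure (S i)} [∀ i, SigmaFinite (m i)]
    {κ : ∀ i, Kernel (S i) (S i)} (h : ∀ i, IsSubinvariant (κ i) (m i)) (f : ∀ i, Lp ℝ 2 (m i)) :
    (isSubinvariant_piKernel h).op (tens f) = tens fun i => (h i).op (f i) := by
  have hfin : ∀ i x, IsFiniteMeasure (κ i x) := fun i x =>
    ⟨((h i).mass x).trans_lt ENNReal.one_lt_top⟩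
  refine eq_tens ?_
  filter_upwards [(isSubinvariant_piKernel h).coeFn_op_congr (coeFn_tens f),
    prod_congr_ae fun i => (h i).coeFn_op (f i)] with x h1 h2
  rw [h1, h2, piKernel_apply]
  exact integral_fintype_prod_eq_prod (fun i => f i)

end Product

namespace KilledProcess

section

variable {d : ℕ} {S : Fin d → Type*} [∀ i, MeasurableSpace (S i)]
  [∀ i, TopologicalSpace (S i)] {m : ∀ i, Measure (S i)} [∀ i, SigmaFinite (m i)]
  {X : ∀ i, KilledProcess (S i)}

theorem cartesian_visit {d : ℕ} {S : Fin d → Type*} {X : ∀ i, KilledProcess (S i)} (t : ℝ≥0) :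
    (cartesian X).visit t univ = univ.pi fun i => (X i).visit t univ := by
  ext ω
  change ((t : ℝ≥0∞) < ⨅ i, (X i).ζ (ω i)) ∧ _ ∈ univ ↔
    ∀ i, i ∈ univ → (t : ℝ≥0∞) < (X i).ζ (ω i) ∧ _ ∈ univ
  simp only [mem_univ, and_true, true_imp_iff]
  constructor
  · intro h i
    exact h.trans_le (iInf_le _ i)
  · intro h
    -- Without factors the lifetime is the empty infimum `∞`; otherwise the infimum is attained and
    -- the strict inequality passes to it.
    rcases isEmpty_or_nonempty (Fin d) with he | hne
    · rw [iInf_of_empty]; exact ENNReal.coe_lt_top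
    · obtain ⟨i, hi⟩ := exists_eq_ciInf_of_finite (f := fun i => (X i).ζ (ω i))
      rw [← hi]
      exact h i

/-- Survival of the product is a box event, so restricting the product law to it and taking the
image under the position are both done componentwise. -/
theorem cartesian_transition (hX : ∀ i, (X i).IsContinuousMarkov) (t : ℝ≥0)
    {f : (∀ i, S i) → ℝ} (hf : StronglyMeasurable f) (x : ∀ i, S i) :
    (cartesian X).transition t f x =
      ∫ y, f y ∂(piKernel (fun i => kern (hX i) t) (fun i => kern_le_one (hX i) t) x) := by
  have hprob : ∀ i, IsProbabilityMeasure ((X i).P (x i)) := fun i => (hX i).prob (x i)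
  rw [transition, cartesian_visit]
  change ∫ ω in univ.pi fun i => (X i).visit t univ, f (fun i => (X i).X t (ω i))
    ∂(Measure.pi fun i => (X i).P (x i)) = _
  rw [Measure.restrict_pi_pi, piKernel_apply]
  simp only [kern_def]
  rw [← Measure.pi_map_pi fun i => aemeasurable_X (hX i) t (x i), integral_map]
  · refine aemeasurable_pi_lambda _ fun i => ?_
    exact (aemeasurable_X (hX i) t (x i)).comp_quasiMeasurePreserving
      (Measure.quasiMeasurePreserving_eval _ i)
  · exact hf.aestronglyMeasurable

/-- The transition semigroup of a Cartesian product. -/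
def cartesianSemigroup (hX : ∀ i, (X i).IsContinuousMarkov) (hs : ∀ i, (X i).IsSymmetric (m i))
    (t : ℝ≥0) : Lp ℝ 2 (Measure.pi m) →L[ℝ] Lp ℝ 2 (Measure.pi m) :=
  (isSubinvariant_piKernel fun i => isSubinvariant (hX i) (hs i) t).op

theorem cartesianSemigroup_tens (hX : ∀ i, (X i).IsContinuousMarkov)
    (hs : ∀ i, (X i).IsSymmetric (m i)) (t : ℝ≥0) (f : ∀ i, Lp ℝ 2 (m i)) :
    cartesianSemigroup hX hs t (tens f) = tens fun i => semigroup (hX i) (hs i) t (f i) :=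
  piKernel_op_tens _ f

theorem cartesian_dirichletForm_eq (hX : ∀ i, (X i).IsContinuousMarkov)
    (hs : ∀ i, (X i).IsSymmetric (m i)) :
    (cartesian X).dirichletForm (Measure.pi m) = semigroupForm (cartesianSemigroup hX hs) := by
  refine dirichletForm_eq fun t u => ?_
  filter_upwards [(isSubinvariant_piKernel fun i => isSubinvariant (hX i) (hs i) t).coeFn_op u]
    with x hx
  rw [cartesianSemigroup, hx, cartesian_transition hX t (Lp.stronglyMeasurable u)]

/-- No Markov property of the product process is used. The semigroup law, symmetry and continuity
hold on tensors because they hold in each factor, and tensors are total. -/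
theorem cartesian_isSymmSemigroup (hX : ∀ i, (X i).IsContinuousMarkov)
    (hs : ∀ i, (X i).IsSymmetric (m i)) (hT : ∀ i, IsSymmSemigroup (semigroup (hX i) (hs i))) :
    IsSymmSemigroup (cartesianSemigroup hX hs) := by
  refine isSymmSemigroup_of_total (D := range (tens (m := m))) (fun s t u => ?_)
    (fun t u => IsSubinvariant.norm_op_le _ u) (fun t u v => ?_) dense_tens ?_
  · have := ContinuousLinearMap.ext_on (f := cartesianSemigroup hX hs (s + t))
      (g := (cartesianSemigroup hX hs s).comp (cartesianSemigroup hX hs t)) dense_tens (by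
        rintro _ ⟨f, rfl⟩
        simp only [ContinuousLinearMap.comp_apply, cartesianSemigroup_tens]
        congr 1
        funext i
        exact (hT i).add s t (f i))
    exact congrArg (fun f => f u) this
  · have h1 : ∀ f g : ∀ i, Lp ℝ 2 (m i), ⟪cartesianSemigroup hX hs t (tens f), tens g⟫ =
        ⟪tens f, cartesianSemigroup hX hs t (tens g)⟫ := by
      intro f g
      rw [cartesianSemigroup_tens, cartesianSemigroup_tens, inner_tens, inner_tens]
      exact Finset.prod_congr rfl fun i _ => (hT i).symm t (f i) (g i)
    have h2 : ∀ (f : ∀ i, Lp ℝ 2 (m i)) v, ⟪cartesianSemigroup hX hs t (tens f), v⟫ =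
        ⟪tens f, cartesianSemigroup hX hs t v⟫ := by
      intro f v
      have := ContinuousLinearMap.ext_on (f := innerSL ℝ (cartesianSemigroup hX hs t (tens f)))
        (g := (innerSL ℝ (tens f)).comp (cartesianSemigroup hX hs t)) dense_tens
        (by rintro _ ⟨g, rfl⟩; exact h1 f g)
      exact congrArg (fun f => f v) this
    have := ContinuousLinearMap.ext_on (f := (innerSL ℝ v).comp (cartesianSemigroup hX hs t))
      (g := innerSL ℝ (cartesianSemigroup hX hs t v)) dense_tens (by
        rintro _ ⟨f, rfl⟩
        simp only [ContinuousLinearMap.comp_apply, innerSL_apply_apply]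
        rw [real_inner_comm, h2 f v, real_inner_comm])
    have := congrArg (fun f => f u) this
    simp only [ContinuousLinearMap.comp_apply, innerSL_apply_apply] at this
    rw [real_inner_comm, this, real_inner_comm]
  · rintro _ ⟨f, rfl⟩
    simp only [cartesianSemigroup_tens, inner_tens, norm_sq_tens]
    refine tendsto_finsetProd _ fun i _ => ?_
    have := ((hT i).cont (f i)).inner (𝕜 := ℝ) (tendsto_const_nhds (x := f i))
    rwa [real_inner_self_eq_norm_sq] at this

end

end KilledProcess

end Diffusion

end

/-! ### The form of a tensor product of semigroups -/

noncomputable section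

namespace Diffusion

open ProbabilityTheory
open scoped RealInnerProductSpace

/-- The derivative of a product, in terms of difference quotients. -/
theorem tendsto_prod_diff {ι α : Type*} [DecidableEq ι] {l : Filter α} {c : α → ℝ} (s : Finset ι)
    {a e : ι → ℝ} {b : α → ι → ℝ} (hb : ∀ i, Tendsto (fun t => b t i) l (𝓝 (a i)))
    (he : ∀ i, Tendsto (fun t => c t * (a i - b t i)) l (𝓝 (e i))) :
    Tendsto (fun t => c t * (∏ i ∈ s, a i - ∏ i ∈ s, b t i)) l
      (𝓝 (∑ i ∈ s, e i * ∏ j ∈ s.erase i, a j)) := by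
  induction s using Finset.induction_on with
  | empty => simpa using tendsto_const_nhds
  | insert k s hk ih =>
    have h1 := ((he k).mul_const (∏ i ∈ s, a i)).add ((hb k).mul ih)
    have h2 : e k * ∏ i ∈ s, a i + a k * ∑ i ∈ s, e i * ∏ j ∈ s.erase i, a j =
        ∑ i ∈ insert k s, e i * ∏ j ∈ (insert k s).erase i, a j := by
      rw [Finset.sum_insert hk, Finset.erase_insert hk, Finset.mul_sum]
      congr 1
      refine Finset.sum_congr rfl fun i hi => ?_
      have hki : k ≠ i := fun h => hk (h ▸ hi)
      rw [Finset.erase_insert_of_ne hki, Finset.prod_insert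
        fun h => hk (Finset.mem_of_mem_erase h)]
      ring
    rw [h2] at h1
    refine h1.congr fun t => ?_
    rw [Finset.prod_insert hk, Finset.prod_insert hk]
    ring

variable {d : ℕ} {I : Fin d → Set ℝ} {m : ∀ i, Measure (I i)}

theorem IsCartesianForm.congr {q : L2Form (Measure.pi m)} {p p' : ∀ i, L2Form (m i)}
    (h : IsCartesianForm q p) (hp : ∀ i, (p i).Agree (p' i)) : IsCartesianForm q p' := by
  have ht : tensors p' = tensors p := by
    simp only [tensors, fun i => (hp i).1]
  refine ⟨h.closed, ht ▸ h.tensors_subset, ?_, ht ▸ h.dense⟩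
  intro f g hf hg u v hu hv
  simp only [← (hp _).1] at hf hg
  rw [h.form_tensors f g hf hg u v hu hv]
  exact Finset.sum_congr rfl fun i _ => by rw [(hp i).2 _ (hf i) _ (hg i)]

theorem IsCartesianForm.agree {q r : L2Form (Measure.pi m)} {p : ∀ i, L2Form (m i)}
    (hq : IsCartesianForm q p) (hr : IsCartesianForm r p) : q.Agree r := by
  refine hq.closed.agree_of_dense hr.closed hq.tensors_subset hr.tensors_subset ?_ hq.dense hr.dense
  rintro u ⟨f, hf, hu⟩ v ⟨g, hg, hv⟩
  rw [hq.form_tensors f g hf hg u v hu hv, hr.form_tensors f g hf hg u v hu hv]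

variable [∀ i, SigmaFinite (m i)]

theorem mem_tensors {p : ∀ i, L2Form (m i)} {u : Lp ℝ 2 (Measure.pi m)} :
    u ∈ tensors p ↔ ∃ f : ∀ i, Lp ℝ 2 (m i), (∀ i, f i ∈ (p i).dom) ∧ u = tens f := by
  constructor
  · rintro ⟨f, hf, hu⟩
    exact ⟨f, hf, eq_tens hu⟩
  · rintro ⟨f, hf, rfl⟩
    exact ⟨f, hf, coeFn_tens f⟩

/-- The product of semigroups has the product of the forms as its form. -/
theorem isCartesianForm_of_semigroup {T : ∀ i, ℝ≥0 → Lp ℝ 2 (m i) →L[ℝ] Lp ℝ 2 (m i)}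
    (hT : ∀ i, IsSymmSemigroup (T i))
    {P : ℝ≥0 → Lp ℝ 2 (Measure.pi m) →L[ℝ] Lp ℝ 2 (Measure.pi m)} (hP : IsSymmSemigroup P)
    (htens : ∀ t f, P t (tens f) = tens fun i => T i t (f i)) :
    IsCartesianForm (semigroupForm P) fun i => semigroupForm (T i) := by
  have hlim : ∀ f g : ∀ i, Lp ℝ 2 (m i), (∀ i, f i ∈ (semigroupForm (T i)).dom) →
      (∀ i, g i ∈ (semigroupForm (T i)).dom) →
      Tendsto (fun t => approx P t (tens f) (tens g)) (𝓝[>] 0) (𝓝 (∑ i,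
        (semigroupForm (T i)).form (f i) (g i) * ∏ j ∈ Finset.univ.erase i, ⟪f j, g j⟫)) := by
    intro f g hf hg
    -- Inner products of tensors are products, so the approximating form is the difference quotient
    -- of a product, and the Leibniz rule gives its limit.
    refine (tendsto_prod_diff (c := fun t : ℝ≥0 => (t : ℝ)⁻¹) Finset.univ
      (a := fun j => ⟪f j, g j⟫)
      (b := fun t j => ⟪T j t (f j), g j⟫) (fun j => ?_) fun j => ?_).congr fun t => ?_
    · exact ((hT j).cont (f j)).inner tendsto_const_nhds
    · refine ((hT j).tendsto_approx (hf j) (hg j)).congr fun t => ?_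
      rw [approx, inner_sub_left]
    · rw [approx, inner_sub_left, htens, inner_tens, inner_tens]
  have hsub : tensors (fun i => semigroupForm (T i)) ⊆ (semigroupForm P).dom := by
    intro u hu
    obtain ⟨f, hf, rfl⟩ := mem_tensors.1 hu
    exact ⟨_, hlim f f hf hf⟩
  refine ⟨hP.isClosedForm, hsub, ?_, ?_⟩
  · intro f g hf hg u v hu hv
    rw [eq_tens hu, eq_tens hv]
    simp only [← l2_inner]
    exact (hlim f g hf hg).limUnder_eq
  -- The product semigroup maps each tensor to a tensor of elements `T i t (f i)`, which belong to
  -- the domains of the factors.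
  · refine hP.dense_dom (show Submodule.span ℝ _ ≤ hP.isClosedForm.domain from Submodule.span_le.2 hsub)
      dense_tens ?_
    intro t ht u hu
    induction hu using Submodule.span_induction with
    | mem x hx =>
      obtain ⟨f, rfl⟩ := hx
      rw [htens]
      exact Submodule.subset_span
        (mem_tensors.2 ⟨_, fun i => ((hT i).apply_mem_dom ht (f i)).1, rfl⟩)
    | zero => rw [map_zero]; exact Submodule.zero_mem _
    | add x y _ _ hx hy => rw [map_add]; exact Submodule.add_mem _ hx hy
    | smul c x _ hx => rw [map_smul]; exact Submodule.smul_mem _ c hx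

/-- Since `0 ≤ ⟪T j t (f j), f j⟫ ≤ ‖f j‖ ^ 2`, the approximating form of the tensor dominates that
of `f i` times `∏_{j ≠ i} ‖f j‖ ^ 2`. This is how the assumption on the box is brought down to the
factors. -/
theorem mem_dom_of_tens_mem_dom {T : ∀ i, ℝ≥0 → Lp ℝ 2 (m i) →L[ℝ] Lp ℝ 2 (m i)}
    (hT : ∀ i, IsSymmSemigroup (T i))
    {P : ℝ≥0 → Lp ℝ 2 (Measure.pi m) →L[ℝ] Lp ℝ 2 (Measure.pi m)} (hP : IsSymmSemigroup P)
    (htens : ∀ t f, P t (tens f) = tens fun i => T i t (f i)) {f : ∀ i, Lp ℝ 2 (m i)}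
    (hf : tens f ∈ (semigroupForm P).dom) (i : Fin d) (hne : ∀ j, j ≠ i → f j ≠ 0) :
    f i ∈ (semigroupForm (T i)).dom := by
  set c := ∏ j ∈ Finset.univ.erase i, ‖f j‖ ^ 2 with hc
  have hcpos : 0 < c := Finset.prod_pos fun j hj =>
    pow_pos (norm_pos_iff.2 (hne j (Finset.ne_of_mem_erase hj))) 2
  refine ((hT i).mem_dom_of_le (C := (semigroupForm P).form (tens f) (tens f) / c)
    fun t ht => ?_).1
  rw [le_div_iff₀ hcpos]
  refine le_trans ?_ (hP.approx_le_form hf t)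
  rw [IsSymmSemigroup.approx_self, IsSymmSemigroup.approx_self, htens, inner_tens, norm_sq_tens,
    ← Finset.mul_prod_erase _ _ (Finset.mem_univ i), ← Finset.mul_prod_erase _ _ (Finset.mem_univ i),
    mul_assoc, sub_mul]
  gcongr
  · exact (hT i).inner_nonneg t (f i)
  · exact Finset.prod_le_prod (fun j _ => (hT j).inner_nonneg t (f j))
      fun j _ => (hT j).inner_le t (f j)

end Diffusion

end

/-! ### Measures on an interval and derivatives with respect to a scale -/

noncomputable section

namespace Diffusion

open scoped RealInnerProductSpace

/-- The Cauchy–Schwarz inequality for integrals. -/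
theorem sq_integral_mul_le {S : Type*} [MeasurableSpace S] {ν : Measure S} {f g : S → ℝ}
    (hf : MemLp f 2 ν) (hg : MemLp g 2 ν) :
    (∫ x, f x * g x ∂ν) ^ 2 ≤ (∫ x, f x ^ 2 ∂ν) * ∫ x, g x ^ 2 ∂ν := by
  have h1 : ⟪hf.toLp, hg.toLp⟫ = ∫ x, f x * g x ∂ν := by
    rw [l2_inner]
    refine integral_congr_ae ?_
    filter_upwards [hf.coeFn_toLp, hg.coeFn_toLp] with x h1 h2
    rw [h1, h2]
  have h2 : ∀ {f : S → ℝ} (hf : MemLp f 2 ν), ‖hf.toLp‖ ^ 2 = ∫ x, f x ^ 2 ∂ν := by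
    intro f hf
    rw [l2_norm_sq]
    refine integral_congr_ae ?_
    filter_upwards [hf.coeFn_toLp] with x h1
    rw [h1]
  rw [← h1, ← h2 hf, ← h2 hg, ← mul_pow, sq_le_sq, abs_of_nonneg (by positivity : 0 ≤ ‖_‖ * ‖_‖)]
  exact abs_real_inner_le_norm _ _

section Interval

variable {I : Set ℝ} [hI : Fact (IsOpen I)]

instance : NoMinOrder I := ⟨fun x => by
  obtain ⟨ε, hε, hb⟩ := Metric.isOpen_iff.1 hI.out x x.2
  refine ⟨⟨x - ε / 2, hb ?_⟩, ?_⟩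
  · rw [Metric.mem_ball, Real.dist_eq, abs_lt]; constructor <;> linarith
  · rw [← Subtype.coe_lt_coe]; change (x : ℝ) - ε / 2 < x; linarith⟩

instance : NoMaxOrder I := ⟨fun x => by
  obtain ⟨ε, hε, hb⟩ := Metric.isOpen_iff.1 hI.out x x.2
  refine ⟨⟨x + ε / 2, hb ?_⟩, ?_⟩
  · rw [Metric.mem_ball, Real.dist_eq, abs_lt]; constructor <;> linarith
  · rw [← Subtype.coe_lt_coe]; change (x : ℝ) < x + ε / 2; linarith⟩

instance : LocallyCompactSpace I := hI.out.locallyCompactSpace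

instance : PolishSpace I := hI.out.polishSpace

variable [hI' : OrdConnected I]

omit hI in
theorem isCompact_Icc_subtype (a b : I) : IsCompact (Icc a b) := by
  rw [Subtype.isCompact_iff]
  have : (Subtype.val '' Icc a b : Set ℝ) = Icc (a : ℝ) b := by
    ext x
    constructor
    · rintro ⟨y, hy, rfl⟩; exact hy
    · intro hx; exact ⟨⟨x, hI'.out a.2 b.2 hx⟩, hx, rfl⟩
  rw [this]
  exact isCompact_Icc

theorem measure_Ioc_ne_top (ν : Measure I) [IsLocallyFiniteMeasure ν] (a b : I) :
    ν (Ioc a b) ≠ ∞ :=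
  ((measure_mono Ioc_subset_Icc_self).trans_lt (isCompact_Icc_subtype a b).measure_lt_top).ne

theorem measure_ext_Ioc {μ ν : Measure I} [IsLocallyFiniteMeasure μ]
    (h : ∀ a b : I, a < b → μ (Ioc a b) = ν (Ioc a b)) : μ = ν :=
  Measure.ext_of_Ioc' μ ν (fun a b _ => measure_Ioc_ne_top μ a b) h

omit hI' in
theorem isLocallyFiniteMeasure_of_Ioc {μ : Measure I} (h : ∀ a b : I, μ (Ioc a b) ≠ ∞) :
    IsLocallyFiniteMeasure μ := ⟨fun x => by
  obtain ⟨a, ha⟩ := exists_lt x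
  obtain ⟨b, hb⟩ := exists_gt x
  exact ⟨Ioc a b, Ioc_mem_nhds ha hb, (h a b).lt_top⟩⟩

omit hI' in
/-- The intervals `(a, b]` cover `I` countably. -/
theorem exists_seq_Ioc [Nonempty I] : ∃ f : ℕ → Set I, (∀ n, ∃ a b : I, f n = Ioc a b) ∧ ⋃ n, f n = univ := by
  obtain ⟨x⟩ := ‹Nonempty I›
  choose a ha using fun x : I => exists_lt x
  choose b hb using fun x : I => exists_gt x
  obtain ⟨T, hT, hcov⟩ := TopologicalSpace.isOpen_iUnion_countable
    (fun x : I => Ioo (a x) (b x)) (fun x => isOpen_Ioo)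
  have hU : ⋃ x : I, Ioo (a x) (b x) = univ :=
    eq_univ_of_forall fun x => mem_iUnion.2 ⟨x, ha x, hb x⟩
  rw [hU] at hcov
  have hTne : T.Nonempty := by
    by_contra hne
    rw [not_nonempty_iff_eq_empty] at hne
    have : x ∈ ⋃ i ∈ T, Ioo (a i) (b i) := hcov ▸ mem_univ x
    simp [hne] at this
  obtain ⟨g, hg⟩ := hT.exists_eq_range hTne
  refine ⟨fun n => Ioc (a (g n)) (b (g n)), fun n => ⟨_, _, rfl⟩, eq_univ_of_forall fun y => ?_⟩
  have hy : y ∈ ⋃ i ∈ T, Ioo (a i) (b i) := hcov ▸ mem_univ y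
  obtain ⟨i, hi, hyi⟩ := mem_iUnion₂.1 hy
  rw [hg] at hi
  obtain ⟨n, rfl⟩ := hi
  exact mem_iUnion.2 ⟨n, Ioo_subset_Ioc_self hyi⟩

/-- A measure with a density on `(a, b]` with respect to intervals. -/
theorem measure_le_of_integral_Ioc {μ ν : Measure I} [IsLocallyFiniteMeasure ν] {a b : I}
    {w : I → ℝ} (hw : IntegrableOn w (Ioc a b) μ)
    (h : ∀ x y, a ≤ x → x ≤ y → y ≤ b → (ν (Ioc x y)).toReal = ∫ z in Ioc x y, w z ∂μ)
    {A : Set I} (hA : MeasurableSet A) :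
    ν (A ∩ Ioc a b) ≤ ∫⁻ z in A ∩ Ioc a b, ENNReal.ofReal (w z) ∂μ := by
  set ρ := μ.restrict (Ioc a b) with hρ
  have hfin1 : ∫⁻ z, ENNReal.ofReal (w z) ∂ρ ≠ ∞ := hw.lintegral_lt_top.ne
  have hfin2 : ∫⁻ z, ENNReal.ofReal (-w z) ∂ρ ≠ ∞ := hw.neg.lintegral_lt_top.ne
  have hfinA : IsFiniteMeasure (ν.restrict (Ioc a b)) :=
    ⟨by rw [Measure.restrict_apply_univ]; exact (measure_Ioc_ne_top ν a b).lt_top⟩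
  have hf2 : IsFiniteMeasure (ρ.withDensity fun z => ENNReal.ofReal (-w z)) :=
    isFiniteMeasure_withDensity hfin2
  -- The function `w` is not known to be nonnegative. Moving its negative part to the other side
  -- gives an identity between measures, which can be checked on intervals.
  have heq : ν.restrict (Ioc a b) + ρ.withDensity (fun z => ENNReal.ofReal (-w z)) =
      ρ.withDensity fun z => ENNReal.ofReal (w z) := by
    refine measure_ext_Ioc fun x y hxy => ?_
    rw [Measure.add_apply, Measure.restrict_apply measurableSet_Ioc,
      withDensity_apply _ measurableSet_Ioc, withDensity_apply _ measurableSet_Ioc, hρ,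
      Measure.restrict_restrict measurableSet_Ioc, Ioc_inter_Ioc]
    rcases le_or_gt (x ⊔ a) (y ⊓ b) with hle | hlt
    · have hsub : Ioc (x ⊔ a) (y ⊓ b) ⊆ Ioc a b := Ioc_subset_Ioc le_sup_right inf_le_right
      have hwi := hw.mono_set hsub
      have h1 := h _ _ (le_sup_right : a ≤ x ⊔ a) hle inf_le_right
      rw [integral_eq_lintegral_pos_part_sub_lintegral_neg_part hwi] at h1
      have f1 := hwi.lintegral_lt_top.ne
      have f2 := hwi.neg.lintegral_lt_top.ne
      have f3 := measure_Ioc_ne_top ν (x ⊔ a) (y ⊓ b)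
      simp only [Pi.neg_apply] at f2
      rw [← ENNReal.toReal_eq_toReal_iff' (by simp [f2, f3]) f1, ENNReal.toReal_add f3 f2]
      linarith
    · rw [Ioc_eq_empty (not_lt.2 hlt.le)]
      simp
  have h2 := congrArg (fun κ : Measure I => κ A) heq
  simp only [Measure.add_apply, Measure.restrict_apply hA, withDensity_apply _ hA, hρ,
    Measure.restrict_restrict hA] at h2
  exact le_self_add.trans_eq h2

/-- A locally integrable function with vanishing integrals over intervals vanishes. -/
theorem ae_eq_zero_of_integral_Ioc {μ : Measure I} [IsLocallyFiniteMeasure μ] {f : I → ℝ}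
    (hf : ∀ a b : I, IntegrableOn f (Ioc a b) μ)
    (h : ∀ a b : I, a ≤ b → ∫ z in Ioc a b, f z ∂μ = 0) : f =ᵐ[μ] 0 := by
  rcases isEmpty_or_nonempty I with he | hne
  · exact Eventually.of_forall fun x => he.elim x
  have hloc : AEMeasurable f μ := by
    obtain ⟨g, hg, hcov⟩ := exists_seq_Ioc (I := I)
    have : AEMeasurable f (μ.restrict (⋃ n, g n)) := by
      refine aemeasurable_iUnion_iff.2 fun n => ?_
      obtain ⟨a, b, hab⟩ := hg n
      rw [hab]
      exact (hf a b).aemeasurable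
    rwa [hcov, Measure.restrict_univ] at this
  have hfin1 : ∀ a b : I, ∫⁻ z in Ioc a b, ENNReal.ofReal (f z) ∂μ ≠ ∞ := fun a b =>
    (hf a b).lintegral_lt_top.ne
  have hfin2 : ∀ a b : I, ∫⁻ z in Ioc a b, ENNReal.ofReal (-f z) ∂μ ≠ ∞ := fun a b =>
    (hf a b).neg.lintegral_lt_top.ne
  have : IsLocallyFiniteMeasure (μ.withDensity fun z => ENNReal.ofReal (f z)) :=
    isLocallyFiniteMeasure_of_Ioc fun a b => by
      rw [withDensity_apply _ measurableSet_Ioc]; exact hfin1 a b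
  -- The positive and the negative part define the same locally finite measure, hence agree almost
  -- everywhere, and only one of them can be nonzero at a point.
  have heq : μ.withDensity (fun z => ENNReal.ofReal (f z)) =
      μ.withDensity fun z => ENNReal.ofReal (-f z) := by
    refine measure_ext_Ioc fun a b hab => ?_
    rw [withDensity_apply _ measurableSet_Ioc, withDensity_apply _ measurableSet_Ioc]
    have h1 := h a b hab.le
    rw [integral_eq_lintegral_pos_part_sub_lintegral_neg_part (hf a b), sub_eq_zero,
      ENNReal.toReal_eq_toReal_iff' (hfin1 a b) (hfin2 a b)] at h1
    exact h1
  have h2 := (withDensity_eq_iff_of_sigmaFinite hloc.ennreal_ofReal hloc.neg.ennreal_ofReal).1 heq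
  filter_upwards [h2] with x hx
  simp only [Pi.neg_apply] at hx
  rcases le_total (f x) 0 with h0 | h0
  · rw [ENNReal.ofReal_of_nonpos h0, eq_comm, ENNReal.ofReal_eq_zero] at hx
    simp only [Pi.zero_apply]; linarith
  · have h0' : -f x ≤ 0 := by linarith
    rw [ENNReal.ofReal_of_nonpos h0', ENNReal.ofReal_eq_zero] at hx
    simp only [Pi.zero_apply]; linarith

section Scale

variable {s : I → ℝ}

omit hI' in
theorem IsScale.measurableEmbedding (hs : IsScale s) : MeasurableEmbedding s :=
  hs.1.measurableEmbedding hs.2.injective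

omit hI in
theorem IsScale.Icc_subset_range (hs : IsScale s) (a b : I) : Icc (s a) (s b) ⊆ range s := by
  intro t ht
  have hpre : IsPreconnected (univ : Set I) :=
    (Subtype.preconnectedSpace hI'.isPreconnected).isPreconnected_univ
  obtain ⟨x, -, hx⟩ := hpre.intermediate_value (mem_univ a) (mem_univ b) hs.1.continuousOn ht
  exact ⟨x, hx⟩

omit hI in
theorem IsScale.image_Ioc (hs : IsScale s) (a b : I) : s '' Ioc a b = Ioc (s a) (s b) := by
  ext t
  constructor
  · rintro ⟨x, hx, rfl⟩; exact ⟨hs.2 hx.1, hs.2.monotone hx.2⟩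
  · intro ht
    obtain ⟨x, rfl⟩ := hs.Icc_subset_range a b (Ioc_subset_Icc_self ht)
    exact ⟨x, ⟨hs.2.lt_iff_lt.1 ht.1, hs.2.le_iff_le.1 ht.2⟩, rfl⟩

theorem scaleMeasure_Ioc (hs : IsScale s) (a b : I) :
    scaleMeasure s (Ioc a b) = ENNReal.ofReal (s b - s a) := by
  rw [scaleMeasure, hs.measurableEmbedding.comap_apply, hs.image_Ioc, Real.volume_Ioc]

theorem isLocallyFiniteMeasure_scaleMeasure (hs : IsScale s) :
    IsLocallyFiniteMeasure (scaleMeasure s) :=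
  isLocallyFiniteMeasure_of_Ioc fun a b => by rw [scaleMeasure_Ioc hs]; exact ENNReal.ofReal_ne_top

theorem setIntegral_scaleMeasure (hs : IsScale s) {x y : I} (f : ℝ → ℝ) :
    ∫ z in Ioc x y, f (s z) ∂(scaleMeasure s) = ∫ t in Ioc (s x) (s y), f t := by
  have he := hs.measurableEmbedding
  have h1 : Ioc x y = s ⁻¹' Ioc (s x) (s y) := by
    ext z; simp [hs.2.lt_iff_lt, hs.2.le_iff_le]
  rw [h1, ← he.setIntegral_map, scaleMeasure, he.map_comap, Measure.restrict_restrict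
    measurableSet_Ioc, inter_eq_left.2 (Ioc_subset_Icc_self.trans (hs.Icc_subset_range x y))]

namespace IsScaleDeriv

variable {u v w w' : I → ℝ}

theorem integrableOn (hs : IsScale s) (h : MemLp w 2 (scaleMeasure s)) (a b : I) :
    IntegrableOn w (Ioc a b) (scaleMeasure s) := by
  have := isLocallyFiniteMeasure_scaleMeasure hs
  have : IsFiniteMeasure ((scaleMeasure s).restrict (Ioc a b)) :=
    ⟨by rw [Measure.restrict_apply_univ]; exact (measure_Ioc_ne_top _ a b).lt_top⟩
  exact (h.restrict (Ioc a b)).integrable (by norm_num)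

theorem ae_eq (hs : IsScale s) (h : IsScaleDeriv s u w) (h' : IsScaleDeriv s u w') :
    w =ᵐ[scaleMeasure s] w' := by
  have := isLocallyFiniteMeasure_scaleMeasure hs
  have := ae_eq_zero_of_integral_Ioc (μ := scaleMeasure s) (f := w - w')
    (fun a b => (integrableOn hs h.1 a b).sub (integrableOn hs h'.1 a b)) (fun a b hab => by
      simp only [Pi.sub_apply]
      rw [integral_sub (integrableOn hs h.1 a b) (integrableOn hs h'.1 a b), ← h.2 a b hab,
        ← h'.2 a b hab, sub_self])
  filter_upwards [this] with x hx
  simp only [Pi.sub_apply, Pi.zero_apply] at hx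
  linarith

/-- The Cauchy–Schwarz inequality against the constant one. It gives continuity of functions of
finite energy, and later a uniform bound for functions vanishing at one end. -/
theorem sq_sub_le (hs : IsScale s) (h : IsScaleDeriv s u w) {x y : I} (hxy : x ≤ y) :
    (u y - u x) ^ 2 ≤ (∫ z, w z ^ 2 ∂(scaleMeasure s)) * (s y - s x) := by
  have := isLocallyFiniteMeasure_scaleMeasure hs
  have hfin : IsFiniteMeasure ((scaleMeasure s).restrict (Ioc x y)) :=
    ⟨by rw [Measure.restrict_apply_univ]; exact (measure_Ioc_ne_top _ x y).lt_top⟩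
  have h1 := sq_integral_mul_le (h.1.restrict (Ioc x y)) (memLp_const (1 : ℝ) (p := 2)
    (μ := (scaleMeasure s).restrict (Ioc x y)))
  rw [h.2 x y hxy]
  have hm : ∫ _z in Ioc x y, (1 : ℝ) ^ 2 ∂(scaleMeasure s) = s y - s x := by
    have h0 : 0 ≤ s y - s x := sub_nonneg.2 (hs.2.monotone hxy)
    simp [Measure.real, scaleMeasure_Ioc hs, h0]
  simp only [mul_one] at h1
  rw [hm] at h1
  refine h1.trans (mul_le_mul_of_nonneg_right ?_ (sub_nonneg.2 (hs.2.monotone hxy)))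
  exact setIntegral_le_integral h.1.integrable_sq (Eventually.of_forall fun z => sq_nonneg _)

theorem abs_sub_le (hs : IsScale s) (h : IsScaleDeriv s u w) (x y : I) :
    |u y - u x| ≤ √((∫ z, w z ^ 2 ∂(scaleMeasure s)) * |s y - s x|) := by
  apply Real.abs_le_sqrt
  rcases le_total x y with hxy | hxy
  · rw [abs_of_nonneg (sub_nonneg.2 (hs.2.monotone hxy))]
    exact h.sq_sub_le hs hxy
  · rw [abs_sub_comm, abs_of_nonneg (sub_nonneg.2 (hs.2.monotone hxy))]
    have := h.sq_sub_le hs hxy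
    nlinarith

theorem continuous (hs : IsScale s) (h : IsScaleDeriv s u w) : Continuous u := by
  rw [continuous_iff_continuousAt]
  intro x
  rw [ContinuousAt, tendsto_iff_norm_sub_tendsto_zero]
  refine squeeze_zero (fun _ => norm_nonneg _) (fun y => h.abs_sub_le hs x y) ?_
  have : Continuous fun y => √((∫ z, w z ^ 2 ∂(scaleMeasure s)) * |s y - s x|) := by
    have := hs.1
    fun_prop
  simpa using this.tendsto x

theorem sub (hs : IsScale s) (h : IsScaleDeriv s u w) (h' : IsScaleDeriv s v w') :
    IsScaleDeriv s (u - v) (w - w') := by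
  refine ⟨h.1.sub h'.1, fun x y hxy => ?_⟩
  simp only [Pi.sub_apply]
  rw [integral_sub (integrableOn hs h.1 x y) (integrableOn hs h'.1 x y), ← h.2 x y hxy,
    ← h'.2 x y hxy]
  ring

end IsScaleDeriv

variable {m : Measure I} [m.IsOpenPosMeasure]

/-- The arbitrary choice in the definition is harmless: two representatives with a derivative are
continuous, so they coincide because `m` has full support, and the derivative of a function is
unique up to `ds`-null sets. -/
theorem scaleDeriv_ae_eq (hs : IsScale s) {u : Lp ℝ 2 m} {u' w : I → ℝ} (hu : u =ᵐ[m] u')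
    (hw : IsScaleDeriv s u' w) : scaleDeriv s m u =ᵐ[scaleMeasure s] w := by
  have hex : ∃ w, ∃ u' : I → ℝ, u =ᵐ[m] u' ∧ IsScaleDeriv s u' w := ⟨w, u', hu, hw⟩
  rw [scaleDeriv, dif_pos hex]
  obtain ⟨v, hv, hvw⟩ := hex.choose_spec
  have heq : v = u' := (hvw.continuous hs).ae_eq_iff_eq m (hw.continuous hs) |>.1
    (hv.symm.trans hu)
  rw [heq] at hvw
  exact hvw.ae_eq hs hw

theorem fullScaleForm_form (hs : IsScale s) {u v : Lp ℝ 2 m} {u' v' w z : I → ℝ}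
    (hu : u =ᵐ[m] u') (hw : IsScaleDeriv s u' w) (hv : v =ᵐ[m] v') (hz : IsScaleDeriv s v' z) :
    (fullScaleForm s m).form u v = 1 / 2 * ∫ x, w x * z x ∂(scaleMeasure s) := by
  simp only [fullScaleForm]
  congr 1
  refine integral_congr_ae ?_
  filter_upwards [scaleDeriv_ae_eq hs hu hw, scaleDeriv_ae_eq hs hv hz] with x h1 h2
  rw [h1, h2]

omit [m.IsOpenPosMeasure] in
theorem fullScaleForm_sub_mem (hs : IsScale s) {u v : Lp ℝ 2 m} (hu : u ∈ (fullScaleForm s m).dom)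
    (hv : v ∈ (fullScaleForm s m).dom) : u - v ∈ (fullScaleForm s m).dom := by
  obtain ⟨w, u', hu, hw⟩ := hu
  obtain ⟨z, v', hv, hz⟩ := hv
  exact ⟨w - z, u' - v', (Lp.coeFn_sub u v).trans (hu.sub hv), hw.sub hs hz⟩

theorem fullScaleForm_energyOne_sub (hs : IsScale s) {u v : Lp ℝ 2 m} {u' v' w z : I → ℝ}
    (hu : u =ᵐ[m] u') (hw : IsScaleDeriv s u' w) (hv : v =ᵐ[m] v') (hz : IsScaleDeriv s v' z) :
    (fullScaleForm s m).energyOne (u - v) =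
      1 / 2 * ∫ x, (w x - z x) ^ 2 ∂(scaleMeasure s) + ∫ x, (u' x - v' x) ^ 2 ∂m := by
  have h1 : (u - v : Lp ℝ 2 m) =ᵐ[m] u' - v' := (Lp.coeFn_sub u v).trans (hu.sub hv)
  rw [L2Form.energyOne, fullScaleForm_form hs h1 (hw.sub hs hz) h1 (hw.sub hs hz), l2_norm_sq]
  congr 1
  · simp only [Pi.sub_apply, sq]
  · refine integral_congr_ae ?_
    filter_upwards [h1] with x hx
    rw [hx, Pi.sub_apply]

end Scale

end Interval

end Diffusion

end

/-! ### Smooth approximation in one dimension -/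

noncomputable section

namespace Diffusion

/-! ### Test functions -/

section Test

variable {V : Type*} [NormedAddCommGroup V] [NormedSpace ℝ V] {U U' : Set V} {φ ψ : V → ℝ}

theorem IsTest.mono (h : IsTest U φ) (hU : U ⊆ U') : IsTest U' φ := ⟨h.1, h.2.1, h.2.2.trans hU⟩

theorem IsTest.zero : IsTest U (0 : V → ℝ) :=
  ⟨contDiff_const, HasCompactSupport.zero, by simp [tsupport]⟩

theorem IsTest.mul_left (h : IsTest U φ) (hψ : ContDiff ℝ ((⊤ : ℕ∞) : WithTop ℕ∞) ψ) :
    IsTest U (ψ * φ) :=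
  ⟨hψ.mul h.1, h.2.1.mul_left, (tsupport_mul_subset_right).trans h.2.2⟩

theorem IsTest.add (h : IsTest U φ) (h' : IsTest U ψ) : IsTest U (φ + ψ) :=
  ⟨h.1.add h'.1, h.2.1.add h'.2.1, (tsupport_add _ _).trans (union_subset h.2.2 h'.2.2)⟩

theorem IsTest.const_smul (h : IsTest U φ) (c : ℝ) : IsTest U (c • φ) := by
  have : c • φ = (fun _ => c) * φ := by ext x; simp
  rw [this]
  exact h.mul_left contDiff_const

theorem IsTest.eq_zero (h : IsTest U φ) {x : V} (hx : x ∉ U) : φ x = 0 :=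
  image_eq_zero_of_notMem_tsupport fun hx' => hx (h.2.2 hx')

theorem exists_isTest_eq_one [FiniteDimensional ℝ V] {K : Set V} (hK : IsCompact K)
    (hU : IsOpen U) (hKU : K ⊆ U) :
    ∃ φ : V → ℝ, IsTest U φ ∧ (∀ x, φ x ∈ Icc (0 : ℝ) 1) ∧ ∀ x ∈ K, φ x = 1 := by
  have : ProperSpace V := FiniteDimensional.proper ℝ V
  obtain ⟨L, hL, hKL, hLU⟩ := exists_compact_between hK hU hKU
  obtain ⟨f, hf, hf1, hf2, hf3⟩ := exists_contMDiff_support_eq_eq_one_iff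
    (modelWithCornersSelf ℝ V) (n := ⊤) isOpen_interior hK.isClosed hKL
  have hsupp : tsupport f ⊆ L := by
    rw [tsupport, hf2]
    exact closure_minimal interior_subset hL.isClosed
  exact ⟨f, ⟨contMDiff_iff_contDiff.1 hf, hL.of_isClosed_subset (isClosed_tsupport f) hsupp,
    hsupp.trans hLU⟩, fun x => hf1 ⟨x, rfl⟩, fun x hx => (hf3 x).1 hx⟩

/-- A test function on the line that is the identity near a given compact interval. -/
theorem exists_isTest_eq_self {U : Set ℝ} {a b : ℝ} (hU : IsOpen U) (hab : Icc a b ⊆ U) :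
    ∃ φ : ℝ → ℝ, IsTest U φ ∧ ∀ x ∈ Icc a b, φ x = x := by
  obtain ⟨η, h1, -, h3⟩ := exists_isTest_eq_one isCompact_Icc hU hab
  exact ⟨id * η, h1.mul_left contDiff_id, fun x hx => by simp [h3 x hx]⟩

theorem exists_Icc_of_isCompact {α : Type*} [TopologicalSpace α] [LinearOrder α]
    [OrderClosedTopology α] [DenselyOrdered α] {K : Set α} {a b : α} (hK : IsCompact K)
    (hKab : K ⊆ Ioo a b) (hab : a < b) :
    ∃ a' b', a < a' ∧ a' ≤ b' ∧ b' < b ∧ K ⊆ Icc a' b' := by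
  rcases K.eq_empty_or_nonempty with rfl | hne
  · obtain ⟨c, h1, h2⟩ := exists_between hab
    exact ⟨c, c, h1, le_rfl, h2, empty_subset _⟩
  · obtain ⟨x, hx, hx'⟩ := hK.exists_isLeast hne
    obtain ⟨y, hy, hy'⟩ := hK.exists_isGreatest hne
    exact ⟨x, y, (hKab hx).1, hx' hy, (hKab hy).2, fun z hz => ⟨hx' hz, hy' hz⟩⟩

/-- A test function with vanishing integral has an antiderivative that is a test function. -/
theorem IsTest.exists_antideriv {α β : ℝ} (hαβ : α < β) {ψ : ℝ → ℝ} (h : IsTest (Ioo α β) ψ)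
    (h0 : ∫ t in α..β, ψ t = 0) : ∃ φ, IsTest (Ioo α β) φ ∧ deriv φ = ψ := by
  obtain ⟨a, b, ha, hab, hb, hK⟩ := exists_Icc_of_isCompact h.2.1 h.2.2 hαβ
  have hd : ∀ t, HasDerivAt (fun t => ∫ r in α..t, ψ r) (ψ t) t := fun t =>
    (h.1.continuous.integral_hasStrictDerivAt α t).hasDerivAt
  have hderiv : deriv (fun t => ∫ r in α..t, ψ r) = ψ := funext fun t => (hd t).deriv
  have hz : ∀ r ∉ Icc a b, ψ r = 0 := fun r hr => image_eq_zero_of_notMem_tsupport fun h => hr (hK h)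
  have hsupp : Function.support (fun t => ∫ r in α..t, ψ r) ⊆ Icc a b := by
    intro t ht
    by_contra hnt
    refine ht ?_
    simp only
    rcases lt_or_ge t a with hta | hta
    · rw [← intervalIntegral.integral_zero (a := α) (b := t) (μ := volume)]
      refine intervalIntegral.integral_congr fun r hr => hz r fun hr' => ?_
      have := hr.2
      rw [le_sup_iff] at this
      rcases this with this | this
      · exact absurd (this.trans_lt ha) (not_lt.2 hr'.1)
      · exact absurd (this.trans_lt hta) (not_lt.2 hr'.1)
    · have htb : b < t := by
        by_contra hle
        exact hnt ⟨hta, not_lt.1 hle⟩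
      -- As the total integral vanishes, the primitive at `t` may be started from `β` instead of
      -- `α`, and nothing of the support lies between `β` and `t`.
      have hadd := intervalIntegral.integral_add_adjacent_intervals
        (h.1.continuous.intervalIntegrable (μ := volume) α β)
        (h.1.continuous.intervalIntegrable (μ := volume) β t)
      rw [h0, zero_add] at hadd
      rw [← hadd, ← intervalIntegral.integral_zero (a := β) (b := t) (μ := volume)]
      refine intervalIntegral.integral_congr fun r hr => hz r fun hr' => ?_
      have := hr.1
      rw [inf_le_iff] at this
      rcases this with this | this
      · exact absurd (hb.trans_le this) (not_lt.2 hr'.2)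
      · exact absurd (htb.trans_le this) (not_lt.2 hr'.2)
  have hsub : tsupport (fun t => ∫ r in α..t, ψ r) ⊆ Icc a b :=
    closure_minimal hsupp isClosed_Icc
  refine ⟨_, ⟨?_, isCompact_Icc.of_isClosed_subset (isClosed_tsupport _) hsub,
    hsub.trans fun t ht => ⟨ha.trans_le ht.1, ht.2.trans_lt hb⟩⟩, hderiv⟩
  rw [contDiff_infty_iff_deriv, hderiv]
  exact ⟨fun t => (hd t).differentiableAt, h.1⟩

theorem IsTest.exists_bound {U : Set ℝ} {φ : ℝ → ℝ} (h : IsTest U φ) : ∃ C, ∀ t, |deriv φ t| ≤ C := by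
  obtain ⟨C, hC⟩ := (h.1.continuous_deriv (by simp)).bounded_above_of_compact_support h.2.1.deriv
  exact ⟨C, fun t => hC t⟩

theorem IsTest.integral_deriv {U : Set ℝ} {φ : ℝ → ℝ} (h : IsTest U φ) {x y : ℝ} (hxy : x ≤ y) :
    ∫ t in Ioc x y, deriv φ t = φ y - φ x := by
  rw [← intervalIntegral.integral_of_le hxy]
  exact intervalIntegral.integral_deriv_eq_sub (fun t _ => h.1.differentiable (by simp) t)
    ((h.1.continuous_deriv (by simp)).intervalIntegrable _ _)

end Test

/-! ### Changes of scale -/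

section Interval

variable {I : Set ℝ} [hI : Fact (IsOpen I)] [hI' : OrdConnected I]

omit hI in
theorem IsScale.isOpen_range [Fact (IsOpen I)] {s : I → ℝ} (hs : IsScale s) : IsOpen (range s) := by
  rw [isOpen_iff_mem_nhds]
  rintro _ ⟨x, rfl⟩
  obtain ⟨a, ha⟩ := exists_lt x
  obtain ⟨b, hb⟩ := exists_gt x
  exact mem_of_superset (Icc_mem_nhds (hs.2 ha) (hs.2 hb)) (hs.Icc_subset_range a b)

omit hI' in
/-- A compact subset of the image of a scale lies in the image of an interval. -/
theorem IsScale.exists_preimage_subset [Nonempty I] {s : I → ℝ} (hs : IsScale s) {K : Set ℝ}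
    (hK : IsCompact K) (hKs : K ⊆ range s) :
    ∃ a b : I, a < b ∧ K ⊆ Ioo (s a) (s b) ∧ s ⁻¹' K ⊆ Ioc a b := by
  suffices h : ∃ a b : I, a < b ∧ K ⊆ Ioo (s a) (s b) by
    obtain ⟨a, b, hab, hK⟩ := h
    exact ⟨a, b, hab, hK, fun z hz => ⟨hs.2.lt_iff_lt.1 (hK hz).1, (hs.2.lt_iff_lt.1 (hK hz).2).le⟩⟩
  rcases K.eq_empty_or_nonempty with rfl | hne
  · obtain ⟨x⟩ := ‹Nonempty I›
    obtain ⟨y, hy⟩ := exists_gt x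
    exact ⟨x, y, hy, empty_subset _⟩
  · obtain ⟨x, hx, hx'⟩ := hK.exists_isLeast hne
    obtain ⟨y, hy, hy'⟩ := hK.exists_isGreatest hne
    obtain ⟨x, rfl⟩ := hKs hx
    obtain ⟨y, rfl⟩ := hKs hy
    obtain ⟨a, ha⟩ := exists_lt x
    obtain ⟨b, hb⟩ := exists_gt y
    exact ⟨a, b, ha.trans ((hs.2.le_iff_le.1 (hx' hy)).trans_lt hb),
      fun z hz => ⟨(hs.2 ha).trans_le (hx' hz), (hy' hz).trans_lt (hs.2 hb)⟩⟩

/-- `dτ = k ds` for two scales `s`, `τ`, with a positive density that is locally square integrable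
with respect to `ds`. -/
structure IsScaleChange (s τ k : I → ℝ) : Prop where
  scale : IsScale s
  scale' : IsScale τ
  measurable : Measurable k
  pos : ∀ᵐ z ∂(scaleMeasure s), 0 < k z
  memLp : ∀ a b : I, MemLp k 2 ((scaleMeasure s).restrict (Ioc a b))
  sub_eq : ∀ x y : I, x ≤ y → τ y - τ x = ∫ z in Ioc x y, k z ∂(scaleMeasure s)

/-- The trivial change of scale lets the approximation results below be used for smooth functions of
`s` itself. -/
theorem IsScale.isScaleChange_self {s : I → ℝ} (hs : IsScale s) :
    IsScaleChange s s fun _ => 1 where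
  scale := hs
  scale' := hs
  measurable := measurable_const
  pos := Eventually.of_forall fun _ => one_pos
  memLp a b := by
    have := isLocallyFiniteMeasure_scaleMeasure hs
    have : IsFiniteMeasure ((scaleMeasure s).restrict (Ioc a b)) :=
      ⟨by rw [Measure.restrict_apply_univ]; exact (measure_Ioc_ne_top _ a b).lt_top⟩
    exact memLp_const 1
  sub_eq x y hxy := by
    have h0 : 0 ≤ s y - s x := sub_nonneg.2 (hs.2.monotone hxy)
    simp [Measure.real, scaleMeasure_Ioc hs, h0]

namespace IsScaleChange

variable {s τ k : I → ℝ} (h : IsScaleChange s τ k)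
include h

theorem isFiniteMeasure_restrict (a b : I) :
    IsFiniteMeasure ((scaleMeasure s).restrict (Ioc a b)) := by
  have := isLocallyFiniteMeasure_scaleMeasure h.scale
  exact ⟨by rw [Measure.restrict_apply_univ]; exact (measure_Ioc_ne_top _ a b).lt_top⟩

theorem scaleMeasure_eq :
    scaleMeasure τ = (scaleMeasure s).withDensity fun z => ENNReal.ofReal (k z) := by
  have := isLocallyFiniteMeasure_scaleMeasure h.scale'
  refine measure_ext_Ioc fun a b hab => ?_
  have := h.isFiniteMeasure_restrict a b
  rw [scaleMeasure_Ioc h.scale', withDensity_apply _ measurableSet_Ioc, h.sub_eq a b hab.le,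
    ofReal_integral_eq_lintegral_ofReal ((h.memLp a b).integrable (by norm_num))]
  filter_upwards [ae_restrict_of_ae h.pos] with z hz using hz.le

theorem setIntegral_eq {f : ℝ → ℝ} (x y : I) :
    ∫ t in Ioc (τ x) (τ y), f t = ∫ z in Ioc x y, f (τ z) * k z ∂(scaleMeasure s) := by
  rw [← setIntegral_scaleMeasure h.scale', h.scaleMeasure_eq,
    setIntegral_withDensity_eq_setIntegral_toReal_smul h.measurable.ennreal_ofReal
      (Eventually.of_forall fun _ => ENNReal.ofReal_lt_top) _ measurableSet_Ioc]
  refine integral_congr_ae ?_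
  filter_upwards [ae_restrict_of_ae h.pos] with z hz
  rw [ENNReal.toReal_ofReal hz.le, smul_eq_mul, mul_comm]

omit hI' in
theorem memLp_mul {f : ℝ → ℝ} (hf : Continuous f) (hf' : HasCompactSupport f)
    (hs : tsupport f ⊆ range τ) :
    MemLp (fun z => f (τ z) * k z) 2 (scaleMeasure s) := by
  rcases isEmpty_or_nonempty I with he | hne
  · rw [Measure.eq_zero_of_isEmpty (scaleMeasure s)]
    exact memLp_measure_zero
  obtain ⟨a, b, -, -, hab⟩ := h.scale'.exists_preimage_subset hf' hs
  obtain ⟨C, hC⟩ := hf.bounded_above_of_compact_support hf'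
  have h1 : (Ioc a b).indicator (fun z => f (τ z) * k z) = fun z => f (τ z) * k z := by
    rw [indicator_eq_self]
    intro z hz
    refine hab (subset_tsupport f ?_)
    intro h0
    exact hz (by simp [h0])
  rw [← h1, memLp_indicator_iff_restrict measurableSet_Ioc]
  refine (h.memLp a b).of_le_mul (c := C) ?_ (Eventually.of_forall fun z => ?_)
  · exact ((hf.comp h.scale'.1).measurable.mul h.measurable).aestronglyMeasurable
  · rw [norm_mul]
    exact mul_le_mul_of_nonneg_right (hC _) (norm_nonneg _)

theorem isScaleDeriv_comp {φ : ℝ → ℝ} (hφ : IsTest (range τ) φ) :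
    IsScaleDeriv s (φ ∘ τ) fun z => deriv φ (τ z) * k z := by
  refine ⟨h.memLp_mul (hφ.1.continuous_deriv (by simp)) hφ.2.1.deriv
    ((tsupport_deriv_subset).trans hφ.2.2), fun x y hxy => ?_⟩
  rw [← h.setIntegral_eq, hφ.integral_deriv (h.scale'.2.monotone hxy)]
  rfl

omit hI' in
/-- Density of the functions `ψ(τ) k` among the square integrable functions. -/
theorem exists_test_approx {a b a' b' : I} (ha : a' < a) (hb : b < b') {w : I → ℝ}
    (hw : MemLp w 2 (scaleMeasure s)) (h0 : ∀ z ∉ Ioc a b, w z = 0) {ε : ℝ} (hε : 0 < ε) :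
    ∃ ψ, IsTest (Ioo (τ a') (τ b')) ψ ∧
      ∫ z, (w z - ψ (τ z) * k z) ^ 2 ∂(scaleMeasure s) ≤ ε := by
  set ds := scaleMeasure s with hds
  -- The distance of `w` and `ψ(τ) k` in `L²(ds)` is the distance of `w / k` and `ψ(τ)` in `L²(k²
  -- ds)`. On `(a', b']` the latter measure is finite, by the local square integrability of `k`.
  set κ := (ds.restrict (Ioc a' b')).withDensity fun z => ENNReal.ofReal (k z ^ 2) with hκ
  have hkm : Measurable fun z => ENNReal.ofReal (k z ^ 2) := (h.measurable.pow_const 2).ennreal_ofReal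
  have hkint : Integrable (fun z => k z ^ 2) (ds.restrict (Ioc a' b')) := (h.memLp a' b').integrable_sq
  have hκfin : IsFiniteMeasure κ := isFiniteMeasure_withDensity hkint.lintegral_lt_top.ne
  have hposr : ∀ᵐ z ∂(ds.restrict (Ioc a' b')), 0 < k z := ae_restrict_of_ae h.pos
  have hint : ∀ f : I → ℝ, ∫ z, f z ^ 2 ∂κ = ∫ z in Ioc a' b', (f z * k z) ^ 2 ∂ds := by
    intro f
    rw [hκ, integral_withDensity_eq_integral_toReal_smul hkm
      (Eventually.of_forall fun _ => ENNReal.ofReal_lt_top)]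
    refine integral_congr_ae (Eventually.of_forall fun z => ?_)
    simp only
    rw [ENNReal.toReal_ofReal (sq_nonneg _), smul_eq_mul]
    ring
  have hF : MemLp (fun z => w z / k z) 2 κ := by
    have hmeas : AEStronglyMeasurable (fun z => w z / k z) (ds.restrict (Ioc a' b')) :=
      (hw.1.aemeasurable.restrict.div h.measurable.aemeasurable).aestronglyMeasurable
    rw [memLp_two_iff_integrable_sq (hmeas.mono_ac (withDensity_absolutelyContinuous _ _)),
      integrable_withDensity_iff_integrable_smul' hkm
      (Eventually.of_forall fun _ => ENNReal.ofReal_lt_top)]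
    refine (hw.integrable_sq.restrict (s := Ioc a' b')).congr ?_
    filter_upwards [hposr] with z hz
    rw [ENNReal.toReal_ofReal (sq_nonneg _), smul_eq_mul]
    field_simp
  have he := h.scale'.measurableEmbedding
  have hext : (Function.extend τ (fun z => w z / k z) 0) ∘ τ = fun z => w z / k z :=
    Function.extend_comp he.injective _ _
  -- Transported by `τ`, the question becomes the density of smooth functions with compact support
  -- in `L²` of a finite measure on the line.
  have hFm : MemLp (Function.extend τ (fun z => w z / k z) 0) 2 (κ.map τ) := by
    rw [he.memLp_map_measure_iff, hext]
    exact hF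
  obtain ⟨g, hg1, hg2, hg3⟩ := hFm.exist_eLpNorm_sub_le (by norm_num) (by norm_num)
    (Real.sqrt_pos.2 hε)
  have hgτ : MemLp (g ∘ τ) 2 κ := by
    rw [← he.memLp_map_measure_iff]
    exact hg2.continuous.memLp_of_hasCompactSupport hg1
  have hdiff : MemLp (fun z => w z / k z - g (τ z)) 2 κ := hF.sub hgτ
  have hle1 : ∫ z, (w z / k z - g (τ z)) ^ 2 ∂κ ≤ ε := by
    have h1 : eLpNorm (fun z => w z / k z - g (τ z)) 2 κ ≤ ENNReal.ofReal √ε := by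
      rw [he.eLpNorm_map_measure] at hg3
      refine le_of_eq_of_le ?_ hg3
      congr 1
      ext z
      simp only [Function.comp, Pi.sub_apply]
      rw [he.injective.extend_apply]
    have h2 : ‖hdiff.toLp‖ ^ 2 ≤ ε := by
      rw [Lp.norm_toLp]
      calc _ ≤ √ε ^ 2 := pow_le_pow_left₀ ENNReal.toReal_nonneg
            (ENNReal.toReal_le_of_le_ofReal (Real.sqrt_nonneg _) h1) 2
        _ = ε := Real.sq_sqrt hε.le
    rw [l2_norm_sq] at h2
    refine le_of_eq_of_le (integral_congr_ae ?_) h2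
    filter_upwards [hdiff.coeFn_toLp] with z hz
    rw [hz]
  -- The cut-off localizes the support. It is one where `w` may be nonzero; elsewhere `w = 0`, and
  -- multiplying `g` by a factor in `[0, 1]` only decreases the error.
  obtain ⟨η, hη1, hη2, hη3⟩ := exists_isTest_eq_one (isCompact_Icc (a := τ a) (b := τ b))
    (isOpen_Ioo (a := τ a') (b := τ b'))
    (fun t ht => ⟨(h.scale'.2 ha).trans_le ht.1, ht.2.trans_lt (h.scale'.2 hb)⟩)
  have hψ : IsTest (Ioo (τ a') (τ b')) (g * η) := hη1.mul_left hg2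
  have hle2 : ∫ z, (w z - (g * η) (τ z) * k z) ^ 2 ∂ds ≤ ∫ z, (w z / k z - g (τ z)) ^ 2 ∂κ := by
    have h1 : ∫ z, (w z - (g * η) (τ z) * k z) ^ 2 ∂ds =
        ∫ z, (w z / k z - (g * η) (τ z)) ^ 2 ∂κ := by
      rw [hint fun z => w z / k z - (g * η) (τ z), ← setIntegral_eq_integral_of_forall_compl_eq_zero
        (s := Ioc a' b')]
      · refine integral_congr_ae ?_
        filter_upwards [hposr] with z hz
        field_simp
      · intro z hz
        have h1 : z ∉ Ioc a b := fun h => hz ⟨ha.trans h.1, h.2.trans hb.le⟩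
        have h2 : τ z ∉ Ioo (τ a') (τ b') := fun h' =>
          hz ⟨h.scale'.2.lt_iff_lt.1 h'.1, (h.scale'.2.lt_iff_lt.1 h'.2).le⟩
        rw [h0 z h1, hψ.eq_zero h2]
        simp
    rw [h1]
    refine integral_mono_of_nonneg (Eventually.of_forall fun z => sq_nonneg _) hdiff.integrable_sq
      (Eventually.of_forall fun z => ?_)
    simp only [Pi.mul_apply]
    by_cases hz : z ∈ Ioc a b
    · rw [hη3 _ ⟨h.scale'.2.monotone hz.1.le, h.scale'.2.monotone hz.2⟩, mul_one]
    · rw [h0 z hz, zero_div, zero_sub, zero_sub, neg_sq, neg_sq, mul_pow]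
      have h1 := hη2 (τ z)
      have : η (τ z) ^ 2 ≤ 1 := by nlinarith [h1.1, h1.2]
      nlinarith [sq_nonneg (g (τ z))]
  exact ⟨g * η, hψ, hle2.trans hle1⟩

-- To the left of `a` and to the right of `b` the function is constant, so its derivative can be cut
-- off there. The new derivative vanishes at every point outside `(a, b]`, as `exists_test_approx`
-- demands.
omit h hI hI' in
theorem _root_.Diffusion.IsScaleDeriv.indicator {s u w : I → ℝ} (hw : IsScaleDeriv s u w) {a b : I}
    (hab : a ≤ b) (h0 : ∀ z ∉ Ioo a b, u z = 0) : IsScaleDeriv s u ((Ioc a b).indicator w) := by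
  refine ⟨hw.1.indicator measurableSet_Ioc, fun x y hxy => ?_⟩
  have ha : ∀ z ≤ a, u z = 0 := fun z hz => h0 z fun h => absurd h.1 (not_lt.2 hz)
  have hb : ∀ z, b ≤ z → u z = 0 := fun z hz => h0 z fun h => absurd h.2 (not_lt.2 hz)
  rw [setIntegral_indicator measurableSet_Ioc, Ioc_inter_Ioc]
  rcases le_or_gt (x ⊔ a) (y ⊓ b) with hle | hlt
  · rw [← hw.2 _ _ hle]
    congr 1
    · rcases le_total y b with h | h
      · rw [inf_eq_left.2 h]
      · rw [inf_eq_right.2 h, hb y h, hb b le_rfl]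
    · rcases le_total x a with h | h
      · rw [sup_eq_right.2 h, ha x h, ha a le_rfl]
      · rw [sup_eq_left.2 h]
  · rw [Ioc_eq_empty (not_lt.2 hlt.le), setIntegral_empty]
    rw [inf_lt_iff] at hlt
    rcases hlt with hlt | hlt <;> rw [lt_sup_iff] at hlt <;> rcases hlt with hlt | hlt
    · exact absurd hlt (not_lt.2 hxy)
    · rw [ha y hlt.le, ha x (hxy.trans hlt.le), sub_zero]
    · rw [hb x hlt.le, hb y (hlt.le.trans hxy), sub_zero]
    · exact absurd hlt (not_lt.2 hab)

/-- Functions with compact support and finite energy are approximated by smooth functions of `τ`. -/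
theorem exists_test_energy_lt (m : Measure I) [IsLocallyFiniteMeasure m] {u w : I → ℝ}
    (hw : IsScaleDeriv s u w) {a b : I} (hab : a < b) (h0 : ∀ z ∉ Ioo a b, u z = 0) {ε : ℝ}
    (hε : 0 < ε) :
    ∃ φ, IsTest (range τ) φ ∧
      1 / 2 * ∫ z, (w z - deriv φ (τ z) * k z) ^ 2 ∂(scaleMeasure s) +
        ∫ z, (u z - φ (τ z)) ^ 2 ∂m < ε := by
  set ds := scaleMeasure s with hds
  obtain ⟨a', ha⟩ := exists_lt a
  obtain ⟨b', hb⟩ := exists_gt b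
  have hab' : a' < b' := ha.trans (hab.trans hb)
  have hτ : τ a' < τ b' := h.scale'.2 hab'
  have := h.isFiniteMeasure_restrict a' b'
  have hsub : Ioo (τ a') (τ b') ⊆ range τ := Ioo_subset_Icc_self.trans (h.scale'.Icc_subset_range a' b')
  -- A bump of mass `T > 0` that does not depend on `ε`. A multiple of it corrects the integral of
  -- the approximating `ψ` to zero, so that the result is the derivative of a test function.
  obtain ⟨θ, hθ1, hθ2, hθ3⟩ := exists_isTest_eq_one (isCompact_Icc (a := τ a) (b := τ b))
    (isOpen_Ioo (a := τ a') (b := τ b'))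
    (fun t ht => ⟨(h.scale'.2 ha).trans_le ht.1, ht.2.trans_lt (h.scale'.2 hb)⟩)
  set T := ∫ t in Ioc (τ a') (τ b'), θ t with hT
  have hTpos : 0 < T := by
    have h1 : ∫ t in Ioc (τ a) (τ b), θ t = τ b - τ a := by
      rw [setIntegral_congr_fun measurableSet_Ioc (g := fun _ => (1 : ℝ))
        (fun t ht => hθ3 t (Ioc_subset_Icc_self ht))]
      simp [(h.scale'.2 hab).le]
    have h2 : ∫ t in Ioc (τ a) (τ b), θ t ≤ T :=
      setIntegral_mono_set (hθ1.1.continuous.integrable_of_hasCompactSupport hθ1.2.1).integrableOn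
        (Eventually.of_forall fun t => (hθ2 t).1)
        (Ioc_subset_Ioc (h.scale'.2 ha).le (h.scale'.2 hb).le).eventuallyLE
    rw [h1] at h2
    exact (sub_pos.2 (h.scale'.2 hab)).trans_le h2
  have hθk : MemLp (fun z => θ (τ z) * k z) 2 ds :=
    h.memLp_mul hθ1.1.continuous hθ1.2.1 (hθ1.2.2.trans hsub)
  set Θ := ∫ z, (θ (τ z) * k z) ^ 2 ∂ds with hΘ
  have hΘ0 : 0 ≤ Θ := integral_nonneg fun z => sq_nonneg _
  set L := s b' - s a' with hL
  have hL0 : 0 ≤ L := sub_nonneg.2 (h.scale.2 hab').le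
  -- If `ψ` is `δ`-close to the derivative in squared norm, the correction `(c / T) θ` costs `(c /
  -- T) ^ 2 * Θ` with `c ^ 2 ≤ L * δ`. So `δ * M₁` bounds the final error of the derivative, and `δ
  -- * M` that of the `ℰ₁`-norm.
  set M₁ := 2 + 2 * (L * Θ / T ^ 2) with hM₁
  have hM₁0 : 0 ≤ M₁ := by positivity
  set M := M₁ * (1 / 2 + m.real (Ioc a' b') * L) with hM
  have hM0 : 0 ≤ M := by positivity
  set w' := (Ioc a b).indicator w with hw'
  have hsd := hw.indicator hab.le h0
  have hww : w =ᵐ[ds] w' := hw.ae_eq h.scale hsd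
  obtain ⟨ψ, hψ, hψA⟩ := h.exists_test_approx ha hb hsd.1
    (fun z hz => indicator_of_notMem hz w) (div_pos hε (by linarith : 0 < M + 1))
  set δ := ε / (M + 1) with hδ
  have hδ0 : 0 < δ := div_pos hε (by linarith)
  have hψk : MemLp (fun z => ψ (τ z) * k z) 2 ds :=
    h.memLp_mul hψ.1.continuous hψ.2.1 (hψ.2.2.trans hsub)
  set c := ∫ t in Ioc (τ a') (τ b'), ψ t with hc
  -- The derivative has integral zero because `u` vanishes at `a'` and `b'`. So `c` is, up to sign,
  -- the integral of the error, and the Cauchy–Schwarz inequality applies.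
  have hc2 : c ^ 2 ≤ L * δ := by
    have h1 : c = -∫ z in Ioc a' b', (w' z - ψ (τ z) * k z) * 1 ∂ds := by
      simp only [mul_one]
      rw [integral_sub (IsScaleDeriv.integrableOn h.scale hsd.1 a' b')
        (IsScaleDeriv.integrableOn h.scale hψk a' b'), ← hsd.2 a' b' hab'.le, ← h.setIntegral_eq,
        h0 b' (fun h => absurd h.2 (not_lt.2 hb.le)), h0 a' (fun h => absurd h.1 (not_lt.2 ha.le))]
      simp [hc]
    have h2 := sq_integral_mul_le ((hsd.1.sub hψk).restrict (Ioc a' b'))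
      (memLp_const (1 : ℝ) (p := 2) (μ := ds.restrict (Ioc a' b')))
    have h3 : ∫ _z in Ioc a' b', (1 : ℝ) ^ 2 ∂ds = L := by
      simp [Measure.real, hds, scaleMeasure_Ioc h.scale, hL]
      simpa [hL] using hL0
    rw [h3] at h2
    rw [h1, neg_sq, mul_comm L]
    refine h2.trans (mul_le_mul_of_nonneg_right (le_trans ?_ hψA) hL0)
    exact setIntegral_le_integral (hsd.1.sub hψk).integrable_sq
      (Eventually.of_forall fun z => sq_nonneg _)
  have hψ' : IsTest (Ioo (τ a') (τ b')) (ψ + (-(c / T)) • θ) := hψ.add (hθ1.const_smul _)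
  obtain ⟨φ, hφ, hφd⟩ := hψ'.exists_antideriv hτ (by
    rw [intervalIntegral.integral_of_le hτ.le]
    simp only [Pi.add_apply, Pi.smul_apply, smul_eq_mul]
    rw [integral_add (hψ.1.continuous.integrable_of_hasCompactSupport hψ.2.1).integrableOn
      ((hθ1.1.continuous.integrable_of_hasCompactSupport hθ1.2.1).const_mul _).integrableOn,
      integral_const_mul, ← hc, ← hT]
    field_simp
    ring)
  have hφ' : IsTest (range τ) φ := hφ.mono hsub
  have hsφ := h.isScaleDeriv_comp hφ'
  have hdiff := hsd.sub h.scale hsφ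
  set A := ∫ z, (w' z - deriv φ (τ z) * k z) ^ 2 ∂ds with hA
  have hA0 : 0 ≤ A := integral_nonneg fun z => sq_nonneg _
  have hAle : A ≤ δ * M₁ := by
    have i1 : Integrable (fun z => (w' z - ψ (τ z) * k z) ^ 2) ds := (hsd.1.sub hψk).integrable_sq
    have i2 : Integrable (fun z => (θ (τ z) * k z) ^ 2) ds := hθk.integrable_sq
    have h1 : A ≤ ∫ z, (2 * (w' z - ψ (τ z) * k z) ^ 2 +
        2 * (c / T) ^ 2 * (θ (τ z) * k z) ^ 2) ∂ds := by
      refine integral_mono_of_nonneg (Eventually.of_forall fun z => sq_nonneg _)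
        ((i1.const_mul 2).add (i2.const_mul _))
        (Eventually.of_forall fun z => ?_)
      simp only [hφd, Pi.add_apply, Pi.smul_apply, smul_eq_mul]
      nlinarith [sq_nonneg ((w' z - ψ (τ z) * k z) - (c / T) * (θ (τ z) * k z))]
    rw [integral_add (i1.const_mul 2) (i2.const_mul _),
      integral_const_mul, integral_const_mul, ← hΘ] at h1
    have h2 : 2 * (c / T) ^ 2 * Θ ≤ 2 * (L * δ / T ^ 2) * Θ := by
      rw [div_pow]
      gcongr
    have h3 : δ * M₁ = 2 * δ + 2 * (L * δ / T ^ 2) * Θ := by rw [hM₁]; ring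
    have h4 : ∫ z, (w' z - ψ (τ z) * k z) ^ 2 ∂ds ≤ δ := hψA
    linarith
  -- The difference vanishes at `a'` and outside `(a', b']`, so its energy controls it uniformly on
  -- a set of finite `m`-measure.
  have hu2 : ∫ z, (u z - φ (τ z)) ^ 2 ∂m ≤ m.real (Ioc a' b') * (A * L) := by
    have hz : ∀ z ∉ Ioc a' b', u z - φ (τ z) = 0 := by
      intro z hz
      rw [h0 z fun h => hz ⟨ha.trans h.1, (h.2.trans hb).le⟩, hφ.eq_zero fun h' =>
          hz ⟨h.scale'.2.lt_iff_lt.1 h'.1, (h.scale'.2.lt_iff_lt.1 h'.2).le⟩, sub_zero]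
    rw [← setIntegral_eq_integral_of_forall_compl_eq_zero (s := Ioc a' b')
      (fun z hz' => by rw [hz z hz']; simp)]
    have hb1 : ∀ z ∈ Ioc a' b', (u z - φ (τ z)) ^ 2 ≤ A * L := by
      intro z hz'
      have h1 := hdiff.sq_sub_le h.scale hz'.1.le
      have h2 : (u - φ ∘ τ) a' = 0 := hz a' fun h => absurd h.1 (lt_irrefl _)
      rw [h2, sub_zero] at h1
      refine h1.trans (mul_le_mul_of_nonneg_left ?_ hA0)
      rw [hL]
      linarith [h.scale.2.monotone hz'.2]
    have hmf : m (Ioc a' b') ≠ ∞ := measure_Ioc_ne_top m a' b'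
    calc _ ≤ ∫ _z in Ioc a' b', A * L ∂m := by
          refine integral_mono_of_nonneg (Eventually.of_forall fun z => sq_nonneg _)
            (integrableOn_const hmf) ?_
          exact (ae_restrict_iff' measurableSet_Ioc).2 (Eventually.of_forall hb1)
      _ = _ := by simp
  refine ⟨φ, hφ', ?_⟩
  have hAeq : ∫ z, (w z - deriv φ (τ z) * k z) ^ 2 ∂ds = A := by
    refine integral_congr_ae ?_
    filter_upwards [hww] with z hz
    rw [hz]
  rw [hAeq]
  calc _ ≤ 1 / 2 * A + m.real (Ioc a' b') * (A * L) := by linarith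
    _ = A * (1 / 2 + m.real (Ioc a' b') * L) := by ring
    _ ≤ δ * M₁ * (1 / 2 + m.real (Ioc a' b') * L) := by gcongr
    _ = δ * M := by rw [hM]; ring
    _ < δ * (M + 1) := by linarith
    _ = ε := by rw [hδ]; field_simp

end IsScaleChange

end Interval

end Diffusion

end

/-! ### The absolutely continuous part of a scale and its minimal form -/

noncomputable section

namespace Diffusion

section Interval

variable {I : Set ℝ} [hI : Fact (IsOpen I)] [hI' : OrdConnected I]

omit hI hI' in
theorem isScale_val : IsScale (Subtype.val : I → ℝ) := ⟨continuous_subtype_val, fun _ _ h => h⟩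

omit hI hI' in
theorem scaleMeasure_val : scaleMeasure (Subtype.val : I → ℝ) = lebesgueOn I := rfl

instance : IsLocallyFiniteMeasure (lebesgueOn I) := isLocallyFiniteMeasure_scaleMeasure isScale_val

/-- A measurable set that carries the absolutely continuous part of `ds`, of full Lebesgue measure
and negligible for the singular part. -/
def regSet (s : I → ℝ) : Set I :=
  ((scaleMeasure s).mutuallySingular_singularPart (lebesgueOn I)).nullSet

omit hI hI' in
theorem measurableSet_regSet (s : I → ℝ) : MeasurableSet (regSet s) :=
  Measure.MutuallySingular.measurableSet_nullSet _

omit hI hI' in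
theorem lebesgueOn_compl_regSet (s : I → ℝ) : lebesgueOn I (regSet s)ᶜ = 0 :=
  Measure.MutuallySingular.measure_compl_nullSet _

omit hI hI' in
theorem singularPart_regSet (s : I → ℝ) :
    (scaleMeasure s).singularPart (lebesgueOn I) (regSet s) = 0 :=
  Measure.MutuallySingular.measure_nullSet _

variable {s : I → ℝ}

/-- On `regSet s` the singular part vanishes, and the absolutely continuous part does not charge the
complement. -/
theorem restrict_regSet (hs : IsScale s) : (scaleMeasure s).restrict (regSet s) =
    (lebesgueOn I).withDensity ((scaleMeasure s).rnDeriv (lebesgueOn I)) := by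
  have := isLocallyFiniteMeasure_scaleMeasure hs
  ext A hA
  have h1 := congrArg (fun κ : Measure I => κ (A ∩ regSet s))
    ((scaleMeasure s).haveLebesgueDecomposition_add (lebesgueOn I))
  simp only [Measure.add_apply] at h1
  rw [Measure.restrict_apply hA, h1,
    measure_mono_null inter_subset_right (singularPart_regSet s), zero_add]
  have h2 : (lebesgueOn I).withDensity ((scaleMeasure s).rnDeriv (lebesgueOn I)) (regSet s)ᶜ = 0 :=
    withDensity_absolutelyContinuous _ _ (lebesgueOn_compl_regSet s)
  exact measure_inter_conull h2

theorem integrableOn_rnDeriv (hs : IsScale s) (a b : I) :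
    IntegrableOn (fun z => ((scaleMeasure s).rnDeriv (lebesgueOn I) z).toReal) (Ioc a b)
      (lebesgueOn I) := by
  have := isLocallyFiniteMeasure_scaleMeasure hs
  refine integrable_toReal_of_lintegral_ne_top (Measure.measurable_rnDeriv _ _).aemeasurable ?_
  exact ((Measure.setLIntegral_rnDeriv_le (Ioc a b)).trans_lt (measure_Ioc_ne_top _ a b).lt_top).ne

theorem ofReal_setIntegral_rnDeriv (hs : IsScale s) (a b : I) :
    ENNReal.ofReal (∫ z in Ioc a b, ((scaleMeasure s).rnDeriv (lebesgueOn I) z).toReal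
      ∂(lebesgueOn I)) = (scaleMeasure s).restrict (regSet s) (Ioc a b) := by
  have := isLocallyFiniteMeasure_scaleMeasure hs
  rw [ofReal_integral_eq_lintegral_ofReal (integrableOn_rnDeriv hs a b)
    (Eventually.of_forall fun _ => ENNReal.toReal_nonneg), restrict_regSet hs,
    withDensity_apply _ measurableSet_Ioc]
  refine lintegral_congr_ae ?_
  filter_upwards [ae_restrict_of_ae (Measure.rnDeriv_lt_top (scaleMeasure s) (lebesgueOn I))]
    with z hz
  rw [ENNReal.ofReal_toReal hz.ne]

theorem acPart_sub (hs : IsScale s) (e : I) {x y : I} (hxy : x ≤ y) :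
    acPart s e y - acPart s e x =
      ∫ z in Ioc x y, ((scaleMeasure s).rnDeriv (lebesgueOn I) z).toReal ∂(lebesgueOn I) := by
  have hadd : ∀ {a b c : I}, a ≤ b → b ≤ c →
      ∫ z in Ioc a c, ((scaleMeasure s).rnDeriv (lebesgueOn I) z).toReal ∂(lebesgueOn I) =
      (∫ z in Ioc a b, ((scaleMeasure s).rnDeriv (lebesgueOn I) z).toReal ∂(lebesgueOn I)) +
      ∫ z in Ioc b c, ((scaleMeasure s).rnDeriv (lebesgueOn I) z).toReal ∂(lebesgueOn I) := by
    intro a b c hab hbc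
    rw [← Ioc_union_Ioc_eq_Ioc hab hbc, setIntegral_union (Ioc_disjoint_Ioc_of_le le_rfl)
      measurableSet_Ioc (integrableOn_rnDeriv hs a b) (integrableOn_rnDeriv hs b c)]
  have hemp : ∀ {a b : I}, b ≤ a →
      ∫ z in Ioc a b, ((scaleMeasure s).rnDeriv (lebesgueOn I) z).toReal ∂(lebesgueOn I) = 0 := by
    intro a b hab
    rw [Ioc_eq_empty (not_lt.2 hab), setIntegral_empty]
  rw [acPart, acPart]
  rcases le_total e x with h1 | h1
  · rw [hemp h1, hemp (h1.trans hxy), hadd h1 hxy]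
    ring
  · rcases le_total e y with h2 | h2
    · rw [hemp h1, hemp h2, hadd h1 h2]
      ring
    · rw [hemp h1, hemp h2, hadd hxy h2]
      ring

theorem acPart_mono (hs : IsScale s) (e : I) {x y : I} (hxy : x ≤ y) :
    0 ≤ acPart s e y - acPart s e x ∧ acPart s e y - acPart s e x ≤ s y - s x := by
  rw [acPart_sub hs e hxy]
  refine ⟨integral_nonneg fun _ => ENNReal.toReal_nonneg, ?_⟩
  rw [← ENNReal.ofReal_le_ofReal_iff (sub_nonneg.2 (hs.2.monotone hxy)),
    ofReal_setIntegral_rnDeriv hs, ← scaleMeasure_Ioc hs]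
  exact Measure.restrict_apply_le _ _

omit hI in
theorem continuous_acPart [Fact (IsOpen I)] (hs : IsScale s) (e : I) : Continuous (acPart s e) := by
  rw [continuous_iff_continuousAt]
  intro x
  rw [ContinuousAt, tendsto_iff_norm_sub_tendsto_zero]
  refine squeeze_zero (fun _ => norm_nonneg _) (g := fun y => |s y - s x|) (fun y => ?_) ?_
  · rw [Real.norm_eq_abs]
    rcases le_total x y with h | h
    · have := acPart_mono hs e h
      rw [abs_of_nonneg this.1]
      exact this.2.trans (le_abs_self _)
    · have := acPart_mono hs e h
      rw [abs_sub_comm, abs_of_nonneg this.1, abs_sub_comm]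
      exact this.2.trans (le_abs_self _)
  · have : Continuous fun y => |s y - s x| := by
      have := hs.1
      fun_prop
    simpa using this.tendsto x

/-! ### Scales for which the smooth functions have finite energy -/

/-- The test functions on `I` have finite energy with respect to the scale `s`. -/
def HasSmoothDomain (s : I → ℝ) : Prop :=
  ∀ φ : ℝ → ℝ, IsTest I φ → ∃ w, IsScaleDeriv s (fun x : I => φ x) w

/-- A test function equal to `x` on `[a, b]` has a derivative with respect to `s` whose integrals
over subintervals of `(a, b]` are their lengths. It dominates the density of Lebesgue measure, which
is thereby locally in `L²(ds)`. -/
theorem HasSmoothDomain.exists_deriv (hs : IsScale s) (h : HasSmoothDomain s) (a b : I) :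
    ∃ w, MemLp w 2 (scaleMeasure s) ∧ ∀ A, MeasurableSet A →
      lebesgueOn I (A ∩ Ioc a b) ≤ ∫⁻ z in A ∩ Ioc a b, ENNReal.ofReal (w z) ∂(scaleMeasure s) := by
  obtain ⟨φ, hφ, hφ'⟩ := exists_isTest_eq_self hI.out (hI'.out a.2 b.2)
  obtain ⟨w, hw⟩ := h φ hφ
  refine ⟨w, hw.1, fun A hA => measure_le_of_integral_Ioc (IsScaleDeriv.integrableOn hs hw.1 a b)
    (fun x y hax hxy hyb => ?_) hA⟩
  rw [← hw.2 x y hxy]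
  simp only
  rw [hφ' y ⟨hax.trans hxy, hyb⟩, hφ' x ⟨hax, hxy.trans hyb⟩, ← scaleMeasure_val,
    scaleMeasure_Ioc isScale_val, ENNReal.toReal_ofReal (sub_nonneg.2 hxy)]

theorem HasSmoothDomain.absolutelyContinuous (hs : IsScale s) (h : HasSmoothDomain s) :
    lebesgueOn I ≪ scaleMeasure s := by
  rcases isEmpty_or_nonempty I with he | hne
  · rw [Measure.eq_zero_of_isEmpty (lebesgueOn I)]
    exact Measure.AbsolutelyContinuous.zero _
  refine Measure.AbsolutelyContinuous.mk fun A hA h0 => ?_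
  obtain ⟨f, hf, hcov⟩ := exists_seq_Ioc (I := I)
  rw [← inter_univ A, ← hcov, inter_iUnion, measure_iUnion_null_iff]
  intro n
  obtain ⟨a, b, hab⟩ := hf n
  obtain ⟨w, -, hw⟩ := h.exists_deriv hs a b
  rw [hab]
  refine le_antisymm ((hw A hA).trans (le_of_eq ?_)) bot_le
  rw [setLIntegral_measure_zero _ _ (measure_mono_null inter_subset_left h0)]

variable (s) in
/-- The density of the Lebesgue measure with respect to `ds`. -/
def invDensity (z : I) : ℝ := ((lebesgueOn I).rnDeriv (scaleMeasure s) z).toReal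

omit hI hI' in
theorem measurable_invDensity : Measurable (invDensity s) :=
  (Measure.measurable_rnDeriv _ _).ennreal_toReal

theorem HasSmoothDomain.memLp_invDensity (hs : IsScale s) (h : HasSmoothDomain s) (a b : I) :
    MemLp (invDensity s) 2 ((scaleMeasure s).restrict (Ioc a b)) := by
  have := isLocallyFiniteMeasure_scaleMeasure hs
  obtain ⟨w, hw, hle⟩ := h.exists_deriv hs a b
  have h1 : (lebesgueOn I).rnDeriv (scaleMeasure s) ≤ᵐ[(scaleMeasure s).restrict (Ioc a b)]
      fun z => ENNReal.ofReal (w z) := by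
    refine ae_le_of_forall_setLIntegral_le_of_sigmaFinite (Measure.measurable_rnDeriv _ _)
      fun A hA _ => ?_
    rw [Measure.restrict_restrict hA, Measure.setLIntegral_rnDeriv (h.absolutelyContinuous hs)]
    exact hle A hA
  refine (hw.restrict (Ioc a b)).mono measurable_invDensity.aestronglyMeasurable ?_
  filter_upwards [h1] with z hz
  rw [invDensity, Real.norm_of_nonneg ENNReal.toReal_nonneg, Real.norm_eq_abs]
  refine (ENNReal.toReal_mono ENNReal.ofReal_ne_top hz).trans ?_
  rw [ENNReal.toReal_ofReal']
  exact max_le (le_abs_self _) (abs_nonneg _)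

/-- Because Lebesgue measure is absolutely continuous with respect to `ds`, the density of `ds` is
positive almost everywhere, and the increments of its primitive are positive. -/
theorem HasSmoothDomain.isScale_acPart (hs : IsScale s) (h : HasSmoothDomain s) (e : I) :
    IsScale (acPart s e) := by
  have := isLocallyFiniteMeasure_scaleMeasure hs
  refine ⟨continuous_acPart hs e, fun x y hxy => ?_⟩
  rw [← sub_pos, acPart_sub hs e hxy.le]
  rw [setIntegral_pos_iff_support_of_nonneg_ae
    (Eventually.of_forall fun _ => ENNReal.toReal_nonneg) (integrableOn_rnDeriv hs x y)]
  have h1 : 0 < lebesgueOn I (Ioc x y) := by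
    rw [← scaleMeasure_val, scaleMeasure_Ioc isScale_val, ENNReal.ofReal_pos, sub_pos]
    exact hxy
  refine h1.trans_eq (measure_congr ?_)
  filter_upwards [Measure.rnDeriv_pos' (h.absolutelyContinuous hs),
    Measure.rnDeriv_lt_top (scaleMeasure s) (lebesgueOn I)] with z hz1 hz2
  refine propext ⟨fun hz => ⟨?_, hz⟩, fun hz => hz.2⟩
  exact (ENNReal.toReal_pos hz1.ne' hz2.ne).ne'

theorem scaleMeasure_acPart (hs : IsScale s) {e : I} (hac : IsScale (acPart s e)) :
    scaleMeasure (acPart s e) = (scaleMeasure s).restrict (regSet s) := by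
  have := isLocallyFiniteMeasure_scaleMeasure hac
  refine measure_ext_Ioc fun a b hab => ?_
  rw [scaleMeasure_Ioc hac, acPart_sub hs e hab.le, ofReal_setIntegral_rnDeriv hs]

/-- The coordinate `x` is an admissible new scale for `s̄`: the density `dx/ds` is also `dx/ds̄`,
since passing from `ds` to `ds̄` drops a Lebesgue-null set only. -/
theorem HasSmoothDomain.isScaleChange (hs : IsScale s) (h : HasSmoothDomain s) (e : I) :
    IsScaleChange (acPart s e) Subtype.val (invDensity s) := by
  have hds := scaleMeasure_acPart hs (h.isScale_acPart hs e)
  have := isLocallyFiniteMeasure_scaleMeasure hs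
  have hac := h.absolutelyContinuous hs
  refine ⟨h.isScale_acPart hs e, isScale_val, measurable_invDensity, ?_, fun a b => ?_,
    fun x y hxy => ?_⟩
  · rw [hds, restrict_regSet hs]
    refine (withDensity_absolutelyContinuous _ _).ae_le ?_
    filter_upwards [Measure.rnDeriv_pos hac, hac.ae_le (Measure.rnDeriv_lt_top (lebesgueOn I)
      (scaleMeasure s))] with z hz1 hz2
    exact ENNReal.toReal_pos hz1.ne' hz2.ne
  · rw [hds]
    exact (h.memLp_invDensity hs a b).mono_measure
      (Measure.restrict_mono subset_rfl Measure.restrict_le_self)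
  · rw [hds, Measure.restrict_restrict measurableSet_Ioc]
    simp only [invDensity]
    rw [Measure.setIntegral_toReal_rnDeriv hac, Measure.real,
      measure_inter_conull (lebesgueOn_compl_regSet s), ← scaleMeasure_val,
      scaleMeasure_Ioc isScale_val, ENNReal.toReal_ofReal (sub_nonneg.2 hxy)]

/-- Extending the derivative by zero to the singular set preserves its integrals, as `ds̄` is `ds`
restricted to `regSet s`. This makes the form of `s` an extension of that of `s̄`. -/
theorem IsScaleDeriv.of_acPart (hs : IsScale s) {e : I} (hac : IsScale (acPart s e)) {u w : I → ℝ}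
    (h : IsScaleDeriv (acPart s e) u w) : IsScaleDeriv s u ((regSet s).indicator w) := by
  have hds := scaleMeasure_acPart hs hac
  refine ⟨?_, fun x y hxy => ?_⟩
  · rw [memLp_indicator_iff_restrict (measurableSet_regSet s), ← hds]
    exact h.1
  · rw [h.2 x y hxy, setIntegral_indicator (measurableSet_regSet s), hds,
      Measure.restrict_restrict measurableSet_Ioc]

/-! ### Density in the domains of the one-dimensional forms -/

variable {m : Measure I} [m.IsOpenPosMeasure]

omit hI hI' [m.IsOpenPosMeasure] in
theorem fullScaleForm_energyOne_nonneg (u : Lp ℝ 2 m) : 0 ≤ (fullScaleForm s m).energyOne u := by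
  rw [L2Form.energyOne]
  have : 0 ≤ ∫ z, scaleDeriv s m u z * scaleDeriv s m u z ∂(scaleMeasure s) :=
    integral_nonneg fun z => mul_self_nonneg _
  simp only [fullScaleForm]
  positivity

theorem integral_sq_sub_le {S : Type*} [MeasurableSpace S] {ν : Measure S} {f g h : S → ℝ}
    (hfg : MemLp (fun z => f z - g z) 2 ν) (hgh : MemLp (fun z => g z - h z) 2 ν) :
    ∫ z, (f z - h z) ^ 2 ∂ν ≤ 2 * ∫ z, (f z - g z) ^ 2 ∂ν + 2 * ∫ z, (g z - h z) ^ 2 ∂ν := by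
  rw [← integral_const_mul, ← integral_const_mul,
    ← integral_add (hfg.integrable_sq.const_mul 2) (hgh.integrable_sq.const_mul 2)]
  refine integral_mono_of_nonneg (Eventually.of_forall fun z => sq_nonneg _)
    ((hfg.integrable_sq.const_mul 2).add (hgh.integrable_sq.const_mul 2))
    (Eventually.of_forall fun z => ?_)
  simp only
  nlinarith [sq_nonneg ((f z - g z) - (g z - h z))]

theorem fullScaleForm_energyOne_sub_le (hs : IsScale s) {u v f : Lp ℝ 2 m}
    (hu : u ∈ (fullScaleForm s m).dom) (hv : v ∈ (fullScaleForm s m).dom)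
    (hf : f ∈ (fullScaleForm s m).dom) :
    (fullScaleForm s m).energyOne (u - f) ≤
      2 * (fullScaleForm s m).energyOne (u - v) + 2 * (fullScaleForm s m).energyOne (v - f) := by
  obtain ⟨w₁, u', hu', hw₁⟩ := hu
  obtain ⟨w₂, v', hv', hw₂⟩ := hv
  obtain ⟨w₃, f', hf', hw₃⟩ := hf
  rw [fullScaleForm_energyOne_sub hs hu' hw₁ hf' hw₃, fullScaleForm_energyOne_sub hs hu' hw₁ hv' hw₂,
    fullScaleForm_energyOne_sub hs hv' hw₂ hf' hw₃]
  have h1 := integral_sq_sub_le (hw₁.1.sub hw₂.1) (hw₂.1.sub hw₃.1)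
  have mu : MemLp u' 2 m := (memLp_congr_ae hu').1 (Lp.memLp u)
  have mv : MemLp v' 2 m := (memLp_congr_ae hv').1 (Lp.memLp v)
  have mf : MemLp f' 2 m := (memLp_congr_ae hf').1 (Lp.memLp f)
  have h2 := integral_sq_sub_le (mu.sub mv) (mv.sub mf)
  linarith

/-- The smooth functions of the scale. -/
def scaleTests (s : I → ℝ) : Set (I → ℝ) := {f | ∃ φ : ℝ → ℝ, IsTest (range s) φ ∧ f = φ ∘ s}

omit [m.IsOpenPosMeasure] in
theorem toL2_scaleTests_subset (hs : IsScale s) :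
    toL2 m (scaleTests s) ⊆ (fullScaleForm s m).dom := by
  rintro u ⟨_, ⟨φ, hφ, rfl⟩, hu⟩
  exact ⟨_, _, hu, hs.isScaleChange_self.isScaleDeriv_comp hφ⟩

theorem toL2_scaleTests_subset_minimal (hs : IsScale s) :
    toL2 m (scaleTests s) ⊆ (minimalScaleForm s m).dom := fun u hu =>
  ⟨toL2_scaleTests_subset hs hu, fun _ => u, fun _ => hu, by
    obtain ⟨_, ⟨φ, hφ, rfl⟩, hu'⟩ := hu
    have h := hs.isScaleChange_self.isScaleDeriv_comp hφ
    simp only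
    rw [fullScaleForm_energyOne_sub hs hu' h hu' h]
    simp⟩

/-- A diagonal choice; an `ℰ₁`-triangle inequality on the full domain suffices, and completeness is
not involved. -/
theorem mem_minimalScaleForm (hs : IsScale s) {f : Lp ℝ 2 m} (hf : f ∈ (fullScaleForm s m).dom)
    (h : ∀ ε : ℝ, 0 < ε → ∃ g ∈ (minimalScaleForm s m).dom,
      (fullScaleForm s m).energyOne (f - g) < ε) : f ∈ (minimalScaleForm s m).dom := by
  have key : ∀ n : ℕ, ∃ g ∈ toL2 m (scaleTests s),
      (fullScaleForm s m).energyOne (f - g) < 1 / (n + 1) := by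
    intro n
    have hn : (0 : ℝ) < 1 / (n + 1) := by positivity
    obtain ⟨g, hg, hfg⟩ := h (1 / (n + 1) / 4) (by linarith)
    obtain ⟨hg1, v, hv, hlim⟩ := hg
    obtain ⟨k, hk⟩ := (hlim.eventually (gt_mem_nhds (show (0 : ℝ) < 1 / (n + 1) / 4 by
      linarith))).exists
    refine ⟨v k, hv k, (fullScaleForm_energyOne_sub_le hs hf hg1
      (toL2_scaleTests_subset hs (hv k))).trans_lt ?_⟩
    linarith
  choose g hg hfg using key
  exact ⟨hf, g, hg, squeeze_zero (fun n => fullScaleForm_energyOne_nonneg _) (fun n => (hfg n).le)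
    tendsto_one_div_add_atTop_nhds_zero_nat⟩

omit [m.IsOpenPosMeasure] in
theorem memLp_comp_scale [IsLocallyFiniteMeasure m] (hs : IsScale s) {φ : ℝ → ℝ}
    (hφ : IsTest (range s) φ) : MemLp (φ ∘ s) 2 m := by
  rcases isEmpty_or_nonempty I with he | hne
  · rw [Measure.eq_zero_of_isEmpty m]
    exact memLp_measure_zero
  obtain ⟨a, b, -, -, hab⟩ := hs.exists_preimage_subset hφ.2.1 hφ.2.2
  refine (hφ.1.continuous.comp hs.1).memLp_of_hasCompactSupport
    (HasCompactSupport.intro (isCompact_Icc_subtype a b) fun z hz => ?_)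
  exact image_eq_zero_of_notMem_tsupport (f := φ) fun h => hz (Ioc_subset_Icc_self (hab h))

/-- Functions with compact support and finite energy are in the domain of the minimal form. -/
theorem mem_minimalScaleForm_of_support [IsLocallyFiniteMeasure m] (hs : IsScale s) {f : Lp ℝ 2 m}
    {u w : I → ℝ} (hf : f =ᵐ[m] u) (hw : IsScaleDeriv s u w) {a b : I} (hab : a < b)
    (h0 : ∀ z ∉ Ioo a b, u z = 0) : f ∈ (minimalScaleForm s m).dom := by
  refine mem_minimalScaleForm hs ⟨w, u, hf, hw⟩ fun ε hε => ?_
  obtain ⟨φ, hφ, hlt⟩ := hs.isScaleChange_self.exists_test_energy_lt m hw hab h0 hε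
  have hmem := memLp_comp_scale (m := m) hs hφ
  refine ⟨hmem.toLp, toL2_scaleTests_subset_minimal hs ⟨_, ⟨φ, hφ, rfl⟩, hmem.coeFn_toLp⟩, ?_⟩
  rw [fullScaleForm_energyOne_sub hs hf hw hmem.coeFn_toLp
    (hs.isScaleChange_self.isScaleDeriv_comp hφ)]
  exact hlt

/-- The test functions on `I` belong to the domain of the minimal form of the absolutely continuous
part of the scale. -/
theorem HasSmoothDomain.mem_minimalScaleForm [IsLocallyFiniteMeasure m] (hs : IsScale s)
    (h : HasSmoothDomain s) (e : I) {φ : ℝ → ℝ} (hφ : IsTest I φ) {f : Lp ℝ 2 m}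
    (hf : f =ᵐ[m] fun z => φ z) : f ∈ (minimalScaleForm (acPart s e) m).dom := by
  have hφ' : IsTest (range (Subtype.val : I → ℝ)) φ := by rwa [Subtype.range_val]
  have : Nonempty I := ⟨e⟩
  obtain ⟨a, b, hab, hsub, -⟩ := (isScale_val (I := I)).exists_preimage_subset hφ'.2.1 hφ'.2.2
  refine mem_minimalScaleForm_of_support (h.isScale_acPart hs e) hf
    ((h.isScaleChange hs e).isScaleDeriv_comp hφ') hab fun z hz => ?_
  exact image_eq_zero_of_notMem_tsupport fun h => hz (hsub h)

/-- The test functions on `I` are dense in the domain of the minimal form of the absolutely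
continuous part of the scale. -/
theorem HasSmoothDomain.exists_test_lt [IsLocallyFiniteMeasure m] (hs : IsScale s)
    (h : HasSmoothDomain s) (e : I) {f : Lp ℝ 2 m} (hf : f ∈ (minimalScaleForm (acPart s e) m).dom)
    {ε : ℝ} (hε : 0 < ε) : ∃ φ, IsTest I φ ∧ ∃ v : Lp ℝ 2 m, (v =ᵐ[m] fun z => φ z) ∧
      (fullScaleForm (acPart s e) m).energyOne (f - v) < ε := by
  have hac := h.isScale_acPart hs e
  have : Nonempty I := ⟨e⟩
  obtain ⟨hf, g, hg, hlim⟩ := hf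
  obtain ⟨n, hn⟩ := (hlim.eventually (gt_mem_nhds (show (0 : ℝ) < ε / 4 by linarith))).exists
  obtain ⟨_, ⟨ψ, hψ, rfl⟩, hgn⟩ := hg n
  have hψd := hac.isScaleChange_self.isScaleDeriv_comp hψ
  obtain ⟨a, b, hab, hsub, -⟩ := hac.exists_preimage_subset hψ.2.1 hψ.2.2
  -- The element is first approximated by a smooth function of `s̄`, which has compact support and
  -- finite energy, and that one by a smooth function of `x`.
  obtain ⟨φ, hφ, hlt⟩ := (h.isScaleChange hs e).exists_test_energy_lt m hψd hab
    (fun z hz => image_eq_zero_of_notMem_tsupport (f := ψ) fun h => hz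
      ⟨hac.2.lt_iff_lt.1 (hsub h).1, hac.2.lt_iff_lt.1 (hsub h).2⟩)
    (show (0 : ℝ) < ε / 4 by linarith)
  have hφd := (h.isScaleChange hs e).isScaleDeriv_comp hφ
  have hmem := memLp_comp_scale (m := m) isScale_val hφ
  refine ⟨φ, by rwa [Subtype.range_val] at hφ, hmem.toLp, hmem.coeFn_toLp, ?_⟩
  replace hlt := (fullScaleForm_energyOne_sub hac hgn hψd hmem.coeFn_toLp hφd).trans_lt hlt
  have := fullScaleForm_energyOne_sub_le hac hf (toL2_scaleTests_subset hac (hg n))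
    ⟨_, _, hmem.coeFn_toLp, hφd⟩
  linarith

omit [m.IsOpenPosMeasure] in
theorem fullScaleForm_acPart_dom (hs : IsScale s) {e : I} (hac : IsScale (acPart s e))
    {f : Lp ℝ 2 m} (hf : f ∈ (fullScaleForm (acPart s e) m).dom) : f ∈ (fullScaleForm s m).dom := by
  obtain ⟨w, u, hu, hw⟩ := hf
  exact ⟨_, _, hu, hw.of_acPart hs hac⟩

theorem fullScaleForm_acPart_form (hs : IsScale s) {e : I} (hac : IsScale (acPart s e))
    {f g : Lp ℝ 2 m} (hf : f ∈ (fullScaleForm (acPart s e) m).dom)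
    (hg : g ∈ (fullScaleForm (acPart s e) m).dom) :
    (fullScaleForm s m).form f g = (fullScaleForm (acPart s e) m).form f g := by
  obtain ⟨w, u, hu, hw⟩ := hf
  obtain ⟨w', u', hu', hw'⟩ := hg
  rw [fullScaleForm_form hac hu hw hu' hw', fullScaleForm_form hs hu (hw.of_acPart hs hac) hu'
    (hw'.of_acPart hs hac), scaleMeasure_acPart hs hac]
  congr 1
  rw [← integral_indicator (measurableSet_regSet s)]
  refine integral_congr_ae (Eventually.of_forall fun z => ?_)
  by_cases hz : z ∈ regSet s <;> simp [hz]

/-- The comparison passes through `C_c^∞(I)`, since smooth functions of `s̄` need not be smooth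
functions of `s`: it is dense in the smaller domain and contained in the larger one by assumption.
-/
theorem HasSmoothDomain.minimalScaleForm_subset [IsLocallyFiniteMeasure m] (hs : IsScale s)
    (h : HasSmoothDomain s) (e : I)
    (hmin : ∀ φ : ℝ → ℝ, IsTest I φ → ∀ f : Lp ℝ 2 m, (f =ᵐ[m] fun z => φ z) →
      f ∈ (minimalScaleForm s m).dom) :
    (minimalScaleForm (acPart s e) m).dom ⊆ (minimalScaleForm s m).dom := by
  have hac := h.isScale_acPart hs e
  intro f hf
  refine Diffusion.mem_minimalScaleForm hs (fullScaleForm_acPart_dom hs hac hf.1) fun ε hε => ?_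
  obtain ⟨φ, hφ, v, hv, hlt⟩ := h.exists_test_lt hs e hf hε
  refine ⟨v, hmin φ hφ v hv, ?_⟩
  have hvd := (h.mem_minimalScaleForm hs e hφ hv).1
  have hmem := fullScaleForm_sub_mem hac hf.1 hvd
  rwa [L2Form.energyOne, fullScaleForm_acPart_form hs hac hmem hmem]

/-! ### Absolutely continuous scales -/

omit hI in
theorem integrableOn_comp_val {f : ℝ → ℝ} {a b : I} (hf : IntegrableOn f (Ioc a b) volume) :
    IntegrableOn (fun z : I => f z) (Ioc a b) (lebesgueOn I) := by
  have he := MeasurableEmbedding.subtype_coe hI'.measurableSet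
  have h1 : Ioc a b = Subtype.val ⁻¹' Ioc (a : ℝ) b := rfl
  have h2 := (he.integrableOn_map_iff (f := f) (μ := lebesgueOn I) (s := Ioc (a : ℝ) b)).1 (by
    rw [lebesgueOn, he.map_comap]
    exact hf.mono_measure Measure.restrict_le_self)
  exact h2

/-- By the fundamental theorem of calculus the pointwise derivative of `s` integrates to the
increments of `s`, and so it dominates `ds` as a density. -/
theorem IsAbsCont.absolutelyContinuous (hs : IsScale s) (h : IsAbsCont s) :
    scaleMeasure s ≪ lebesgueOn I := by
  have hlf := isLocallyFiniteMeasure_scaleMeasure hs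
  rcases isEmpty_or_nonempty I with he | hne
  · rw [Measure.eq_zero_of_isEmpty (scaleMeasure s)]
    exact Measure.AbsolutelyContinuous.zero _
  refine Measure.AbsolutelyContinuous.mk fun A hA h0 => ?_
  obtain ⟨f, hf, hcov⟩ := exists_seq_Ioc (I := I)
  rw [← inter_univ A, ← hcov, inter_iUnion, measure_iUnion_null_iff]
  intro n
  obtain ⟨a, b, hab⟩ := hf n
  rw [hab]
  rcases le_or_gt b a with hba | hlt
  · simp [Ioc_eq_empty (not_lt.2 hba)]
  set F := Function.extend Subtype.val s 0
  have hF : ∀ z : I, F z = s z := fun z => Subtype.val_injective.extend_apply s 0 z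
  have hint : IntegrableOn (fun z : I => deriv F z) (Ioc a b) (lebesgueOn I) := by
    refine integrableOn_comp_val ?_
    have := (h a b).intervalIntegrable_deriv
    rwa [intervalIntegrable_iff_integrableOn_Ioc_of_le (show (a : ℝ) ≤ b from hlt.le)] at this
  have hle := measure_le_of_integral_Ioc (ν := scaleMeasure s) hint (fun x y hax hxy hyb => ?_) hA
  · refine le_antisymm (hle.trans (le_of_eq ?_)) bot_le
    rw [setLIntegral_measure_zero _ _ (measure_mono_null inter_subset_left h0)]
  · rw [scaleMeasure_Ioc hs, ENNReal.toReal_ofReal (sub_nonneg.2 (hs.2.monotone hxy)),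
      ← scaleMeasure_val, setIntegral_scaleMeasure isScale_val (deriv F),
      ← intervalIntegral.integral_of_le (show (x : ℝ) ≤ y from hxy), ← hF, ← hF,
      ((h a b).mono _).integral_deriv_eq_sub]
    rw [uIcc_of_le (show (x : ℝ) ≤ y from hxy), uIcc_of_le (show (a : ℝ) ≤ b from hlt.le)]
    exact Icc_subset_Icc hax hyb

/-- Without a singular part, `s` is on each compact subinterval a constant plus the primitive of an
integrable function. -/
theorem isAbsCont_of_regSet (hs : IsScale s) (h : scaleMeasure s (regSet s)ᶜ = 0) : IsAbsCont s := by
  have hlf := isLocallyFiniteMeasure_scaleMeasure hs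
  have hr : (scaleMeasure s).restrict (regSet s) = scaleMeasure s :=
    Measure.restrict_eq_self_of_ae_mem (mem_ae_iff.2 h)
  suffices key : ∀ a b : I, a ≤ b →
      AbsolutelyContinuousOnInterval (Function.extend Subtype.val s 0) a b by
    intro a b
    rcases le_total a b with hab | hab
    · exact key a b hab
    · exact (key b a hab).symm
  intro a b hab
  set g : I → ℝ := fun z => ((scaleMeasure s).rnDeriv (lebesgueOn I) z).toReal with hg
  set G := Function.extend Subtype.val g 0 with hG
  have hGg : ∀ z : I, G z = g z := fun z => Subtype.val_injective.extend_apply g 0 z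
  have he := MeasurableEmbedding.subtype_coe hI'.measurableSet
  have hGint : IntervalIntegrable G volume a b := by
    rw [intervalIntegrable_iff_integrableOn_Ioc_of_le (show (a : ℝ) ≤ b from hab)]
    have h1 : IntegrableOn (G ∘ Subtype.val) (Subtype.val ⁻¹' Ioc (a : ℝ) b) (lebesgueOn I) := by
      have := integrableOn_rnDeriv hs a b
      refine this.congr_fun (fun z _ => (hGg z).symm) measurableSet_Ioc
    rw [← he.integrableOn_map_iff, lebesgueOn, he.map_comap, IntegrableOn,
      Measure.restrict_restrict measurableSet_Ioc, inter_eq_left.2] at h1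
    · exact h1
    · rw [Subtype.range_val]
      exact Ioc_subset_Icc_self.trans (hI'.out a.2 b.2)
  have hac := hGint.absolutelyContinuousOnInterval_intervalIntegral (c := a) (by simp)
  rw [absolutelyContinuousOnInterval_iff] at hac ⊢
  have hval : ∀ t ∈ uIcc (a : ℝ) b, Function.extend Subtype.val s 0 t = s a + ∫ v in (a : ℝ)..t, G v := by
    intro t ht
    rw [uIcc_of_le (show (a : ℝ) ≤ b from hab)] at ht
    lift t to I using hI'.out a.2 b.2 ht
    have hat : a ≤ t := ht.1
    rw [Subtype.val_injective.extend_apply, intervalIntegral.integral_of_le ht.1,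
      ← setIntegral_scaleMeasure isScale_val G]
    have h1 : ∫ z in Ioc a t, G z ∂(lebesgueOn I) = s t - s a := by
      simp only [hGg]
      have h2 := ofReal_setIntegral_rnDeriv hs a t
      rw [hr, scaleMeasure_Ioc hs] at h2
      have h3 := congrArg ENNReal.toReal h2
      rwa [ENNReal.toReal_ofReal (integral_nonneg fun _ => ENNReal.toReal_nonneg),
        ENNReal.toReal_ofReal (sub_nonneg.2 (hs.2.monotone hat))] at h3
    rw [scaleMeasure_val, h1]
    ring
  intro ε hε
  obtain ⟨δ, hδ, hlt⟩ := hac ε hε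
  refine ⟨δ, hδ, fun E hE hEδ => lt_of_eq_of_lt (Finset.sum_congr rfl fun i hi => ?_) (hlt E hE hEδ)⟩
  rw [hval _ (hE.1 i hi).1, hval _ (hE.1 i hi).2, dist_add_left]

omit hI hI' in
theorem scaleTests_subset {s' : I → ℝ} {c : ℝ} (h : ∀ z, s' z = s z + c) :
    scaleTests s' ⊆ scaleTests s := by
  rintro _ ⟨φ, hφ, rfl⟩
  refine ⟨φ ∘ (Homeomorph.addRight c), ⟨hφ.1.comp (contDiff_id.add contDiff_const),
    hφ.2.1.comp_homeomorph _, ?_⟩, ?_⟩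
  · intro t ht
    rw [tsupport_comp_eq_preimage] at ht
    obtain ⟨z, hz⟩ := hφ.2.2 ht
    refine ⟨z, ?_⟩
    have h1 : s' z = t + c := hz
    rw [h z] at h1
    linarith
  · ext z
    simp [h z]

omit [m.IsOpenPosMeasure] in
theorem IsAbsCont.minimalScaleForm_acPart (hs : IsScale s) (h : IsAbsCont s) {e : I}
    (hac : IsScale (acPart s e)) : minimalScaleForm (acPart s e) m = minimalScaleForm s m := by
  have hr : scaleMeasure (acPart s e) = scaleMeasure s := by
    rw [scaleMeasure_acPart hs hac]
    exact Measure.restrict_eq_self_of_ae_mem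
      (mem_ae_iff.2 (h.absolutelyContinuous hs (lebesgueOn_compl_regSet s)))
  have hsub : ∀ x y : I, x ≤ y → acPart s e y - acPart s e x = s y - s x := by
    intro x y hxy
    have h2 := scaleMeasure_Ioc hac x y
    rw [hr, scaleMeasure_Ioc hs] at h2
    have h3 := congrArg ENNReal.toReal h2
    rw [ENNReal.toReal_ofReal (sub_nonneg.2 (hs.2.monotone hxy)),
      ENNReal.toReal_ofReal (sub_nonneg.2 (hac.2.monotone hxy))] at h3
    exact h3.symm
  -- Equal measures determine the scale up to a constant only. The constant is harmless because the
  -- smooth functions of the scale are invariant under translations.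
  have hc : ∀ z, acPart s e z = s z + (acPart s e e - s e) := by
    intro z
    rcases le_total z e with hz | hz <;> have := hsub _ _ hz <;> linarith
  have hd : IsScaleDeriv (acPart s e) = IsScaleDeriv s := by
    funext u w
    rw [IsScaleDeriv, IsScaleDeriv, hr]
  have hfull : fullScaleForm (acPart s e) m = fullScaleForm s m := by
    simp only [fullScaleForm]
    unfold scaleDeriv
    rw [hd, hr]
  have htests : scaleTests (acPart s e) = scaleTests s :=
    (scaleTests_subset hc).antisymm (scaleTests_subset (c := -(acPart s e e - s e))
      fun z => by rw [hc z]; ring)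
  change (fullScaleForm (acPart s e) m).closureOf (toL2 m (scaleTests (acPart s e))) =
    (fullScaleForm s m).closureOf (toL2 m (scaleTests s))
  rw [hfull, htests]

end Interval

end Diffusion

end

noncomputable section

namespace Diffusion

/-! ### Smooth interpolation on a grid -/

/-- A smooth bump function whose integer translates sum up to one. -/
def gridBump (y : ℝ) : ℝ := Real.smoothTransition (y + 1) - Real.smoothTransition y

theorem contDiff_gridBump : ContDiff ℝ ((⊤ : ℕ∞) : WithTop ℕ∞) gridBump :=
  (Real.smoothTransition.contDiff.comp (contDiff_id.add contDiff_const)).sub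
    Real.smoothTransition.contDiff

theorem gridBump_nonneg (y : ℝ) : 0 ≤ gridBump y :=
  sub_nonneg.2 (Real.smoothTransition.monotone (by linarith))

theorem gridBump_eq_zero {y : ℝ} (hy : 1 ≤ |y|) : gridBump y = 0 := by
  rw [gridBump]
  rcases le_abs.1 hy with h | h
  · rw [Real.smoothTransition.one_of_one_le h, Real.smoothTransition.one_of_one_le (by linarith),
      sub_self]
  · rw [Real.smoothTransition.zero_of_nonpos (by linarith),
      Real.smoothTransition.zero_of_nonpos (by linarith), sub_self]

theorem deriv_gridBump_eq_zero {y : ℝ} (hy : 1 < |y|) : deriv gridBump y = 0 := by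
  have h : gridBump =ᶠ[𝓝 y] fun _ => 0 := by
    filter_upwards [(isOpen_lt continuous_const continuous_abs).mem_nhds hy] with z hz
    exact gridBump_eq_zero (le_of_lt hz)
  rw [h.deriv_eq, deriv_const]

theorem exists_deriv_gridBump_le : ∃ C, ∀ y, |deriv gridBump y| ≤ C := by
  refine IsTest.exists_bound (U := univ) ⟨contDiff_gridBump, ?_, subset_univ _⟩
  refine HasCompactSupport.intro (isCompact_Icc (a := (-1 : ℝ)) (b := 1)) fun y hy => ?_
  refine gridBump_eq_zero (le_of_lt ?_)
  by_contra h
  exact hy (abs_le.1 (not_lt.1 h))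

/-- The sum telescopes to a difference of two values of the transition function, one taken beyond
`1` and one before `0`. -/
theorem sum_gridBump (M : ℕ) {y : ℝ} (hy : |y| ≤ M) :
    ∑ l ∈ Finset.Icc (-(M : ℤ)) M, gridBump (y - l) = 1 := by
  have h1 : ∀ N : ℕ, ∑ l ∈ Finset.Icc (-(M : ℤ)) (-(M : ℤ) + N), gridBump (y - l) =
      Real.smoothTransition (y + M + 1) - Real.smoothTransition (y + M - N) := by
    intro N
    induction N with
    | zero =>
      simp [gridBump]
    | succ N ih =>
      have : Finset.Icc (-(M : ℤ)) (-(M : ℤ) + (N + 1 : ℕ)) =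
          insert (-(M : ℤ) + (N + 1 : ℕ)) (Finset.Icc (-(M : ℤ)) (-(M : ℤ) + N)) := by
        ext l
        simp only [Finset.mem_Icc, Finset.mem_insert]
        push_cast
        omega
      rw [this, Finset.sum_insert (by simp), ih, gridBump]
      push_cast
      rw [show y - (-(M : ℝ) + (N + 1)) + 1 = y + M - N by ring,
        show y - (-(M : ℝ) + (N + 1)) = y + M - (N + 1) by ring]
      ring
  have h2 := h1 (2 * M)
  rw [show -(M : ℤ) + (2 * M : ℕ) = M by push_cast; ring] at h2
  rw [h2, Real.smoothTransition.one_of_one_le (by linarith [(abs_le.1 hy).1]),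
    Real.smoothTransition.zero_of_nonpos (by push_cast; linarith [(abs_le.1 hy).2]), sub_zero]

/-- Derivative of a constant. It permits the subtraction of `φ x` from all interpolation
coefficients when a partial derivative is estimated. -/
theorem sum_deriv_gridBump (M : ℕ) {y : ℝ} (hy : |y| < M) :
    ∑ l ∈ Finset.Icc (-(M : ℤ)) M, deriv gridBump (y - l) = 0 := by
  have h : (fun z : ℝ => ∑ l ∈ Finset.Icc (-(M : ℤ)) M, gridBump (z - l)) =ᶠ[𝓝 y] fun _ => 1 := by
    filter_upwards [(isOpen_lt continuous_abs continuous_const).mem_nhds hy] with z hz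
    exact sum_gridBump M (le_of_lt hz)
  have h1 := h.deriv_eq
  rw [deriv_const] at h1
  rw [← h1, deriv_fun_sum]
  · refine Finset.sum_congr rfl fun l _ => ?_
    rw [deriv_comp_sub_const]
  · intro l _
    exact ((contDiff_gridBump.differentiable (by simp)).comp (differentiable_id.sub_const _)) y

theorem sum_abs_deriv_gridBump_le {C : ℝ} (hC : ∀ y, |deriv gridBump y| ≤ C) (M : ℕ) (y : ℝ) :
    ∑ l ∈ Finset.Icc (-(M : ℤ)) M, |deriv gridBump (y - l)| ≤ 3 * C := by
  have hC0 : 0 ≤ C := (abs_nonneg _).trans (hC 0)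
  -- At most the three integers around `⌊y⌋` are within distance one of `y`.
  have h1 : ∀ l : ℤ, l ∉ Finset.Icc (⌊y⌋ - 1) (⌊y⌋ + 1) → |deriv gridBump (y - l)| = 0 := by
    intro l hl
    rw [abs_eq_zero]
    refine deriv_gridBump_eq_zero ?_
    by_contra h
    have h2 := abs_le.1 (not_lt.1 h)
    have h3 := Int.floor_le y
    have h4 := Int.lt_floor_add_one y
    refine hl (Finset.mem_Icc.2 ⟨?_, ?_⟩)
    · rw [sub_le_iff_le_add, Int.floor_le_iff]
      push_cast
      by_contra h5
      have h6 : (l : ℝ) ≤ y - 2 := by linarith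
      linarith
    · have h6 : l - 1 ≤ ⌊y⌋ := Int.le_floor.2 (by push_cast; linarith)
      omega
  calc ∑ l ∈ Finset.Icc (-(M : ℤ)) M, |deriv gridBump (y - l)|
      = ∑ l ∈ Finset.Icc (-(M : ℤ)) M ∩ Finset.Icc (⌊y⌋ - 1) (⌊y⌋ + 1),
          |deriv gridBump (y - l)| := by
        refine (Finset.sum_subset Finset.inter_subset_left fun l hl hl' => h1 l fun h => ?_).symm
        exact hl' (Finset.mem_inter.2 ⟨hl, h⟩)
    _ ≤ ∑ l ∈ Finset.Icc (⌊y⌋ - 1) (⌊y⌋ + 1), |deriv gridBump (y - l)| :=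
        Finset.sum_le_sum_of_subset_of_nonneg Finset.inter_subset_right fun _ _ _ => abs_nonneg _
    _ ≤ (Finset.Icc (⌊y⌋ - 1) (⌊y⌋ + 1)).card • C := Finset.sum_le_card_nsmul _ _ _ fun l _ => hC _
    _ = 3 * C := by
        rw [Int.card_Icc, nsmul_eq_mul]
        congr 1
        rw [show ⌊y⌋ + 1 + 1 - (⌊y⌋ - 1) = 3 by ring, show Int.toNat 3 = 3 from rfl]
        norm_num

/-- A Lipschitz function is approximated uniformly on a cube by finite sums of products of smooth
functions of the coordinates, with partial derivatives that stay bounded. -/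
theorem exists_sum_prod_approx {d : ℕ} {φ : (Fin d → ℝ) → ℝ} {L : ℝ≥0} (hφ : LipschitzWith L φ)
    (R : ℝ) : ∃ B : ℝ, ∀ ε : ℝ, 0 < ε → ∃ (A : Finset (Fin d → ℤ)) (c : (Fin d → ℤ) → ℝ)
      (ρ : (Fin d → ℤ) → Fin d → ℝ → ℝ), (∀ k j, ContDiff ℝ ((⊤ : ℕ∞) : WithTop ℕ∞) (ρ k j)) ∧
      ∀ x : Fin d → ℝ, (∀ j, |x j| ≤ R) →
        |(∑ k ∈ A, c k * ∏ j, ρ k j (x j)) - φ x| ≤ ε ∧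
        ∀ i, |∑ k ∈ A, c k * ∏ j, Function.update (ρ k) i (deriv (ρ k i)) j (x j)| ≤ B := by
  obtain ⟨C, hC⟩ := exists_deriv_gridBump_le
  have hC0 : 0 ≤ C := (abs_nonneg _).trans (hC 0)
  -- Interpolation on a grid of mesh `1 / N`: differentiation produces a factor `N`, the oscillation
  -- of the coefficients a factor `L / N`, and at most three neighbors contribute `C` each. The
  -- bound is independent of the mesh.
  refine ⟨L * (3 * C), fun ε hε => ?_⟩
  obtain ⟨n, hn⟩ := exists_nat_gt (L / ε)
  set N : ℝ := n + 1 with hN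
  have hN0 : 0 < N := by positivity
  obtain ⟨M, hM⟩ := exists_nat_gt (N * R)
  have hLN : L * (1 / N) ≤ ε := by
    rw [div_lt_iff₀ hε] at hn
    rw [mul_one_div, div_le_iff₀ hN0, hN]
    nlinarith
  set T : Finset ℤ := Finset.Icc (-(M : ℤ)) M with hT
  refine ⟨Fintype.piFinset fun _ => T, fun k => φ fun j => k j / N,
    fun k j t => gridBump (N * t - k j), fun k j => contDiff_gridBump.comp
      ((contDiff_const.mul contDiff_id).sub contDiff_const), fun x hx => ?_⟩
  have hxM : ∀ j, |N * x j| < M := fun j => by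
    rw [abs_mul, abs_of_pos hN0]
    exact (mul_le_mul_of_nonneg_left (hx j) hN0.le).trans_lt hM
  have hclose : ∀ k : Fin d → ℤ, (∀ j, |N * x j - k j| ≤ 1) →
      |φ (fun j => k j / N) - φ x| ≤ L * (1 / N) := by
    intro k hk
    rw [← Real.dist_eq]
    refine (hφ.dist_le_mul _ _).trans (mul_le_mul_of_nonneg_left ?_ L.2)
    rw [dist_pi_le_iff (by positivity)]
    intro j
    rw [Real.dist_eq, show (k j : ℝ) / N - x j = -((N * x j - k j) / N) by field_simp; ring, abs_neg,
      abs_div, abs_of_pos hN0]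
    exact div_le_div_of_nonneg_right (hk j) hN0.le
  -- One estimate serves the values and the derivatives. A weight with index `k` is nonzero only if
  -- the grid point `k / N` is within `1 / N` of `x` in every coordinate, and then `φ` differs there
  -- from `φ x` by at most `L / N`.
  have hsum : ∀ α : Fin d → ℤ → ℝ, (∀ j l, α j l ≠ 0 → |N * x j - l| ≤ 1) →
      |(∑ k ∈ Fintype.piFinset fun _ => T, φ (fun j => k j / N) * ∏ j, α j (k j)) -
        φ x * ∏ j, ∑ l ∈ T, α j l| ≤ L * (1 / N) * ∏ j, ∑ l ∈ T, |α j l| := by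
    intro α hα
    rw [Finset.prod_univ_sum, Finset.prod_univ_sum, Finset.mul_sum, Finset.mul_sum,
      ← Finset.sum_sub_distrib]
    refine (Finset.abs_sum_le_sum_abs _ _).trans (Finset.sum_le_sum fun k _ => ?_)
    rw [← sub_mul, abs_mul, Finset.abs_prod]
    by_cases h0 : ∀ j, α j (k j) ≠ 0
    · exact mul_le_mul_of_nonneg_right (hclose k fun j => hα j _ (h0 j))
        (Finset.prod_nonneg fun _ _ => abs_nonneg _)
    · push Not at h0
      obtain ⟨j, hj⟩ := h0
      rw [Finset.prod_eq_zero (Finset.mem_univ j) (by rw [hj, abs_zero]), mul_zero, mul_zero]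
  have hα1 : ∀ j (l : ℤ), gridBump (N * x j - l) ≠ 0 → |N * x j - l| ≤ 1 := by
    intro j l h
    by_contra h'
    exact h (gridBump_eq_zero (le_of_lt (not_le.1 h')))
  have hs1 : ∀ j, ∑ l ∈ T, |gridBump (N * x j - l)| = 1 := fun j => by
    rw [← sum_gridBump M (hxM j).le]
    exact Finset.sum_congr rfl fun l _ => abs_of_nonneg (gridBump_nonneg _)
  constructor
  · have h := hsum (fun j l => gridBump (N * x j - l)) hα1
    simp only [hs1, Finset.prod_const_one, mul_one] at h
    rw [Finset.prod_congr rfl fun j _ => sum_gridBump M (hxM j).le, Finset.prod_const_one,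
      mul_one] at h
    exact h.trans hLN
  · intro i
    -- For the `i`-th partial derivative the weights of the `i`-th coordinate sum to zero, so the
    -- main term `φ x * ∏ j, ∑ l ∈ T, α j l` disappears.
    set α : Fin d → ℤ → ℝ := fun j l => if j = i then N * deriv gridBump (N * x j - l)
      else gridBump (N * x j - l) with hαdef
    have h := hsum α (by
      intro j l hne
      by_cases hj : j = i
      · by_contra h'
        refine hne ?_
        simp only [hαdef, if_pos hj]
        rw [deriv_gridBump_eq_zero (not_le.1 h'), mul_zero]
      · refine hα1 j l ?_
        simpa [hαdef, hj] using hne)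
    have hz : ∏ j, ∑ l ∈ T, α j l = 0 := by
      refine Finset.prod_eq_zero (Finset.mem_univ i) ?_
      simp only [hαdef, if_true]
      rw [← Finset.mul_sum, sum_deriv_gridBump M (hxM i), mul_zero]
    have hle : ∏ j, ∑ l ∈ T, |α j l| ≤ N * (3 * C) := by
      rw [← Finset.mul_prod_erase _ _ (Finset.mem_univ i)]
      have h1 : ∏ j ∈ Finset.univ.erase i, ∑ l ∈ T, |α j l| = 1 := by
        refine Finset.prod_eq_one fun j hj => ?_
        simp only [hαdef, if_neg (Finset.ne_of_mem_erase hj)]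
        exact hs1 j
      rw [h1, mul_one]
      simp only [hαdef, if_true, abs_mul, abs_of_pos hN0]
      rw [← Finset.mul_sum]
      exact mul_le_mul_of_nonneg_left (sum_abs_deriv_gridBump_le hC M _) hN0.le
    rw [hz, mul_zero, sub_zero] at h
    have heq : ∀ k : Fin d → ℤ, ∏ j, Function.update (fun j t => gridBump (N * t - k j)) i
        (deriv fun t => gridBump (N * t - k i)) j (x j) = ∏ j, α j (k j) := by
      intro k
      refine Finset.prod_congr rfl fun j _ => ?_
      by_cases hj : j = i
      · subst hj
        rw [Function.update_self]
        simp only [hαdef, if_true]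
        have hd : HasDerivAt (fun t => gridBump (N * t - k j))
            (deriv gridBump (N * x j - k j) * (N * 1)) (x j) :=
          HasDerivAt.comp (x j) ((contDiff_gridBump.differentiable (by simp)) _).hasDerivAt
            (((hasDerivAt_id _).const_mul N).sub_const _)
        rw [hd.deriv]
        ring
      · rw [Function.update_of_ne hj]
        simp [hαdef, hj]
    simp only [heq]
    calc _ ≤ L * (1 / N) * (N * (3 * C)) :=
          h.trans (mul_le_mul_of_nonneg_left hle (by positivity))
      _ = L * (3 * C) := by field_simp

end Diffusion

end

/-! ### Product forms on the box and the test functions in their domain -/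

noncomputable section

namespace Diffusion

open scoped RealInnerProductSpace

theorem prod_update_apply {ι : Type*} [Fintype ι] [DecidableEq ι] {S : ι → Type*}
    (f : ∀ j, S j → ℝ) (i : ι) (g : S i → ℝ) (x : ∀ j, S j) :
    ∏ j, Function.update f i g j (x j) = g (x i) * ∏ j ∈ Finset.univ.erase i, f j (x j) := by
  rw [← Finset.mul_prod_erase _ _ (Finset.mem_univ i), Function.update_self]
  congr 1
  exact Finset.prod_congr rfl fun j hj => by rw [Function.update_of_ne (Finset.ne_of_mem_erase hj)]

section Product

variable {d : ℕ} {I : Fin d → Set ℝ} [∀ i, Fact (IsOpen (I i))] [∀ i, OrdConnected (I i)]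
  {m : ∀ i, Measure (I i)} [∀ i, IsLocallyFiniteMeasure (m i)] {s : ∀ i, I i → ℝ}

/-! ### The energy of a sum of products -/

theorem sigmaFinite_update (hs : ∀ i, IsScale (s i)) (i j : Fin d) :
    SigmaFinite (Function.update m i (scaleMeasure (s i)) j) := by
  have := isLocallyFiniteMeasure_scaleMeasure (hs i)
  by_cases h : j = i
  · subst h
    rw [Function.update_self]
    infer_instance
  · rw [Function.update_of_ne h]
    infer_instance

omit [∀ i, Fact (IsOpen (I i))] [∀ i, OrdConnected (I i)] [∀ i, IsLocallyFiniteMeasure (m i)] in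
theorem memLp_update {u : ∀ j, I j → ℝ} {i : Fin d} {w : I i → ℝ} (hu : ∀ j, MemLp (u j) 2 (m j))
    (hw : MemLp w 2 (scaleMeasure (s i))) (j : Fin d) :
    MemLp (Function.update u i w j) 2 (Function.update m i (scaleMeasure (s i)) j) := by
  by_cases h : j = i
  · subst h
    rwa [Function.update_self, Function.update_self]
  · rw [Function.update_of_ne h, Function.update_of_ne h]
    exact hu j

/-- Replacing the `i`-th factor of the product measure by `dsᵢ` turns the `i`-th term of the energy
into a single `L²` inner product over the box, of functions differentiated in the `i`-th factor.
Pointwise bounds on partial derivatives thereby become energy bounds. -/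
theorem integral_prod_update (hs : ∀ i, IsScale (s i)) (i : Fin d) (u u' : ∀ j, I j → ℝ)
    (w w' : I i → ℝ) :
    ∫ x, (∏ j, Function.update u i w j (x j)) * ∏ j, Function.update u' i w' j (x j)
      ∂(Measure.pi (Function.update m i (scaleMeasure (s i)))) =
    (∫ z, w z * w' z ∂(scaleMeasure (s i))) *
      ∏ j ∈ Finset.univ.erase i, ∫ z, u j z * u' j z ∂(m j) := by
  have := fun j => sigmaFinite_update (m := m) hs i j
  simp only [← Finset.prod_mul_distrib]
  rw [integral_fintype_prod_eq_prod
    (fun j z => Function.update u i w j z * Function.update u' i w' j z),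
    ← Finset.mul_prod_erase _ _ (Finset.mem_univ i)]
  congr 1
  · rw [Function.update_self, Function.update_self, Function.update_self]
  · refine Finset.prod_congr rfl fun j hj => ?_
    have hj' := Finset.ne_of_mem_erase hj
    rw [Function.update_of_ne hj', Function.update_of_ne hj', Function.update_of_ne hj']

theorem memLp_prod_update (hs : ∀ i, IsScale (s i)) (i : Fin d) {u : ∀ j, I j → ℝ} {w : I i → ℝ}
    (hu : ∀ j, MemLp (u j) 2 (m j)) (hw : MemLp w 2 (scaleMeasure (s i))) :
    MemLp (fun x => ∏ j, Function.update u i w j (x j)) 2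
      (Measure.pi (Function.update m i (scaleMeasure (s i)))) := by
  have := fun j => sigmaFinite_update (m := m) hs i j
  exact memLp_prod (memLp_update hu hw)

/-- The energy of a linear combination of products. -/
theorem IsCartesianForm.form_sum_tens [∀ i, (m i).IsOpenPosMeasure] (hs : ∀ i, IsScale (s i))
    {q : L2Form (Measure.pi m)}
    (hq : IsCartesianForm q fun i => minimalScaleForm (s i) (m i)) {κ : Type*} (A : Finset κ)
    (c : κ → ℝ) {f : κ → ∀ j, Lp ℝ 2 (m j)} {u w : κ → ∀ j, I j → ℝ}
    (hf : ∀ a j, f a j ∈ (minimalScaleForm (s j) (m j)).dom)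
    (hu : ∀ a j, f a j =ᵐ[m j] u a j) (hw : ∀ a j, IsScaleDeriv (s j) (u a j) (w a j)) :
    q.form (∑ a ∈ A, c a • tens (f a)) (∑ a ∈ A, c a • tens (f a)) =
      ∑ i, 1 / 2 * ∫ x, (∑ a ∈ A, c a * ∏ j, Function.update (u a) i (w a i) j (x j)) ^ 2
        ∂(Measure.pi (Function.update m i (scaleMeasure (s i)))) := by
  have hum : ∀ a j, MemLp (u a j) 2 (m j) := fun a j => (memLp_congr_ae (hu a j)).1 (Lp.memLp _)
  have hmem : ∀ a, tens (f a) ∈ q.dom := fun a =>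
    hq.tensors_subset (mem_tensors.2 ⟨f a, hf a, rfl⟩)
  have hval : ∀ a b, q.form (tens (f a)) (tens (f b)) = ∑ i, 1 / 2 *
      ∫ x, (∏ j, Function.update (u a) i (w a i) j (x j)) *
        ∏ j, Function.update (u b) i (w b i) j (x j)
        ∂(Measure.pi (Function.update m i (scaleMeasure (s i)))) := by
    intro a b
    rw [hq.form_tensors (f a) (f b) (hf a) (hf b) _ _ (coeFn_tens _) (coeFn_tens _)]
    refine Finset.sum_congr rfl fun i _ => ?_
    rw [integral_prod_update hs, ← mul_assoc]
    congr 1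
    · exact fullScaleForm_form (hs i) (hu a i) (hw a i) (hu b i) (hw b i)
    · refine Finset.prod_congr rfl fun j _ => integral_congr_ae ?_
      filter_upwards [hu a j, hu b j] with z h1 h2
      rw [h1, h2]
  have hint : ∀ i a b, Integrable (fun x => (∏ j, Function.update (u a) i (w a i) j (x j)) *
        ∏ j, Function.update (u b) i (w b i) j (x j))
        (Measure.pi (Function.update m i (scaleMeasure (s i)))) := fun i a b =>
    (memLp_prod_update hs i (hum a) (hw a i).1).integrable_mul
      (memLp_prod_update hs i (hum b) (hw b i).1)
  have hR : ∀ i, ∫ x, (∑ a ∈ A, c a * ∏ j, Function.update (u a) i (w a i) j (x j)) ^ 2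
        ∂(Measure.pi (Function.update m i (scaleMeasure (s i)))) =
      ∑ a ∈ A, ∑ b ∈ A, c a * c b * ∫ x, (∏ j, Function.update (u a) i (w a i) j (x j)) *
        ∏ j, Function.update (u b) i (w b i) j (x j)
        ∂(Measure.pi (Function.update m i (scaleMeasure (s i)))) := by
    intro i
    have hint' : ∀ a b, Integrable (fun x =>
        (c a * ∏ j, Function.update (u a) i (w a i) j (x j)) *
          (c b * ∏ j, Function.update (u b) i (w b i) j (x j)))
        (Measure.pi (Function.update m i (scaleMeasure (s i)))) := fun a b => by
      refine ((hint i a b).const_mul (c a * c b)).congr (Eventually.of_forall fun x => ?_)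
      simp only
      ring
    simp only [sq, Finset.sum_mul_sum]
    rw [integral_finsetSum _ fun a _ => integrable_finsetSum _ fun b _ => hint' a b]
    refine Finset.sum_congr rfl fun a _ => ?_
    rw [integral_finsetSum _ fun b _ => hint' a b]
    refine Finset.sum_congr rfl fun b _ => ?_
    rw [← integral_const_mul]
    congr 1
    ext x
    ring
  have hL : q.form (∑ a ∈ A, c a • tens (f a)) (∑ a ∈ A, c a • tens (f a)) =
      ∑ a ∈ A, ∑ b ∈ A, c a * c b * q.form (tens (f a)) (tens (f b)) := by
    let v : κ → hq.closed.domain := fun a => ⟨tens (f a), hmem a⟩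
    have hv : (∑ a ∈ A, c a • tens (f a)) = ((∑ a ∈ A, c a • v a : hq.closed.domain) : Lp ℝ 2 _) := by
      simp [v]
    rw [hv, ← hq.closed.bilin_apply, map_sum, Finset.sum_comm]
    refine Finset.sum_congr rfl fun b _ => ?_
    rw [map_smul, map_sum, LinearMap.sum_apply, Finset.smul_sum]
    refine Finset.sum_congr rfl fun a _ => ?_
    rw [map_smul, LinearMap.smul_apply, hq.closed.bilin_apply]
    simp only [smul_eq_mul, v]
    ring
  rw [hL]
  simp only [hR, hval]
  simp only [Finset.mul_sum]
  rw [Finset.sum_comm_cycle]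
  refine Finset.sum_congr rfl fun i _ => Finset.sum_congr rfl fun a _ =>
    Finset.sum_congr rfl fun b _ => ?_
  ring

omit [∀ i, Fact (IsOpen (I i))] [∀ i, OrdConnected (I i)] [∀ i, IsLocallyFiniteMeasure (m i)] in
/-- The Cartesian product of restrictions of the factors is a restriction of the Cartesian
product. -/
theorem IsCartesianForm.restrict {q : L2Form (Measure.pi m)} {p p' : ∀ i, L2Form (m i)}
    (hq : IsCartesianForm q p) (hsub : ∀ i, (p' i).dom ⊆ (p i).dom)
    (hform : ∀ i, ∀ f ∈ (p' i).dom, ∀ g ∈ (p' i).dom, (p' i).form f g = (p i).form f g) :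
    IsCartesianForm (q.closureOf (Submodule.span ℝ (tensors p') : Set (Lp ℝ 2 (Measure.pi m)))) p' := by
  have htens : tensors p' ⊆ q.dom := by
    rintro u ⟨f, hf, hu⟩
    exact hq.tensors_subset ⟨f, fun i => hsub i (hf i), hu⟩
  have hspan : (Submodule.span ℝ (tensors p') : Set (Lp ℝ 2 (Measure.pi m))) ⊆ q.dom :=
    (Submodule.span_le (p := hq.closed.domain)).2 htens
  refine ⟨hq.closed.isClosedForm_closureOf hspan,
    Submodule.subset_span.trans (hq.closed.subset_closureOf hspan), ?_, fun u hu => ⟨hu, hu.2⟩⟩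
  intro f g hf hg u v hu hv
  refine (hq.form_tensors f g (fun i => hsub i (hf i)) (fun i => hsub i (hg i)) u v hu hv).trans ?_
  exact Finset.sum_congr rfl fun i _ => by rw [hform i _ (hf i) _ (hg i)]

omit [∀ i, Fact (IsOpen (I i))] [∀ i, OrdConnected (I i)] in
theorem coeFn_sum_smul {S κ : Type*} [MeasurableSpace S] {μ : Measure S} (A : Finset κ) (c : κ → ℝ)
    {v : κ → Lp ℝ 2 μ} {v' : κ → S → ℝ} (h : ∀ k, v k =ᵐ[μ] v' k) :
    (∑ k ∈ A, c k • v k : Lp ℝ 2 μ) =ᵐ[μ] fun x => ∑ k ∈ A, c k * v' k x := by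
  classical
  induction A using Finset.induction_on with
  | empty =>
    simp only [Finset.sum_empty]
    exact Lp.coeFn_zero _ _ _
  | insert k A hk ih =>
    rw [Finset.sum_insert hk]
    filter_upwards [Lp.coeFn_add (c k • v k) (∑ k ∈ A, c k • v k), Lp.coeFn_smul (c k) (v k), ih,
      h k] with x h1 h2 h3 h4
    rw [h1, Pi.add_apply, h2, Pi.smul_apply, h3, h4, Finset.sum_insert hk, smul_eq_mul]

/-- The product rule for one factor of a product. -/
theorem prod_update_mul_deriv (i : Fin d) {ρ η : Fin d → ℝ → ℝ} (hρ : Differentiable ℝ (ρ i))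
    (hη : Differentiable ℝ (η i)) (y : Fin d → ℝ) :
    ∏ j, Function.update (fun j => ρ j * η j) i (deriv (ρ i * η i)) j (y j) =
      (∏ j, Function.update η i (deriv (η i)) j (y j)) * ∏ j, ρ j (y j) +
        (∏ j, η j (y j)) * ∏ j, Function.update ρ i (deriv (ρ i)) j (y j) := by
  rw [prod_update_apply, prod_update_apply, prod_update_apply, ← Finset.mul_prod_erase _ _ (Finset.mem_univ i),
    ← Finset.mul_prod_erase _ _ (Finset.mem_univ i), deriv_mul (hρ _) (hη _)]
  simp only [Pi.mul_apply, Finset.prod_mul_distrib]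
  ring

/-- The test functions on the box belong to the Cartesian product of the minimal forms of the
absolutely continuous parts. -/
theorem IsCartesianForm.smoothBox_subset [∀ i, (m i).IsOpenPosMeasure] (hs : ∀ i, IsScale (s i))
    (h : ∀ i, HasSmoothDomain (s i)) (e : ∀ i, I i) {q : L2Form (Measure.pi m)}
    (hq : IsCartesianForm q fun i => minimalScaleForm (acPart (s i) (e i)) (m i)) :
    toL2 (Measure.pi m) (smoothBox I) ⊆ q.dom := by
  rintro u ⟨_, ⟨φ, hφ, rfl⟩, hu⟩
  have hsc := fun i => (h i).isScale_acPart (hs i) (e i)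
  obtain ⟨L, hL⟩ : ∃ L, LipschitzWith L φ :=
    ContDiff.lipschitzWith_of_hasCompactSupport hφ.2.1 hφ.1 (by simp)
  obtain ⟨Cφ, hCφ⟩ := hφ.1.continuous.bounded_above_of_compact_support hφ.2.1
  have hCφ0 : 0 ≤ Cφ := (norm_nonneg _).trans (hCφ 0)
  -- The cut-offs are one on the projections of the support, so `(∏ η) φ = φ`. Multiplying the
  -- interpolating products by them yields products of test functions without changing the limit.
  have hcut : ∀ j, ∃ η : ℝ → ℝ, IsTest (I j) η ∧ (∀ t, η t ∈ Icc (0 : ℝ) 1) ∧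
      ∀ t ∈ (fun x : Fin d → ℝ => x j) '' tsupport φ, η t = 1 := fun j =>
    exists_isTest_eq_one (hφ.2.1.isCompact.image (continuous_apply j)) (Fact.out : IsOpen (I j)) (by
      rintro _ ⟨x, hx, rfl⟩
      exact hφ.2.2 hx j (mem_univ j))
  choose η hη1 hη2 hη3 using hcut
  have hηφ : ∀ y, (∏ j, η j (y j)) * φ y = φ y := by
    intro y
    by_cases hy : y ∈ tsupport φ
    · rw [Finset.prod_eq_one fun j _ => hη3 j _ ⟨y, hy, rfl⟩, one_mul]
    · rw [image_eq_zero_of_notMem_tsupport hy, mul_zero]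
  choose Cη hCη using fun j => (hη1 j).exists_bound
  have hbox : ∀ j, ∃ a b : I j, a < b ∧ tsupport (η j) ⊆ Ioo (a : ℝ) b := fun j => by
    have : Nonempty (I j) := ⟨e j⟩
    obtain ⟨a, b, hab, hsub, -⟩ := (isScale_val (I := I j)).exists_preimage_subset (hη1 j).2.1
      ((hη1 j).2.2.trans_eq Subtype.range_val.symm)
    exact ⟨a, b, hab, hsub⟩
  choose a b hab hsub using hbox
  set R : ℝ := ∑ j, (|(a j : ℝ)| + |(b j : ℝ)|) with hR
  have hxR : ∀ x : ∀ j, I j, (∀ j, x j ∈ Ioc (a j) (b j)) → ∀ j, |(x j : ℝ)| ≤ R := by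
    intro x hx j
    have h1 : |(a j : ℝ)| + |(b j : ℝ)| ≤ R :=
      Finset.single_le_sum (f := fun j => |(a j : ℝ)| + |(b j : ℝ)|)
        (fun _ _ => by positivity) (Finset.mem_univ j)
    have h2 : (a j : ℝ) < x j := (hx j).1
    have h3 : (x j : ℝ) ≤ b j := (hx j).2
    refine le_trans (abs_le.2 ⟨?_, ?_⟩) h1
    · linarith [neg_abs_le (a j : ℝ), abs_nonneg (b j : ℝ)]
    · linarith [le_abs_self (b j : ℝ), abs_nonneg (a j : ℝ)]
  obtain ⟨B, hB⟩ := exists_sum_prod_approx hL R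
  have hpos : ∀ n : ℕ, (0 : ℝ) < 1 / (n + 1) := fun n => by positivity
  choose A c ρ hρ happ using fun n : ℕ => hB (1 / (n + 1)) (hpos n)
  have htest : ∀ n k j, IsTest (I j) (ρ n k j * η j) := fun n k j => (hη1 j).mul_left (hρ n k j)
  have htest' : ∀ n k j, IsTest (range (Subtype.val : I j → ℝ)) (ρ n k j * η j) := fun n k j => by
    rw [Subtype.range_val]
    exact htest n k j
  have hmem : ∀ n k j, MemLp ((ρ n k j * η j) ∘ (Subtype.val : I j → ℝ)) 2 (m j) := fun n k j =>
    memLp_comp_scale isScale_val (htest' n k j)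
  set f : ∀ (n : ℕ) (k : Fin d → ℤ) (j : Fin d), Lp ℝ 2 (m j) := fun n k j => (hmem n k j).toLp
  have hf : ∀ n k j, f n k j ∈ (minimalScaleForm (acPart (s j) (e j)) (m j)).dom := fun n k j =>
    (h j).mem_minimalScaleForm (hs j) (e j) (htest n k j) (hmem n k j).coeFn_toLp
  have hfd := fun n k j => ((h j).isScaleChange (hs j) (e j)).isScaleDeriv_comp (htest' n k j)
  set v : ℕ → Lp ℝ 2 (Measure.pi m) := fun n => ∑ k ∈ A n, c n k • tens (f n k) with hv
  have hspan : ∀ n, v n ∈ Submodule.span ℝ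
      (tensors fun i => minimalScaleForm (acPart (s i) (e i)) (m i)) := fun n =>
    Submodule.sum_mem _ fun k _ => Submodule.smul_mem _ _
      (Submodule.subset_span (mem_tensors.2 ⟨f n k, hf n k, rfl⟩))
  have hspanq : (Submodule.span ℝ (tensors fun i => minimalScaleForm (acPart (s i) (e i)) (m i)) :
      Set (Lp ℝ 2 (Measure.pi m))) ⊆ q.dom :=
    (Submodule.span_le (p := hq.closed.domain)).2 hq.tensors_subset
  have hout : ∀ x : ∀ j, I j, ∀ j, x j ∉ Ioc (a j) (b j) → (x j : ℝ) ∉ tsupport (η j) :=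
    fun x j hx hx' => hx (Ioo_subset_Ioc_self (hsub j hx'))
  have hfac : ∀ n k (y : Fin d → ℝ), ∏ j, (ρ n k j * η j) (y j) =
      (∏ j, η j (y j)) * ∏ j, ρ n k j (y j) := fun n k y => by
    simp only [Pi.mul_apply]
    rw [Finset.prod_mul_distrib, mul_comm]
  have hvG : ∀ n, v n =ᵐ[Measure.pi m] fun x =>
      ∑ k ∈ A n, c n k * ∏ j, (ρ n k j * η j) (x j) := fun n =>
    coeFn_sum_smul (A n) (c n) fun k => (coeFn_tens (f n k)).trans
      (prod_congr_ae fun j => (hmem n k j).coeFn_toLp)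
  -- The error is uniformly small and supported in a fixed box of finite measure, hence small in
  -- `L²`.
  have hGφ : ∀ n (x : ∀ j, I j), |(∑ k ∈ A n, c n k * ∏ j, (ρ n k j * η j) (x j)) - φ fun j => x j| ≤
      1 / (n + 1) * ∏ j, (Ioc (a j) (b j)).indicator (fun _ => (1 : ℝ)) (x j) := by
    intro n x
    have h1 : (∑ k ∈ A n, c n k * ∏ j, (ρ n k j * η j) (x j)) - (φ fun j => x j) =
        (∏ j, η j (x j)) * ((∑ k ∈ A n, c n k * ∏ j, ρ n k j (x j)) - φ fun j => x j) := by
      rw [mul_sub, hηφ fun j => x j, Finset.mul_sum]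
      congr 1
      refine Finset.sum_congr rfl fun k _ => ?_
      rw [hfac n k fun j => x j]
      ring
    rw [h1, abs_mul, Finset.abs_prod]
    by_cases hx : ∀ j, x j ∈ Ioc (a j) (b j)
    · rw [Finset.prod_congr rfl fun j _ => indicator_of_mem (hx j) _, Finset.prod_const_one, mul_one]
      calc _ ≤ 1 * (1 / ((n : ℝ) + 1)) := by
            refine mul_le_mul (Finset.prod_le_one (fun _ _ => abs_nonneg _) fun j _ => ?_)
              (happ n (fun j => x j) (hxR x hx)).1 (abs_nonneg _) zero_le_one
            rw [abs_of_nonneg (hη2 j _).1]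
            exact (hη2 j _).2
        _ = _ := one_mul _
    · push Not at hx
      obtain ⟨j, hj⟩ := hx
      rw [Finset.prod_eq_zero (Finset.mem_univ j), zero_mul]
      · exact mul_nonneg (hpos n).le
          (Finset.prod_nonneg fun j _ => indicator_nonneg (fun _ _ => zero_le_one) _)
      · rw [image_eq_zero_of_notMem_tsupport (hout x j hj), abs_zero]
  have hlim : Tendsto v atTop (𝓝 u) := by
    have hg : MemLp (fun x : ∀ j, I j => ∏ j, (Ioc (a j) (b j)).indicator (fun _ => (1 : ℝ)) (x j)) 2
        (Measure.pi m) := memLp_prod fun j =>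
      memLp_indicator_const 2 measurableSet_Ioc 1 (Or.inr (measure_Ioc_ne_top (m j) _ _))
    rw [tendsto_iff_norm_sub_tendsto_zero]
    have hz : Tendsto (fun n : ℕ => 1 / ((n : ℝ) + 1) * ‖hg.toLp‖) atTop (𝓝 0) := by
      simpa using tendsto_one_div_add_atTop_nhds_zero_nat.mul_const ‖hg.toLp‖
    refine squeeze_zero (fun _ => norm_nonneg _) (fun n => ?_) hz
    refine Lp.norm_le_mul_norm_of_ae_le_mul ?_
    filter_upwards [Lp.coeFn_sub (v n) u, hvG n, hu, hg.coeFn_toLp] with x h1 h2 h3 h4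
    rw [h1, Pi.sub_apply, h2, h3, h4, Real.norm_eq_abs, Real.norm_of_nonneg
      (Finset.prod_nonneg fun j _ => indicator_nonneg (fun _ _ => zero_le_one) _)]
    exact hGφ n x
  -- The product rule leaves two terms: the derivative of the cut-off times the interpolation, at
  -- most `Cφ + 1` in size, and the cut-off times the derivative of the interpolation, at most `B`.
  -- The density `dx/ds̄ᵢ` is kept in the square integrable `W i`.
  set B' : Fin d → ℝ := fun i => Cη i * (Cφ + 1) + B with hB'
  set W : ∀ i, (∀ j, I j) → ℝ := fun i x => ∏ j, Function.update
    (fun j => (Ioc (a j) (b j)).indicator fun _ => (1 : ℝ)) i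
      ((Ioc (a i) (b i)).indicator (invDensity (s i))) j (x j) with hW
  have hWm : ∀ i, MemLp (W i) 2
      (Measure.pi (Function.update m i (scaleMeasure (acPart (s i) (e i))))) := fun i => by
    refine memLp_prod_update (s := fun i => acPart (s i) (e i)) hsc i
      (fun j => memLp_indicator_const 2 measurableSet_Ioc 1
        (Or.inr (measure_Ioc_ne_top (m j) _ _))) ?_
    rw [memLp_indicator_iff_restrict measurableSet_Ioc]
    exact ((h i).isScaleChange (hs i) (e i)).memLp _ _
  have hbound : ∀ n i (x : ∀ j, I j), |∑ k ∈ A n, c n k * ∏ j, Function.update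
      (fun j => (ρ n k j * η j) ∘ (Subtype.val : I j → ℝ)) i
      (fun z => deriv (ρ n k i * η i) z * invDensity (s i) z) j (x j)| ≤ B' i * W i x := by
    intro n i x
    have hk : ∀ (F : ∀ j, ℝ → ℝ) (G : ℝ → ℝ), (∏ j, Function.update
        (fun j => F j ∘ (Subtype.val : I j → ℝ)) i (fun z => G z * invDensity (s i) z) j (x j)) =
        invDensity (s i) (x i) * ∏ j, Function.update F i G j (x j) := by
      intro F G
      rw [prod_update_apply, prod_update_apply F i G fun j => (x j : ℝ)]
      simp only [Function.comp]
      ring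
    by_cases hx : ∀ j, x j ∈ Ioc (a j) (b j)
    · have hWx : W i x = invDensity (s i) (x i) := by
        simp only [hW]
        rw [prod_update_apply, indicator_of_mem (hx i),
          Finset.prod_eq_one fun j _ => indicator_of_mem (hx j) _, mul_one]
      have hK0 : 0 ≤ invDensity (s i) (x i) := ENNReal.toReal_nonneg
      have hsum : (∑ k ∈ A n, c n k * ∏ j, Function.update
          (fun j => (ρ n k j * η j) ∘ (Subtype.val : I j → ℝ)) i
          (fun z => deriv (ρ n k i * η i) z * invDensity (s i) z) j (x j)) =
          invDensity (s i) (x i) * ((∏ j, Function.update η i (deriv (η i)) j (x j)) *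
              ∑ k ∈ A n, c n k * ∏ j, ρ n k j (x j) +
            (∏ j, η j (x j)) *
              ∑ k ∈ A n, c n k * ∏ j, Function.update (ρ n k) i (deriv (ρ n k i)) j (x j)) := by
        rw [Finset.mul_sum, Finset.mul_sum, ← Finset.sum_add_distrib, Finset.mul_sum]
        refine Finset.sum_congr rfl fun k _ => ?_
        rw [hk (fun j => ρ n k j * η j), prod_update_mul_deriv i ((hρ n k i).differentiable (by simp))
          ((hη1 i).1.differentiable (by simp)) fun j => x j]
        ring
      obtain ⟨h1, h2⟩ := happ n (fun j => x j) (hxR x hx)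
      rw [hsum, hWx, abs_mul, abs_of_nonneg hK0, mul_comm]
      refine mul_le_mul_of_nonneg_right ((abs_add_le _ _).trans ?_) hK0
      rw [abs_mul, abs_mul, Finset.abs_prod, Finset.abs_prod]
      have hη0 : ∀ j t, |η j t| ≤ 1 := fun j t => by
        rw [abs_of_nonneg (hη2 j _).1]
        exact (hη2 j _).2
      have h3 : ∏ j, |Function.update η i (deriv (η i)) j (x j)| ≤ Cη i := by
        rw [← Finset.mul_prod_erase _ _ (Finset.mem_univ i), Function.update_self]
        calc _ ≤ Cη i * 1 := mul_le_mul (hCη i _) (Finset.prod_le_one (fun _ _ => abs_nonneg _)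
              fun j hj => by
                rw [Function.update_of_ne (Finset.ne_of_mem_erase hj)]
                exact hη0 j _) (Finset.prod_nonneg fun _ _ => abs_nonneg _)
              ((abs_nonneg _).trans (hCη i 0))
          _ = Cη i := mul_one _
      have h4 : |∑ k ∈ A n, c n k * ∏ j, ρ n k j (x j)| ≤ Cφ + 1 := by
        have h5 : (1 : ℝ) / (n + 1) ≤ 1 := by
          rw [div_le_one (by positivity)]
          linarith [(Nat.cast_nonneg n : (0 : ℝ) ≤ n)]
        have h6 : |φ fun j => x j| ≤ Cφ := hCφ _
        have h7 := abs_sub_abs_le_abs_sub (∑ k ∈ A n, c n k * ∏ j, ρ n k j (x j)) (φ fun j => x j)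
        linarith
      refine add_le_add (mul_le_mul h3 h4 (abs_nonneg _) ((abs_nonneg _).trans (hCη i 0))) ?_
      calc _ ≤ 1 * B := mul_le_mul (Finset.prod_le_one (fun _ _ => abs_nonneg _)
            fun j _ => hη0 j _) (h2 i) (abs_nonneg _) zero_le_one
        _ = B := one_mul _
    · push Not at hx
      obtain ⟨l, hl⟩ := hx
      have hWx : W i x = 0 := by
        refine Finset.prod_eq_zero (Finset.mem_univ l) ?_
        by_cases hli : l = i
        · subst hli
          rw [Function.update_self, indicator_of_notMem hl]
        · rw [Function.update_of_ne hli, indicator_of_notMem hl]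
      rw [hWx, mul_zero, Finset.sum_eq_zero, abs_zero]
      intro k _
      rw [hk (fun j => ρ n k j * η j), Finset.prod_eq_zero (Finset.mem_univ l), mul_zero, mul_zero]
      by_cases hli : l = i
      · subst hli
        rw [Function.update_self]
        exact image_eq_zero_of_notMem_tsupport fun h' =>
          hout x l hl (tsupport_mul_subset_right (tsupport_deriv_subset h'))
      · rw [Function.update_of_ne hli, Pi.mul_apply, image_eq_zero_of_notMem_tsupport (hout x l hl),
          mul_zero]
  -- Only boundedness of the energies is available, not their convergence; with convergence in `L²`
  -- it puts the limit into the domain.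
  refine L2Form.IsClosedForm.closureOf_subset _ (hq.closed.mem_closureOf_of_bounded hspanq hspan
    (C := ∑ i, 1 / 2 * ∫ x, (B' i * W i x) ^ 2
      ∂(Measure.pi (Function.update m i (scaleMeasure (acPart (s i) (e i)))))) (fun n => ?_) hlim)
  rw [hv]
  simp only
  rw [hq.form_sum_tens hsc (A n) (c n) (hf n) (fun k j => (hmem n k j).coeFn_toLp) (hfd n)]
  refine Finset.sum_le_sum fun i _ => mul_le_mul_of_nonneg_left ?_ (by norm_num)
  refine integral_mono_of_nonneg (Eventually.of_forall fun x => sq_nonneg _)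
    ((hWm i).const_mul (B' i)).integrable_sq (Eventually.of_forall fun x => ?_)
  exact sq_le_sq' (neg_le_of_abs_le (hbound n i x)) ((le_abs_self _).trans (hbound n i x))

end Product

end Diffusion

end

/-! ### Identification of the closure of the test functions -/

noncomputable section

namespace Diffusion

open scoped RealInnerProductSpace

/-- The squared distance expands into products of inner products of the factors, each of which
converges. -/
theorem tendsto_tens {ι : Type*} [Fintype ι] {S : ι → Type*} [∀ i, MeasurableSpace (S i)]
    {m : ∀ i, Measure (S i)} [∀ i, SigmaFinite (m i)] {v : ℕ → ∀ i, Lp ℝ 2 (m i)}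
    {f : ∀ i, Lp ℝ 2 (m i)} (h : ∀ i, Tendsto (fun n => v n i) atTop (𝓝 (f i))) :
    Tendsto (fun n => tens (v n)) atTop (𝓝 (tens f)) := by
  rw [tendsto_iff_norm_sub_tendsto_zero]
  have h1 : ∀ n, ‖tens (v n) - tens f‖ ^ 2 =
      ∏ i, ⟪v n i, v n i⟫ - 2 * ∏ i, ⟪v n i, f i⟫ + ∏ i, ⟪f i, f i⟫ := by
    intro n
    rw [@norm_sub_sq_real, ← real_inner_self_eq_norm_sq, ← real_inner_self_eq_norm_sq, inner_tens,
      inner_tens, inner_tens]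
  have h2 : Tendsto (fun n => ‖tens (v n) - tens f‖ ^ 2) atTop (𝓝 0) := by
    simp only [h1]
    have h3 := (((tendsto_finsetProd Finset.univ fun i _ => (h i).inner (𝕜 := ℝ) (h i)).sub
      ((tendsto_finsetProd Finset.univ fun i _ => (h i).inner (𝕜 := ℝ)
        (tendsto_const_nhds (x := f i))).const_mul 2)).add
      (tendsto_const_nhds (x := ∏ i, ⟪f i, f i⟫)))
    convert h3 using 2
    ring
  have h3 := h2.sqrt
  simpa [Real.sqrt_sq] using h3

theorem isTest_prod {d : ℕ} {I : Fin d → Set ℝ} {φ : Fin d → ℝ → ℝ} (h : ∀ i, IsTest (I i) (φ i)) :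
    IsTest (univ.pi I) fun x : Fin d → ℝ => ∏ i, φ i (x i) := by
  have hc : IsCompact (univ.pi fun i => tsupport (φ i)) := isCompact_univ_pi fun i => (h i).2.1
  have hsub : tsupport (fun x : Fin d → ℝ => ∏ i, φ i (x i)) ⊆ univ.pi fun i => tsupport (φ i) := by
    refine closure_minimal (fun x hx i _ => subset_tsupport _ ?_) hc.isClosed
    exact Finset.prod_ne_zero_iff.1 hx i (Finset.mem_univ i)
  refine ⟨contDiff_prod fun i _ => (h i).1.comp (contDiff_apply ℝ ℝ i),
    hc.of_isClosed_subset (isClosed_tsupport _) hsub, hsub.trans fun x hx i hi => (h i).2.2 (hx i hi)⟩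

section Interval

variable {I : Set ℝ} [Fact (IsOpen I)] [OrdConnected I] {m : Measure I} [IsLocallyFiniteMeasure m]
  [m.IsOpenPosMeasure]

/-- A test function on `I` that does not vanish in `L²`. -/
theorem exists_isTest_ne_zero (m : Measure I) [IsLocallyFiniteMeasure m] [m.IsOpenPosMeasure]
    (e : I) : ∃ η, IsTest I η ∧ ∃ v : Lp ℝ 2 m, (v =ᵐ[m] fun z => η z) ∧ v ≠ 0 := by
  obtain ⟨η, h1, -, h3⟩ := exists_isTest_eq_one (isCompact_singleton (x := (e : ℝ)))
    (Fact.out : IsOpen I) (singleton_subset_iff.2 e.2)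
  have hmem : MemLp (η ∘ (Subtype.val : I → ℝ)) 2 m :=
    memLp_comp_scale isScale_val (by rwa [Subtype.range_val])
  refine ⟨η, h1, hmem.toLp, hmem.coeFn_toLp, fun h0 => ?_⟩
  have h2 : η ∘ (Subtype.val : I → ℝ) =ᵐ[m] fun _ => 0 := by
    refine hmem.coeFn_toLp.symm.trans ?_
    rw [h0]
    exact Lp.coeFn_zero _ _ _
  have h4 := ((h1.1.continuous.comp continuous_subtype_val).ae_eq_iff_eq m continuous_const).1 h2
  have h5 := congrFun h4 e
  rw [Function.comp, h3 _ rfl] at h5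
  exact one_ne_zero h5

-- An element of the domain has a continuous representative, and this must be the test function
-- itself because `m` has full support.
omit [IsLocallyFiniteMeasure m] in
theorem hasSmoothDomain_of_mem {s : I → ℝ} (hs : IsScale s)
    (h : ∀ φ : ℝ → ℝ, IsTest I φ → ∃ f ∈ (fullScaleForm s m).dom, f =ᵐ[m] fun z => φ z) :
    HasSmoothDomain s := by
  intro φ hφ
  obtain ⟨f, ⟨w, u, hu, hw⟩, hf⟩ := h φ hφ
  have heq : u = fun z : I => φ z := ((hw.continuous hs).ae_eq_iff_eq m
    (hφ.1.continuous.comp continuous_subtype_val)).1 (hu.symm.trans hf)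
  rw [heq] at hw
  exact ⟨w, hw⟩

/-- If `ds` charges the complement of `regSet s`, some function of the minimal domain has a
derivative that does not vanish there. -/
theorem exists_deriv_pos {s : I → ℝ} (hs : IsScale s) (hN : scaleMeasure s (regSet s)ᶜ ≠ 0) :
    ∃ f ∈ (minimalScaleForm s m).dom, ∃ u w : I → ℝ, f =ᵐ[m] u ∧ IsScaleDeriv s u w ∧
      0 < ∫ z, (regSet s)ᶜ.indicator w z * (regSet s)ᶜ.indicator w z ∂(scaleMeasure s) := by
  have hlf := isLocallyFiniteMeasure_scaleMeasure hs
  obtain ⟨a, b, hab⟩ : ∃ a b : I, scaleMeasure s ((regSet s)ᶜ ∩ Ioc a b) ≠ 0 := by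
    by_contra! h
    rcases isEmpty_or_nonempty I with he | hne
    · exact hN (by rw [Measure.eq_zero_of_isEmpty (scaleMeasure s)]; rfl)
    obtain ⟨f, hf, hcov⟩ := exists_seq_Ioc (I := I)
    refine hN ?_
    rw [← inter_univ (regSet s)ᶜ, ← hcov, inter_iUnion, measure_iUnion_null_iff]
    intro n
    obtain ⟨a, b, hab⟩ := hf n
    rw [hab]
    exact h a b
  obtain ⟨a', ha⟩ := exists_lt a
  obtain ⟨b', hb⟩ := exists_gt b
  -- A smooth function of `s` equal to `s` around `[a, b]`; its derivative with respect to `s` is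
  -- one on `(a, b]`, including the singular part.
  obtain ⟨φ, hφ, hφ'⟩ := exists_isTest_eq_self hs.isOpen_range (hs.Icc_subset_range a' b')
  have hmem := memLp_comp_scale (m := m) hs hφ
  have hd := hs.isScaleChange_self.isScaleDeriv_comp hφ
  have hd1 : ∀ z ∈ Ioc a b, deriv φ (s z) = 1 := by
    intro z hz
    have : φ =ᶠ[𝓝 (s z)] id := by
      filter_upwards [Icc_mem_nhds (hs.2 (ha.trans hz.1)) (hs.2 (hz.2.trans_lt hb))] with t ht
      exact hφ' t ht
    rw [this.deriv_eq, deriv_id]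
  refine ⟨hmem.toLp, toL2_scaleTests_subset_minimal hs ⟨_, ⟨φ, hφ, rfl⟩, hmem.coeFn_toLp⟩, _, _,
    hmem.coeFn_toLp, hd, ?_⟩
  have hR := (measurableSet_regSet s).compl
  have hint := (hd.1.indicator hR).integrable_mul (hd.1.indicator hR)
  refine (integral_pos_iff_support_of_nonneg (fun z => mul_self_nonneg _) hint).2 ?_
  refine (pos_iff_ne_zero.2 hab).trans_le (measure_mono fun z hz => ?_)
  rw [Function.mem_support, indicator_of_mem hz.1, hd1 z hz.2]
  norm_num

end Interval

section Product

variable {d : ℕ} {I : Fin d → Set ℝ} [∀ i, Fact (IsOpen (I i))] [∀ i, OrdConnected (I i)]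
  {m : ∀ i, Measure (I i)} [∀ i, IsLocallyFiniteMeasure (m i)] [∀ i, (m i).IsOpenPosMeasure]
  {s : ∀ i, I i → ℝ}

/-- The classes in `L²` of the test functions on the box, as a linear space. -/
def smoothBoxSubmodule (m : ∀ i, Measure (I i)) : Submodule ℝ (Lp ℝ 2 (Measure.pi m)) where
  carrier := toL2 (Measure.pi m) (smoothBox I)
  zero_mem' := ⟨_, ⟨0, IsTest.zero, rfl⟩, Lp.coeFn_zero _ _ _⟩
  add_mem' := by
    rintro u v ⟨_, ⟨φ, hφ, rfl⟩, hu⟩ ⟨_, ⟨ψ, hψ, rfl⟩, hv⟩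
    exact ⟨_, ⟨φ + ψ, hφ.add hψ, rfl⟩, (Lp.coeFn_add u v).trans (hu.add hv)⟩
  smul_mem' := by
    rintro c u ⟨_, ⟨φ, hφ, rfl⟩, hu⟩
    exact ⟨_, ⟨c • φ, hφ.const_smul c, rfl⟩, (Lp.coeFn_smul c u).trans (hu.const_smul c)⟩

/-- The products of functions in the minimal domains of the absolutely continuous parts are limits
of test functions on the box. -/
theorem IsCartesianForm.tensors_subset_closureOf (hs : ∀ i, IsScale (s i))
    (h : ∀ i, HasSmoothDomain (s i)) (e : ∀ i, I i) {q : L2Form (Measure.pi m)}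
    (hq : IsCartesianForm q fun i => minimalScaleForm (s i) (m i))
    (hcl : ∀ i, (minimalScaleForm (s i) (m i)).IsClosedForm)
    (hmin : ∀ i, ∀ φ : ℝ → ℝ, IsTest (I i) φ → ∀ f : Lp ℝ 2 (m i), (f =ᵐ[m i] fun z => φ z) →
      f ∈ (minimalScaleForm (s i) (m i)).dom)
    (hC : toL2 (Measure.pi m) (smoothBox I) ⊆ q.dom) :
    tensors (fun i => minimalScaleForm (acPart (s i) (e i)) (m i)) ⊆
      (q.closureOf (toL2 (Measure.pi m) (smoothBox I))).dom := by
  intro u hu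
  obtain ⟨f, hf, rfl⟩ := mem_tensors.1 hu
  have hsc := fun i => (h i).isScale_acPart (hs i) (e i)
  have hfp := fun i => (h i).minimalScaleForm_subset (hs i) (e i) (hmin i) (hf i)
  have hpos : ∀ n : ℕ, (0 : ℝ) < 1 / (n + 1) := fun n => by positivity
  choose φ hφ v hv hlt using fun (n : ℕ) i => (h i).exists_test_lt (hs i) (e i) (hf i) (hpos n)
  have hvp : ∀ n i, v n i ∈ (minimalScaleForm (s i) (m i)).dom := fun n i =>
    hmin i _ (hφ n i) _ (hv n i)
  have hen : ∀ i, Tendsto (fun n => (minimalScaleForm (s i) (m i)).energyOne (f i - v n i)) atTop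
      (𝓝 0) := by
    intro i
    refine squeeze_zero (fun n => (hcl i).energyOne_nonneg ((hcl i).sub_mem (hfp i) (hvp n i)))
      (fun n => ?_) tendsto_one_div_add_atTop_nhds_zero_nat
    have hd := fullScaleForm_sub_mem (hsc i) (hf i).1
      ((h i).mem_minimalScaleForm (hs i) (e i) (hφ n i) (hv n i)).1
    refine le_of_eq_of_le ?_ (hlt n i).le
    change (fullScaleForm (s i) (m i)).energyOne _ = _
    rw [L2Form.energyOne, fullScaleForm_acPart_form (hs i) (hsc i) hd hd, L2Form.energyOne]
  have hL2 : ∀ i, Tendsto (fun n => v n i) atTop (𝓝 (f i)) := fun i =>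
    (hcl i).tendsto_of_energyOne (fun n => hvp n i) (hfp i) (hen i)
  -- The product formula expresses the energies of the tensors by energies and inner products in the
  -- factors, which converge; in particular they are bounded.
  have hform : Tendsto (fun n => q.form (tens (v n)) (tens (v n))) atTop
      (𝓝 (q.form (tens f) (tens f))) := by
    have h1 : ∀ g : ∀ i, Lp ℝ 2 (m i), (∀ i, g i ∈ (minimalScaleForm (s i) (m i)).dom) →
        q.form (tens g) (tens g) = ∑ i, (minimalScaleForm (s i) (m i)).form (g i) (g i) *
          ∏ j ∈ Finset.univ.erase i, ⟪g j, g j⟫ := by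
      intro g hg
      rw [hq.form_tensors g g hg hg _ _ (coeFn_tens g) (coeFn_tens g)]
      simp only [l2_inner]
    rw [h1 f hfp]
    simp only [h1 _ (hvp _)]
    refine tendsto_finsetSum _ fun i _ => ((hcl i).tendsto_form (fun n => hvp n i)
      (fun n => hvp n i) (hfp i) (hfp i) (hen i) (hen i)).mul ?_
    exact tendsto_finsetProd _ fun j _ => (hL2 j).inner (𝕜 := ℝ) (hL2 j)
  obtain ⟨C, hCb⟩ := hform.bddAbove_range
  refine hq.closed.mem_closureOf_of_bounded (M := smoothBoxSubmodule m) (v := fun n => tens (v n)) hC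
    (fun n => ?_) (fun n => hCb ⟨n, rfl⟩) (tendsto_tens hL2)
  exact ⟨_, ⟨_, isTest_prod (hφ n), rfl⟩, (coeFn_tens _).trans (prod_congr_ae (hv n))⟩

/-- The closure of the test functions on the box is the Cartesian product of the minimal forms of
the absolutely continuous parts. -/
theorem IsCartesianForm.closureOf_smoothBox (hs : ∀ i, IsScale (s i))
    (h : ∀ i, HasSmoothDomain (s i)) (e : ∀ i, I i) {q : L2Form (Measure.pi m)}
    (hq : IsCartesianForm q fun i => minimalScaleForm (s i) (m i))
    (hcl : ∀ i, (minimalScaleForm (s i) (m i)).IsClosedForm)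
    (hmin : ∀ i, ∀ φ : ℝ → ℝ, IsTest (I i) φ → ∀ f : Lp ℝ 2 (m i), (f =ᵐ[m i] fun z => φ z) →
      f ∈ (minimalScaleForm (s i) (m i)).dom)
    (hC : toL2 (Measure.pi m) (smoothBox I) ⊆ q.dom) :
    IsCartesianForm (q.closureOf (toL2 (Measure.pi m) (smoothBox I)))
      fun i => minimalScaleForm (acPart (s i) (e i)) (m i) := by
  have hsc := fun i => (h i).isScale_acPart (hs i) (e i)
  have hsub := fun i => (h i).minimalScaleForm_subset (hs i) (e i) (hmin i)
  have hr := hq.restrict hsub fun i f hf g hg =>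
    (fullScaleForm_acPart_form (hs i) (hsc i) hf.1 hg.1).symm
  have hspan : (Submodule.span ℝ (tensors fun i => minimalScaleForm (acPart (s i) (e i)) (m i)) :
      Set (Lp ℝ 2 (Measure.pi m))) ⊆ q.dom := by
    refine (Submodule.span_le (p := hq.closed.domain)).2 ?_
    rintro u ⟨f, hf, hu⟩
    exact hq.tensors_subset ⟨f, fun i => hsub i (hf i), hu⟩
  have hcl' : (q.closureOf (smoothBoxSubmodule m : Set (Lp ℝ 2 (Measure.pi m)))).IsClosedForm :=
    hq.closed.isClosedForm_closureOf hC
  have hdom : (q.closureOf (toL2 (Measure.pi m) (smoothBox I))).dom =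
      (q.closureOf (Submodule.span ℝ (tensors fun i =>
        minimalScaleForm (acPart (s i) (e i)) (m i)) : Set (Lp ℝ 2 (Measure.pi m)))).dom :=
    -- One inclusion is the grid approximation of test functions on the box, the other the
    -- approximation of tensors by products of test functions.
    Subset.antisymm
      (hq.closed.closureOf_closureOf hspan (hr.smoothBox_subset hs h e))
      (hq.closed.closureOf_closureOf hC ((Submodule.span_le (p := hcl'.domain)).2
        (hq.tensors_subset_closureOf hs h e hcl hmin hC)))
  have heq : q.closureOf (toL2 (Measure.pi m) (smoothBox I)) =
      q.closureOf (Submodule.span ℝ (tensors fun i =>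
        minimalScaleForm (acPart (s i) (e i)) (m i)) : Set (Lp ℝ 2 (Measure.pi m))) := by
    have h1 : ∀ {r r' : L2Form (Measure.pi m)}, r.dom = r'.dom → r.form = r'.form → r = r' := by
      rintro ⟨_, _⟩ ⟨_, _⟩ rfl rfl
      rfl
    exact h1 hdom rfl
  rw [heq]
  exact hr

/-- If the span of the products of functions in the minimal domains of the absolutely continuous
parts is dense, then the scales have no singular part. -/
theorem IsCartesianForm.regSet_compl_eq_zero (hs : ∀ i, IsScale (s i))
    (h : ∀ i, HasSmoothDomain (s i)) (e : ∀ i, I i) {q : L2Form (Measure.pi m)}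
    (hq : IsCartesianForm q fun i => minimalScaleForm (s i) (m i))
    (hmin : ∀ i, ∀ φ : ℝ → ℝ, IsTest (I i) φ → ∀ f : Lp ℝ 2 (m i), (f =ᵐ[m i] fun z => φ z) →
      f ∈ (minimalScaleForm (s i) (m i)).dom)
    (hdense : ∀ u ∈ q.dom, u ∈ (q.closureOf (Submodule.span ℝ (tensors fun i =>
      minimalScaleForm (acPart (s i) (e i)) (m i)) : Set (Lp ℝ 2 (Measure.pi m)))).dom) (i : Fin d) :
    scaleMeasure (s i) (regSet (s i))ᶜ = 0 := by
  by_contra hN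
  have hsc := fun i => (h i).isScale_acPart (hs i) (e i)
  have hsub := fun i => (h i).minimalScaleForm_subset (hs i) (e i) (hmin i)
  obtain ⟨f₀, hf₀, u₀, w₀, hu₀, hw₀, hpos⟩ := exists_deriv_pos (m := m i) (hs i) hN
  choose η hη v hv hv0 using fun j => exists_isTest_ne_zero (m j) (e j)
  -- The tensor to be separated from the span: its `i`-th factor has a derivative that does not
  -- vanish on the singular set, and the other factors are arbitrary nonzero test functions.
  set f : ∀ j, Lp ℝ 2 (m j) := Function.update v i f₀ with hfdef
  have hfi : f i = f₀ := Function.update_self _ _ _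
  have hfj : ∀ j, j ≠ i → f j = v j := fun j hj => Function.update_of_ne hj _ _
  have hf : ∀ j, f j ∈ (minimalScaleForm (s j) (m j)).dom := by
    intro j
    by_cases hj : j = i
    · subst hj
      rwa [hfi]
    · rw [hfj j hj]
      exact hmin j _ (hη j) _ (hv j)
  have hrep : ∀ j, ∃ u w : I j → ℝ, f j =ᵐ[m j] u ∧ IsScaleDeriv (s j) u w ∧
      (∀ hj : j = i, hj ▸ w = w₀) := by
    intro j
    by_cases hj : j = i
    · subst hj
      exact ⟨u₀, w₀, by rwa [hfi], hw₀, fun _ => rfl⟩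
    · obtain ⟨w, u, hu, hw⟩ := (hf j).1
      exact ⟨u, w, hu, hw, fun hj' => absurd hj' hj⟩
  choose u w hu hw hwi using hrep
  have hwi' : w i = w₀ := hwi i rfl
  -- The part of the `i`-th energy of this tensor that lives on the singular set. It will be a lower
  -- bound for the energy of the difference with any element of the span.
  set K : ℝ := 1 / 2 * ((∫ z, (regSet (s i))ᶜ.indicator (w i) z * (regSet (s i))ᶜ.indicator (w i) z
    ∂(scaleMeasure (s i))) * ∏ j ∈ Finset.univ.erase i, ∫ z, u j z * u j z ∂(m j)) with hK
  have hKpos : 0 < K := by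
    rw [hK, hwi']
    refine mul_pos (by norm_num) (mul_pos hpos (Finset.prod_pos fun j hj => ?_))
    have h1 : ∫ z, u j z * u j z ∂(m j) = ‖f j‖ ^ 2 := by
      rw [l2_norm_sq]
      refine integral_congr_ae ?_
      filter_upwards [hu j] with z hz
      rw [hz, sq]
    rw [h1, hfj j (Finset.ne_of_mem_erase hj)]
    exact pow_pos (norm_pos_iff.2 (hv0 j)) 2
  have htens : tens f ∈ q.dom := hq.tensors_subset (mem_tensors.2 ⟨f, hf, rfl⟩)
  have hspan : (Submodule.span ℝ (tensors fun i => minimalScaleForm (acPart (s i) (e i)) (m i)) :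
      Set (Lp ℝ 2 (Measure.pi m))) ⊆ q.dom := by
    refine (Submodule.span_le (p := hq.closed.domain)).2 ?_
    rintro u ⟨f, hf, hu⟩
    exact hq.tensors_subset ⟨f, fun i => hsub i (hf i), hu⟩
  obtain ⟨-, happ⟩ := (hq.closed.mem_closureOf_iff hspan).1 (hdense _ htens)
  obtain ⟨g, hg, hlt⟩ := happ K hKpos
  obtain ⟨n, c, t, rfl⟩ := Submodule.mem_span_set'.1 hg
  choose F hF hFt using fun a => mem_tensors.1 (t a).2
  choose wb ub hub hwb using fun a j => (hF a j).1
  -- The difference is written as one linear combination of tensors: `none` carries the tensor `tens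
  -- f`, the other indices carry the approximants.
  set κ := Option (Fin n)
  set cc : κ → ℝ := fun a => a.elim 1 fun a => -c a with hcc
  set ff : κ → ∀ j, Lp ℝ 2 (m j) := fun a => a.elim f F with hff
  set uu : κ → ∀ j, I j → ℝ := fun a => a.elim u ub with huu
  set ww : κ → ∀ j, I j → ℝ := fun a => a.elim w fun a j => (regSet (s j)).indicator (wb a j) with hww
  have hsum : tens f - ∑ a, c a • (t a : Lp ℝ 2 (Measure.pi m)) =
      ∑ a : κ, cc a • tens (ff a) := by
    rw [Fintype.sum_option]
    simp only [hcc, hff, Option.elim, one_smul, neg_smul, Finset.sum_neg_distrib, ← hFt]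
    rw [sub_eq_add_neg]
  have hform := hq.form_sum_tens hs Finset.univ cc (f := ff) (u := uu) (w := ww)
    (by
      rintro (_ | a) j
      · exact hf j
      · exact hsub j (hF a j))
    (by
      rintro (_ | a) j
      · exact hu j
      · exact hub a j)
    (by
      rintro (_ | a) j
      · exact hw j
      · exact (hwb a j).of_acPart (hs j) (hsc j))
  rw [← hsum] at hform
  have hle : K ≤ q.form (tens f - ∑ a, c a • (t a : Lp ℝ 2 (Measure.pi m)))
      (tens f - ∑ a, c a • (t a : Lp ℝ 2 (Measure.pi m))) := by
    rw [hform]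
    refine le_trans ?_ (Finset.single_le_sum (f := fun i => 1 / 2 * ∫ x, (∑ a : κ, cc a *
        ∏ j, Function.update (uu a) i (ww a i) j (x j)) ^ 2
        ∂(Measure.pi (Function.update m i (scaleMeasure (s i)))))
      (fun i _ => mul_nonneg (by norm_num) (integral_nonneg fun x => sq_nonneg _))
      (Finset.mem_univ i))
    rw [hK, ← integral_prod_update hs]
    refine mul_le_mul_of_nonneg_left ?_ (by norm_num)
    have hum : ∀ (a : κ) j, MemLp (uu a j) 2 (m j) := by
      rintro (_ | a) j
      · exact (memLp_congr_ae (hu j)).1 (Lp.memLp _)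
      · exact (memLp_congr_ae (hub a j)).1 (Lp.memLp _)
    have hwm : ∀ (a : κ) j, MemLp (ww a j) 2 (scaleMeasure (s j)) := by
      rintro (_ | a) j
      · exact (hw j).1
      · exact ((hwb a j).of_acPart (hs j) (hsc j)).1
    refine integral_mono_of_nonneg (Eventually.of_forall fun x => mul_self_nonneg _) ?_
      (Eventually.of_forall fun x => ?_)
    · have : MemLp (fun x => ∑ a : κ, cc a * ∏ j, Function.update (uu a) i (ww a i) j (x j)) 2
          (Measure.pi (Function.update m i (scaleMeasure (s i)))) :=
        memLp_finsetSum _ fun a _ =>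
          (memLp_prod_update hs i (hum a) (hwm a i)).const_mul (cc a)
      exact this.integrable_sq
    · simp only
      -- Over the singular set the `i`-th derivatives of the approximants vanish, so they cannot
      -- cancel that of `f`; elsewhere the integrand of the lower bound is zero.
      by_cases hx : x i ∈ (regSet (s i))ᶜ
      · have h1 : ∑ a : κ, cc a * ∏ j, Function.update (uu a) i (ww a i) j (x j) =
            ∏ j, Function.update u i ((regSet (s i))ᶜ.indicator (w i)) j (x j) := by
          rw [Fintype.sum_option, Finset.sum_eq_zero fun a _ => ?_, add_zero]
          · simp only [hcc, huu, hww, Option.elim, one_mul]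
            rw [prod_update_apply, prod_update_apply, indicator_of_mem hx]
          · rw [prod_update_apply]
            simp only [hww, Option.elim]
            rw [indicator_of_notMem hx, zero_mul, mul_zero]
        rw [h1, sq]
      · rw [prod_update_apply, indicator_of_notMem hx, zero_mul, zero_mul]
        exact sq_nonneg _
  have h1 := L2Form.IsClosedForm.form_le_energyOne (q := q) (tens f - ∑ a, c a • (t a : Lp ℝ 2 (Measure.pi m)))
  linarith

end Product

end Diffusion

end

/-! ### The special standard core property of the test functions -/

noncomputable section

namespace Diffusion

section Box

variable {d : ℕ} {I : Fin d → Set ℝ}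

/-- The inclusion of a box in the Euclidean space. -/
def boxIncl (I : Fin d → Set ℝ) (x : ∀ i, I i) (i : Fin d) : ℝ := x i

theorem continuous_boxIncl : Continuous (boxIncl I) := by
  unfold boxIncl
  fun_prop

theorem range_boxIncl : range (boxIncl I) = univ.pi I := by
  ext y
  constructor
  · rintro ⟨x, rfl⟩ i -
    exact (x i).2
  · intro hy
    exact ⟨fun i => ⟨y i, hy i (mem_univ i)⟩, rfl⟩

theorem isOpenEmbedding_boxIncl (hI : ∀ i, IsOpen (I i)) : IsOpenEmbedding (boxIncl I) := by
  refine ⟨(IsEmbedding.piMap fun i => IsEmbedding.subtypeVal (p := (· ∈ I i))), ?_⟩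
  rw [range_boxIncl]
  exact isOpen_set_pi finite_univ fun i _ => hI i

variable (hI : ∀ i, IsOpen (I i))
include hI

theorem continuous_of_mem_smoothBox {f : (∀ i, I i) → ℝ} (hf : f ∈ smoothBox I) :
    Continuous f ∧ HasCompactSupport f := by
  obtain ⟨φ, hφ, rfl⟩ := hf
  refine ⟨hφ.1.continuous.comp continuous_boxIncl, ?_⟩
  have hc : IsCompact (boxIncl I ⁻¹' tsupport φ) :=
    (isOpenEmbedding_boxIncl hI).isInducing.isCompact_preimage_iff
      (hφ.2.2.trans_eq range_boxIncl.symm) |>.2 hφ.2.1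
  refine HasCompactSupport.intro hc fun x hx => ?_
  exact image_eq_zero_of_notMem_tsupport (f := φ) hx

omit hI in
theorem smoothBox_mul_mem {f g : (∀ i, I i) → ℝ} (hf : f ∈ smoothBox I) (hg : g ∈ smoothBox I) :
    f * g ∈ smoothBox I := by
  obtain ⟨φ, hφ, rfl⟩ := hf
  obtain ⟨ψ, hψ, rfl⟩ := hg
  exact ⟨φ * ψ, hψ.mul_left hφ.1, rfl⟩

/-- Extension by zero from the open box stays continuous because the support is compact, and a
smooth uniform approximation on the whole space can be chosen to vanish wherever the extension does.
-/
theorem smoothBox_dense_uniform {h : (∀ i, I i) → ℝ} (hc : Continuous h) (hs : HasCompactSupport h)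
    {ε : ℝ} (hε : 0 < ε) : ∃ f ∈ smoothBox I, ∀ x, |h x - f x| ≤ ε := by
  have ho := isOpenEmbedding_boxIncl hI
  set H : (Fin d → ℝ) → ℝ := Function.extend (boxIncl I) h 0 with hH
  have hHι : ∀ x, H (boxIncl I x) = h x := fun x => ho.injective.extend_apply h 0 x
  have hK : IsCompact (boxIncl I '' tsupport h) := hs.isCompact.image continuous_boxIncl
  have hsupp : Function.support H ⊆ boxIncl I '' tsupport h := by
    intro y hy
    by_cases hy' : y ∈ range (boxIncl I)
    · obtain ⟨x, rfl⟩ := hy'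
      refine ⟨x, subset_tsupport h ?_, rfl⟩
      rwa [Function.mem_support, hHι] at hy
    · rw [Function.mem_support, hH, Function.extend_apply' _ _ _ hy'] at hy
      exact absurd rfl hy
  have hts : tsupport H ⊆ boxIncl I '' tsupport h := closure_minimal hsupp hK.isClosed
  have hHc : Continuous H := by
    refine continuous_of_tsupport fun y hy => ?_
    obtain ⟨x, -, rfl⟩ := hts hy
    rw [← ho.continuousAt_iff]
    have : H ∘ boxIncl I = h := funext hHι
    rw [this]
    exact hc.continuousAt
  obtain ⟨g, hg1, hg2, hg3⟩ := hHc.exists_contDiff_approx ⊤ (ε := fun _ => ε) continuous_const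
    fun _ => hε
  have hgs : tsupport g ⊆ boxIncl I '' tsupport h := closure_minimal (hg3.trans hsupp) hK.isClosed
  refine ⟨_, ⟨g, ⟨hg1, hK.of_isClosed_subset (isClosed_tsupport g) hgs, hgs.trans ?_⟩, rfl⟩,
    fun x => ?_⟩
  · rw [← range_boxIncl]
    exact image_subset_range _ _
  · have := hg2 (boxIncl I x)
    rw [hHι, dist_comm, Real.dist_eq] at this
    exact this.le

theorem smoothBox_cutoff {K G : Set (∀ i, I i)} (hK : IsCompact K) (hG : IsOpen G) (hKG : K ⊆ G) :
    ∃ f ∈ smoothBox I, (∀ x, 0 ≤ f x) ∧ (∀ x ∈ K, f x = 1) ∧ ∀ x ∉ G, f x = 0 := by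
  have ho := isOpenEmbedding_boxIncl hI
  obtain ⟨φ, h1, h2, h3⟩ := exists_isTest_eq_one (hK.image continuous_boxIncl)
    (ho.isOpenMap G hG) (image_mono hKG)
  refine ⟨_, ⟨φ, h1.mono ?_, rfl⟩, fun x => (h2 _).1, fun x hx => h3 _ ⟨x, hx, rfl⟩, fun x hx => ?_⟩
  · rw [← range_boxIncl]
    exact image_subset_range _ _
  · refine h1.eq_zero (x := boxIncl I x) ?_
    rintro ⟨y, hy, hyx⟩
    exact hx (ho.injective hyx ▸ hy)

end Box

/-- Smooth approximate unit contractions. -/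
theorem exists_smooth_contraction {ε : ℝ} (hε : 0 < ε) : ∃ φ : ℝ → ℝ,
    ContDiff ℝ ((⊤ : ℕ∞) : WithTop ℕ∞) φ ∧ (∀ t ∈ Icc (0 : ℝ) 1, φ t = t) ∧
    (∀ t, φ t ∈ Icc (-ε) (1 + ε)) ∧
    ∀ t t', t < t' → 0 ≤ φ t' - φ t ∧ φ t' - φ t ≤ t' - t := by
  obtain ⟨χ, h1, h2, h3⟩ := exists_isTest_eq_one (isCompact_Icc (a := (0 : ℝ)) (b := 1))
    (isOpen_Ioo (a := -ε) (b := 1 + ε)) (fun t ht => ⟨by linarith [ht.1], by linarith [ht.2]⟩)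
  have hc := h1.1.continuous
  have hi : ∀ a b, IntervalIntegrable χ volume a b := fun a b => hc.intervalIntegrable a b
  -- Primitive of a bump with values in `[0, 1]`, equal to one on `[0, 1]` and zero outside `(-ε, 1
  -- + ε)`. It is increasing and `1`-Lipschitz, the identity on `[0, 1]`, and exceeds this range by
  -- at most `ε` on each side.
  set φ : ℝ → ℝ := fun t => ∫ r in (0 : ℝ)..t, χ r with hφ
  have hd : ∀ t, HasDerivAt φ (χ t) t := fun t => (hc.integral_hasStrictDerivAt 0 t).hasDerivAt
  have hderiv : deriv φ = χ := funext fun t => (hd t).deriv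
  have hsub : ∀ t t', φ t' - φ t = ∫ r in t..t', χ r := fun t t' =>
    intervalIntegral.integral_interval_sub_left (hi _ _) (hi _ _)
  have hinc : ∀ t t', t ≤ t' → 0 ≤ φ t' - φ t ∧ φ t' - φ t ≤ t' - t := by
    intro t t' htt
    rw [hsub]
    refine ⟨intervalIntegral.integral_nonneg htt fun r _ => (h2 r).1, ?_⟩
    have := intervalIntegral.integral_mono_on htt (hi t t')
      (intervalIntegrable_const (c := (1 : ℝ))) fun r _ => (h2 r).2
    simpa using this
  have hzero : ∀ t t', t ≤ t' → (∀ r ∈ Icc t t', χ r = 0) → φ t' - φ t = 0 := by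
    intro t t' htt hr
    rw [hsub, ← intervalIntegral.integral_zero (a := t) (b := t') (μ := volume)]
    refine intervalIntegral.integral_congr fun r hr' => hr r ?_
    rwa [uIcc_of_le htt] at hr'
  have h0 : φ 0 = 0 := intervalIntegral.integral_same
  refine ⟨φ, ?_, fun t ht => ?_, fun t => ⟨?_, ?_⟩, fun t t' h => hinc t t' h.le⟩
  · rw [contDiff_infty_iff_deriv, hderiv]
    exact ⟨fun t => (hd t).differentiableAt, h1.1⟩
  · have h4 : φ t = ∫ _r in (0 : ℝ)..t, (1 : ℝ) :=
      intervalIntegral.integral_congr fun r hr => by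
        rw [uIcc_of_le ht.1] at hr
        exact h3 r ⟨hr.1, hr.2.trans ht.2⟩
    rw [h4]
    simp
  · rcases le_total 0 t with h | h
    · linarith [(hinc 0 t h).1]
    · rcases le_total (-ε) t with h' | h'
      · linarith [(hinc t 0 h).2]
      · have h5 := hzero t (-ε) h' fun r hr => h1.eq_zero fun h => absurd h.1 (not_lt.2 hr.2)
        linarith [(hinc (-ε) 0 (by linarith)).2]
  · rcases le_total t 0 with h | h
    · linarith [(hinc t 0 h).1]
    · rcases le_total t (1 + ε) with h' | h'
      · linarith [(hinc 0 t h).2]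
      · have h5 := hzero (1 + ε) t h' fun r hr => h1.eq_zero fun h => absurd h.2 (not_lt.2 hr.1)
        linarith [(hinc 0 (1 + ε) (by linarith)).2]

theorem IsTest.comp_left {V : Type*} [NormedAddCommGroup V] [NormedSpace ℝ V] {U : Set V}
    {φ : V → ℝ} {ψ : ℝ → ℝ} (h : IsTest U φ) (hψ : ContDiff ℝ ((⊤ : ℕ∞) : WithTop ℕ∞) ψ)
    (h0 : ψ 0 = 0) : IsTest U (ψ ∘ φ) :=
  ⟨hψ.comp h.1, h.2.1.comp_left h0, (closure_mono (Function.support_comp_subset h0 φ)).trans h.2.2⟩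

/-- Only the `ℰ₁`-density depends on the form; the other properties hold for test functions on any
open box. -/
theorem isSpecialStandardCore_smoothBox {d : ℕ} {I : Fin d → Set ℝ} (hI : ∀ i, IsOpen (I i))
    {m : ∀ i, Measure (I i)} [∀ i, IsLocallyFiniteMeasure (m i)] {q : L2Form (Measure.pi m)}
    (hC : toL2 (Measure.pi m) (smoothBox I) ⊆ q.dom)
    (hdense : ∀ u ∈ q.dom, u ∈ (q.closureOf (toL2 (Measure.pi m) (smoothBox I))).dom) :
    q.IsSpecialStandardCore (smoothBox I) where
  subset_continuous f hf := continuous_of_mem_smoothBox hI hf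
  subset_dom f hf := by
    have := fun i => (hI i).locallyCompactSpace
    obtain ⟨h1, h2⟩ := continuous_of_mem_smoothBox hI hf
    have hmem : MemLp f 2 (Measure.pi m) := h1.memLp_of_hasCompactSupport h2
    exact ⟨hmem.toLp, hC ⟨f, hf, hmem.coeFn_toLp⟩, hmem.coeFn_toLp⟩
  dense_dom := hdense
  dense_uniform h hc hs ε hε := smoothBox_dense_uniform hI hc hs hε
  add_mem := by
    rintro _ ⟨φ, hφ, rfl⟩ _ ⟨ψ, hψ, rfl⟩
    exact ⟨φ + ψ, hφ.add hψ, rfl⟩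
  smul_mem := by
    rintro c _ ⟨φ, hφ, rfl⟩
    exact ⟨c • φ, hφ.const_smul c, rfl⟩
  mul_mem f hf g hg := smoothBox_mul_mem hf hg
  contraction ε hε := by
    obtain ⟨φ, h1, h2, h3, h4⟩ := exists_smooth_contraction hε
    refine ⟨φ, h2, h3, h4, ?_⟩
    rintro _ ⟨ψ, hψ, rfl⟩
    exact ⟨φ ∘ ψ, hψ.comp_left h1 (h2 0 ⟨le_rfl, zero_le_one⟩), rfl⟩
  cutoff K G hK hG _ hKG := smoothBox_cutoff hI hK hG hKG

end Diffusion

end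

/-! ### Minimal diffusions, and the theorem -/

noncomputable section

namespace Diffusion

section Diffusions

variable {d : ℕ} {I : Fin d → Set ℝ} [∀ i, Fact (IsOpen (I i))] [∀ i, OrdConnected (I i)]
  {m : ∀ i, Measure (I i)} [∀ i, IsLocallyFiniteMeasure (m i)]
  {s : ∀ i, I i → ℝ} {X : ∀ i, KilledProcess (I i)}

omit [∀ i, OrdConnected (I i)] in
/-- The Dirichlet form of the Cartesian product of minimal diffusions. -/
theorem isCartesianForm_cartesian (hX : ∀ i, IsMinimalDiffusion (X i) (s i) (m i)) :
    IsCartesianForm ((KilledProcess.cartesian X).dirichletForm (Measure.pi m))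
      fun i => minimalScaleForm (s i) (m i) := by
  have hT := fun i => KilledProcess.isSymmSemigroup (hX i).1 (hX i).2.1
  have hP := KilledProcess.cartesian_isSymmSemigroup (fun i => (hX i).1) (fun i => (hX i).2.1) hT
  rw [KilledProcess.cartesian_dirichletForm_eq (fun i => (hX i).1) fun i => (hX i).2.1]
  refine (isCartesianForm_of_semigroup hT hP (KilledProcess.cartesianSemigroup_tens _ _)).congr
    fun i => ?_
  rw [← KilledProcess.dirichletForm_eq_semigroupForm]
  exact (hX i).2.2

-- Closedness of the minimal form is inherited from the semigroup of the diffusion, with whose form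
-- it agrees.
omit [∀ i, OrdConnected (I i)] in
theorem IsMinimalDiffusion.isClosedForm (hX : ∀ i, IsMinimalDiffusion (X i) (s i) (m i)) (i : Fin d) :
    (minimalScaleForm (s i) (m i)).IsClosedForm := by
  have h := (hX i).2.2
  rw [KilledProcess.dirichletForm_eq_semigroupForm (hX i).1 (hX i).2.1] at h
  exact (KilledProcess.isSymmSemigroup (hX i).1 (hX i).2.1).isClosedForm.of_agree h

/-- The given test function is put in the `i`-th slot and nonzero test functions in the others.
Their product is a test function on the box, and the domain of a product form passes to its factors.
-/
theorem mem_minimalScaleForm_of_smoothBox_subset [∀ i, (m i).IsOpenPosMeasure]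
    (hX : ∀ i, IsMinimalDiffusion (X i) (s i) (m i)) (e : ∀ i, I i)
    (hC : toL2 (Measure.pi m) (smoothBox I) ⊆
      ((KilledProcess.cartesian X).dirichletForm (Measure.pi m)).dom)
    (i : Fin d) (φ : ℝ → ℝ) (hφ : IsTest (I i) φ) (f : Lp ℝ 2 (m i)) (hf : f =ᵐ[m i] fun z => φ z) :
    f ∈ (minimalScaleForm (s i) (m i)).dom := by
  have hT := fun i => KilledProcess.isSymmSemigroup (hX i).1 (hX i).2.1
  have hP := KilledProcess.cartesian_isSymmSemigroup (fun i => (hX i).1) (fun i => (hX i).2.1) hT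
  choose η hη v hv hv0 using fun j => exists_isTest_ne_zero (m j) (e j)
  have htest : ∀ j, IsTest (I j) (Function.update η i φ j) := by
    intro j
    by_cases hj : j = i
    · subst hj
      rwa [Function.update_self]
    · rw [Function.update_of_ne hj]
      exact hη j
  have hF : ∀ j, Function.update v i f j =ᵐ[m j] fun z => Function.update η i φ j z := by
    intro j
    by_cases hj : j = i
    · subst hj
      rwa [Function.update_self, Function.update_self]
    · rw [Function.update_of_ne hj, Function.update_of_ne hj]
      exact hv j
  have hmem : tens (Function.update v i f) ∈ toL2 (Measure.pi m) (smoothBox I) :=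
    ⟨_, ⟨_, isTest_prod htest, rfl⟩, (coeFn_tens _).trans (prod_congr_ae hF)⟩
  have h1 := hC hmem
  rw [KilledProcess.cartesian_dirichletForm_eq (fun i => (hX i).1) fun i => (hX i).2.1] at h1
  have h2 := mem_dom_of_tens_mem_dom hT hP (KilledProcess.cartesianSemigroup_tens _ _) h1 i
    fun j hj => by
      rw [Function.update_of_ne hj]
      exact hv0 j
  rw [Function.update_self, ← KilledProcess.dirichletForm_eq_semigroupForm, (hX i).2.2.1] at h2
  exact h2

end Diffusions

end Diffusion

end

theorem theorem2p5 {d : ℕ} (hd : 2 ≤ d) (I : Fin d → Set ℝ) (hI : ∀ i, IsOpen (I i))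
    (hI' : ∀ i, (I i).OrdConnected) (e : ∀ i, I i)
    (s : ∀ i, I i → ℝ) (hs : ∀ i, Diffusion.IsScale (s i))
    (m : ∀ i, MeasureTheory.Measure (I i)) [∀ i, MeasureTheory.IsLocallyFiniteMeasure (m i)]
    [∀ i, (m i).IsOpenPosMeasure]
    (X : ∀ i, Diffusion.KilledProcess.{w, 0} (I i))
    (hX : ∀ i, Diffusion.IsMinimalDiffusion (X i) (s i) (m i))
    (𝓔 : Diffusion.L2Form (MeasureTheory.Measure.pi m))
    (h𝓔 : 𝓔 = (Diffusion.KilledProcess.cartesian X).dirichletForm (MeasureTheory.Measure.pi m))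
    (hC : Diffusion.toL2 (MeasureTheory.Measure.pi m) (Diffusion.smoothBox I) ⊆ 𝓔.dom) :
    (∀ i, Diffusion.IsScale (Diffusion.acPart (s i) (e i))) ∧
    Diffusion.IsCartesianForm
      (𝓔.closureOf (Diffusion.toL2 (MeasureTheory.Measure.pi m) (Diffusion.smoothBox I)))
      (fun i => Diffusion.minimalScaleForm (Diffusion.acPart (s i) (e i)) (m i)) ∧
    (∀ Xbar : ∀ i, Diffusion.KilledProcess.{w', 0} (I i),
      (∀ i, Diffusion.IsMinimalDiffusion (Xbar i) (Diffusion.acPart (s i) (e i)) (m i)) →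
      ((Diffusion.KilledProcess.cartesian Xbar).dirichletForm (MeasureTheory.Measure.pi m)).Agree
        (𝓔.closureOf (Diffusion.toL2 (MeasureTheory.Measure.pi m) (Diffusion.smoothBox I)))) ∧
    (𝓔.IsSpecialStandardCore (Diffusion.smoothBox I) ↔ ∀ i, Diffusion.IsAbsCont (s i)) := by
  subst h𝓔
  have hF : ∀ i, Fact (IsOpen (I i)) := fun i => ⟨hI i⟩
  have hcart := Diffusion.isCartesianForm_cartesian hX
  have hcl := Diffusion.IsMinimalDiffusion.isClosedForm hX
  have hmin := Diffusion.mem_minimalScaleForm_of_smoothBox_subset hX e hC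
  have hsm : ∀ i, Diffusion.HasSmoothDomain (s i) := fun i =>
    Diffusion.hasSmoothDomain_of_mem (m := m i) (hs i) fun φ hφ => by
      have hmem : MemLp (φ ∘ (Subtype.val : I i → ℝ)) 2 (m i) :=
        Diffusion.memLp_comp_scale Diffusion.isScale_val (by rwa [Subtype.range_val])
      exact ⟨hmem.toLp, (hmin i φ hφ _ hmem.coeFn_toLp).1, hmem.coeFn_toLp⟩
  have hsc := fun i => (hsm i).isScale_acPart (hs i) (e i)
  have hbar := hcart.closureOf_smoothBox hs hsm e hcl hmin hC
  refine ⟨hsc, hbar, fun Xbar hXbar => (Diffusion.isCartesianForm_cartesian hXbar).agree hbar,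
    fun hcore i => ?_, fun hac => Diffusion.isSpecialStandardCore_smoothBox hI hC ?_⟩
  -- A core is dense in the domain, so the closure of the test functions is everything; by its
  -- identification, the tensors for the `s̄ᵢ` span a dense subspace, which excludes a singular
  -- part.
  · refine Diffusion.isAbsCont_of_regSet (hs i)
      (hcart.regSet_compl_eq_zero hs hsm e hmin (fun u hu => ⟨hu, ?_⟩) i)
    exact (hbar.dense u (hcore.dense_dom u hu)).2
  -- For absolutely continuous scales the closure of the test functions and the whole form are
  -- Cartesian products of the same factors, and such a product is unique.
  · have heq : (fun i => Diffusion.minimalScaleForm (Diffusion.acPart (s i) (e i)) (m i)) =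
        fun i => Diffusion.minimalScaleForm (s i) (m i) :=
      funext fun i => (hac i).minimalScaleForm_acPart (hs i) (hsc i)
    rw [heq] at hbar
    intro u hu
    rw [← (hcart.agree hbar).1]
    exact hu
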